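/- Let $d\ge 2$, $N\ge1$, and let $A_1,\dots,A_d\in\mathcal M_N(\mathbb R)$ (the coefficients, frozen at $u=0$, of $\partial_t+\sum_j A_j\partial_j$ on the half-space $x_d>0$), with $A_d$ invertible. Write $L(\tau,\eta,\xi)=\tau I+\sum_{j<d}\eta_jA_j+\xi A_d$ and, for $\sigma\in\mathbb C$, $\eta\in\mathbb R^{d-1}$, $$\mathcal A(\sigma,\eta)=-i\,A_d^{-1}\Big(\sigma I+\sum_{j<d}\eta_jA_j\Big).$$ Assume strict hyperbolicity: there are real functions $\tau_1<\dots<\tau_N$, analytic on $\mathbb R^d\setminus\{0\}$, with $\det L(\tau,\eta,\xi)=\prod_k(\tau-\tau_k(\eta,\xi))$ for all $\tau\in\mathbb R$, $(\eta,\xi)\ne0$. Assume also that, for every $k$ and every $(\eta,\xi)\neq 0$, $\partial_\xi\tau_k(\eta,\xi)=0$ implies $\partial_\xi^2\tau_k(\eta,\xi)\ne0$. A real frequency $(\tau,\eta,\xi)$ with $(\eta,\xi)\ne0$ and $\tau=\tau_k(\eta,\xi)$ is called glancing, incoming or outgoing if $\partial_\xi\tau_k(\eta,\xi)$ is zero,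 negative or positive. Let $\mathcal G$ be the set of $\zeta=(\tau,\eta)\in\mathbb R^d\setminus\{0\}$ such that $(\zeta,\xi)$ is glancing for some $\xi\in\mathbb R$. For $\operatorname{Im}\sigma<0$, let $E_-(\sigma,\eta)$ be the sum of the generalized eigenspaces of $\mathcal A(\sigma,\eta)$ for the eigenvalues of negative real part, and for $\zeta\in\mathbb R^d\setminus\{0\}$ let $E_-(\zeta)$ be its continuous extension to $\zeta$, i.e. its limit as $(\sigma,\eta)\to\zeta$ with $\operatorname{Im}\sigma<0$. For $\zeta\in\mathbb R^d\setminus\{0\}$ let $E^e_-(\zeta)$ (resp. $E^e_+(\zeta)$) be the sum of the generalized eigenspaces of $\mathcal A(\zeta)$ for the eigenvalues of negative (resp. positive) real part, and let $E^{\rm in}(\zeta)$ (resp. $E^{\rm out}(\zeta)$) be the sum of the spaces $\ker L(\zeta,\xi)\subset\mathbb C^N$ over the real $\xi$ such that $(\zeta,\xi)$ is incoming (resp. outgoing). Let $\zeta_1,\dots,\zeta_m\in\mathbb R^d$, let $\mathcal F_b=\zeta_1\mathbb Z+\dots+\zeta_m\mathbb Z$, and assume the small-divisor condition: there are $a_1\in\mathbb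 R$ and $c>0$ such that $\operatorname{dist}(\zeta,\mathcal G)\ge c\,|\zeta|^{-a_1}$ for all $\zeta\in\mathcal F_b\setminus\{0\}$ (with $\operatorname{dist}(\zeta,\emptyset)=+\infty$). Then for every $\zeta\in\mathcal F_b\setminus\{0\}$ one has $$E_-(\zeta)=E^{\rm in}(\zeta)\oplus E^e_-(\zeta),\qquad \mathbb C^N=E^{\rm out}(\zeta)\oplus E^e_+(\zeta)\oplus E^{\rm in}(\zeta)\oplus E^e_-(\zeta).$$ Let $\Pi^e_-(\zeta)$, defined on $E_-(\zeta)$, and $\Pi^e_{\mathbb C^N}(\zeta)$, defined on $\mathbb C^N$, be the projections onto $E^e_-(\zeta)$ according to these decompositions. There are constants $C_1,c_1>0$ and real numbers $b_1,b_1'$ such that, for all $\zeta\in\mathcal F_b\setminus\{0\}$, in operator norm, $$\big|e^{t\mathcal A(\zeta)}\Pi^e_-(\zeta)\big|\le C_1e^{-c_1t|\zeta|^{-b_1}}\le C_1\qquad(t\ge0),$$ $$\big|e^{t\mathcal A(\zeta)}\Pi^e_{\mathbb C^N}(\zeta)\big|\le C_1|\zeta|^{b_1'}e^{-c_1t|\zeta|^{-b_1}}\qquad(t\ge0),$$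 $$\big|e^{t\mathcal A(\zeta)}\big(I-\Pi^e_{\mathbb C^N}(\zeta)\big)\big|\le C_1|\zeta|^{b_1'}\qquad(t\le0).$$ Moreover, if $\mathcal F_b$ is discrete, i.e. $|\zeta|\ge\rho$ on $\mathcal F_b\setminus\{0\}$ for some $\rho>0$, one can take $b_1'=b_1$. -/

import Mathlib

open Filter Topology

noncomputable section

namespace HypBVP

/-- The space of amplitudes `ℂ^N`, with its Hermitian norm. -/
abbrev Amp (N : ℕ) : Type := EuclideanSpace ℂ (Fin N)

/-- Real boundary frequencies `ζ = (τ, η) ∈ ℝ × ℝ^{d-1} = ℝ^d`, with the Euclidean norm of `ℝ^d`.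
Here and below `n` stands for `d - 1`. -/
abbrev Freq (n : ℕ) : Type := WithLp 2 (ℝ × EuclideanSpace ℝ (Fin n))

/-- The frozen coefficients `A_1(0), …, A_{d-1}(0)` (tangential) and `A_d(0)` (normal) of the
operator `∂_t + ∑ A_j(0) ∂_j`. -/
structure Coeffs (n N : ℕ) where
  tan : Fin n → Matrix (Fin N) (Fin N) ℝ
  nor : Matrix (Fin N) (Fin N) ℝ

variable {n N : ℕ}

/-- `∑_{j<d} η_j A_j(0)`. -/
def Coeffs.tanSymbol (S : Coeffs n N) (η : EuclideanSpace ℝ (Fin n)) :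
    Matrix (Fin N) (Fin N) ℝ :=
  ∑ j, η j • S.tan j

/-- The symbol `L(0, (τ, η, ξ)) = τ I + ∑_{j<d} η_j A_j(0) + ξ A_d(0)`. -/
def Coeffs.symbol (S : Coeffs n N) (τ : ℝ) (η : EuclideanSpace ℝ (Fin n)) (ξ : ℝ) :
    Matrix (Fin N) (Fin N) ℝ :=
  τ • (1 : Matrix (Fin N) (Fin N) ℝ) + S.tanSymbol η + ξ • S.nor

/-- `𝒜(σ, η) = -i A_d(0)⁻¹ (σ I + ∑_{j<d} η_j A_j(0))`, for `σ = τ - iγ ∈ ℂ`. -/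
def Coeffs.resolvent (S : Coeffs n N) (σ : ℂ) (η : EuclideanSpace ℝ (Fin n)) :
    Matrix (Fin N) (Fin N) ℂ :=
  (-Complex.I) • ((S.nor⁻¹).map Complex.ofReal *
    (σ • (1 : Matrix (Fin N) (Fin N) ℂ) + (S.tanSymbol η).map Complex.ofReal))

/-- `𝒜(σ, η)` as an operator on `ℂ^N`. -/
def Coeffs.opA (S : Coeffs n N) (σ : ℂ) (η : EuclideanSpace ℝ (Fin n)) : Amp N →L[ℂ] Amp N :=
  Matrix.toEuclideanCLM (𝕜 := ℂ) (S.resolvent σ η)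

/-- `𝒜(ζ)` for a real frequency `ζ = (τ, η)`. -/
def Coeffs.opAReal (S : Coeffs n N) (ζ : Freq n) : Amp N →L[ℂ] Amp N :=
  S.opA (ζ.fst : ℂ) ζ.snd

/-- `ker L(0, (ζ, ξ)) ⊆ ℂ^N`, for `ζ` and `ξ` real. -/
def Coeffs.kerSymbol (S : Coeffs n N) (ζ : Freq n) (ξ : ℝ) : Submodule ℂ (Amp N) :=
  LinearMap.ker
    (Matrix.toEuclideanCLM (𝕜 := ℂ) ((S.symbol ζ.fst ζ.snd ξ).map Complex.ofReal) :
      Amp N →L[ℂ] Amp N).toLinearMap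

/-- Strict hyperbolicity: `τ_1 < ⋯ < τ_N` are real analytic functions of
`(η, ξ) ∈ ℝ^d \ {0}` and `det L(0, (s, η, ξ)) = ∏_k (s - τ_k(η, ξ))` for all `s ∈ ℝ`. -/
structure Coeffs.StrictlyHyperbolic (S : Coeffs n N)
    (τ : Fin N → EuclideanSpace ℝ (Fin n) × ℝ → ℝ) : Prop where
  analytic : ∀ k, AnalyticOnNhd ℝ (τ k) {0}ᶜ
  strictMono : ∀ p : EuclideanSpace ℝ (Fin n) × ℝ, p ≠ 0 → StrictMono fun k => τ k p
  factor : ∀ p : EuclideanSpace ℝ (Fin n) × ℝ, p ≠ 0 → ∀ s : ℝ,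
    (S.symbol s p.1 p.2).det = ∏ k, (s - τ k p)

/-- The normal derivative `∂_ξ τ_k (η, ξ)`. -/
def dNormal (f : EuclideanSpace ℝ (Fin n) × ℝ → ℝ) (p : EuclideanSpace ℝ (Fin n) × ℝ) : ℝ :=
  deriv (fun s : ℝ => f (p.1, s)) p.2

/-- Wherever `∂_ξ τ_k` vanishes on `ℝ^d \ {0}`, the second derivative `∂_ξ² τ_k` does not. -/
def GlancingNondegenerate (τ : Fin N → EuclideanSpace ℝ (Fin n) × ℝ → ℝ) : Prop :=
  ∀ k, ∀ p : EuclideanSpace ℝ (Fin n) × ℝ, p ≠ 0 →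
    dNormal (τ k) p = 0 → dNormal (dNormal (τ k)) p ≠ 0

/-- `(ζ, ξ)` is a characteristic frequency, lying on the sheet `τ = τ_k(η, ξ)`, whose normal
derivative `∂_ξ τ_k(η, ξ)` satisfies `P`. -/
def CharWith (τ : Fin N → EuclideanSpace ℝ (Fin n) × ℝ → ℝ) (P : ℝ → Prop)
    (ζ : Freq n) (ξ : ℝ) : Prop :=
  (ζ.snd, ξ) ≠ (0 : EuclideanSpace ℝ (Fin n) × ℝ) ∧
    ∃ k, ζ.fst = τ k (ζ.snd, ξ) ∧ P (dNormal (τ k) (ζ.snd, ξ))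

/-- Glancing characteristic frequencies: `∂_ξ τ_k = 0`. -/
def Glancing (τ : Fin N → EuclideanSpace ℝ (Fin n) × ℝ → ℝ) : Freq n → ℝ → Prop :=
  CharWith τ fun v => v = 0

/-- Incoming characteristic frequencies: `∂_ξ τ_k < 0`. -/
def Incoming (τ : Fin N → EuclideanSpace ℝ (Fin n) × ℝ → ℝ) : Freq n → ℝ → Prop :=
  CharWith τ fun v => v < 0

/-- Outgoing characteristic frequencies: `∂_ξ τ_k > 0`. -/
def Outgoing (τ : Fin N → EuclideanSpace ℝ (Fin n) × ℝ → ℝ) : Freq n → ℝ → Prop :=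
  CharWith τ fun v => 0 < v

/-- The glancing set `𝒢 ⊆ ℝ^d \ {0}`. -/
def glancingSet (τ : Fin N → EuclideanSpace ℝ (Fin n) × ℝ → ℝ) : Set (Freq n) :=
  {ζ | ζ ≠ 0 ∧ ∃ ξ : ℝ, Glancing τ ζ ξ}

/-- The group `F_b = ζ_1 ℤ + ⋯ + ζ_m ℤ`. -/
def boundaryGroup {m : ℕ} (z : Fin m → Freq n) : AddSubgroup (Freq n) :=
  AddSubgroup.closure (Set.range z)

/-- Small divisors: there are `a ∈ ℝ` and `c > 0` with `dist(ζ, 𝒢) ≥ c |ζ|^{-a}` on `F_b \ {0}`.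
The distance is taken in `[0, ∞]`, so that it is `∞` if `𝒢` is empty. -/
def SmallDivisors (τ : Fin N → EuclideanSpace ℝ (Fin n) × ℝ → ℝ) {m : ℕ}
    (z : Fin m → Freq n) : Prop :=
  ∃ a c : ℝ, 0 < c ∧ ∀ ζ ∈ boundaryGroup z, ζ ≠ 0 →
    ENNReal.ofReal (c * ‖ζ‖ ^ (-a)) ≤ Metric.infEDist ζ (glancingSet τ)

/-- Sum of the generalized eigenspaces of `T` for the eigenvalues `μ` with `P (Re μ)`. -/
def spectralSum (T : Amp N →L[ℂ] Amp N) (P : ℝ → Prop) : Submodule ℂ (Amp N) :=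
  ⨆ (μ : ℂ) (_ : P μ.re), Module.End.maxGenEigenspace T.toLinearMap μ

/-- The stable subspace of `𝒜(σ, η)`; it is `E_-(σ, η)` if `Im σ < 0`. -/
def Coeffs.stable (S : Coeffs n N) (p : ℂ × EuclideanSpace ℝ (Fin n)) : Submodule ℂ (Amp N) :=
  spectralSum (S.opA p.1 p.2) fun r => r < 0

/-- `E_-(ζ)` for a real frequency `ζ`: the limit at `ζ` of the stable subspaces `E_-(σ, η)`,
`Im σ < 0`, that is, the set of limits of vectors of `E_-(σ, η)` as `(σ, η) → ζ`. -/
def Coeffs.Eminus (S : Coeffs n N) (ζ : Freq n) : Submodule ℂ (Amp N) where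
  carrier := {w | ∃ f : ℂ × EuclideanSpace ℝ (Fin n) → Amp N,
    (∀ p, p.1.im < 0 → f p ∈ S.stable p) ∧
      Tendsto f (𝓝[{p | p.1.im < 0}] ((ζ.fst : ℂ), ζ.snd)) (𝓝 w)}
  add_mem' := by
    rintro v w ⟨f, hf, hf'⟩ ⟨g, hg, hg'⟩
    exact ⟨fun p => f p + g p, fun p hp => add_mem (hf p hp) (hg p hp), hf'.add hg'⟩
  zero_mem' := ⟨fun _ => 0, fun _ _ => zero_mem _, tendsto_const_nhds⟩
  smul_mem' := by
    rintro a v ⟨f, hf, hf'⟩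
    exact ⟨fun p => a • f p, fun p hp => Submodule.smul_mem _ a (hf p hp), hf'.const_smul a⟩

/-- `E^e_-(ζ)`, the stable elliptic component: the sum of the generalized eigenspaces of `𝒜(ζ)` for
the eigenvalues `iξ` with `Im ξ > 0`, i.e. `Re (iξ) < 0`. -/
def Coeffs.ellMinus (S : Coeffs n N) (ζ : Freq n) : Submodule ℂ (Amp N) :=
  spectralSum (S.opAReal ζ) fun r => r < 0

/-- `E^e_+(ζ)`, the unstable elliptic component (eigenvalues `iξ` with `Im ξ < 0`). -/
def Coeffs.ellPlus (S : Coeffs n N) (ζ : Freq n) : Submodule ℂ (Amp N) :=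
  spectralSum (S.opAReal ζ) fun r => 0 < r

/-- The sum of the spaces `ker L(0, (ζ, ξ))` over the real `ξ` with `(ζ, ξ)` incoming. -/
def Coeffs.incSpace (S : Coeffs n N) (τ : Fin N → EuclideanSpace ℝ (Fin n) × ℝ → ℝ)
    (ζ : Freq n) : Submodule ℂ (Amp N) :=
  ⨆ (ξ : ℝ) (_ : Incoming τ ζ ξ), S.kerSymbol ζ ξ

/-- The sum of the spaces `ker L(0, (ζ, ξ))` over the real `ξ` with `(ζ, ξ)` outgoing. -/
def Coeffs.outSpace (S : Coeffs n N) (τ : Fin N → EuclideanSpace ℝ (Fin n) × ℝ → ℝ)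
    (ζ : Freq n) : Submodule ℂ (Amp N) :=
  ⨆ (ξ : ℝ) (_ : Outgoing τ ζ ξ), S.kerSymbol ζ ξ

open Classical in
/-- The projection onto `U` along `V` if `W = U ⊕ V` (and `0` otherwise). -/
def projAlong {W : Type*} [AddCommGroup W] [Module ℂ W] (U V : Submodule ℂ W) : W →ₗ[ℂ] W :=
  if h : IsCompl U V then U.projection V h else 0

/-- `Π^e_-(ζ)`, the projection of `E_-(ζ)` onto `E^e_-(ζ)` according to the decomposition of
`E_-(ζ)` into its elliptic and incoming components, for `ζ` not glancing. It is seen as a map from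
`E_-(ζ)` to `ℂ^N`. -/
def Coeffs.projMinus (S : Coeffs n N) (τ : Fin N → EuclideanSpace ℝ (Fin n) × ℝ → ℝ)
    (ζ : Freq n) : S.Eminus ζ →L[ℂ] Amp N :=
  LinearMap.toContinuousLinearMap ((S.Eminus ζ).subtype ∘ₗ
    projAlong ((S.ellMinus ζ).submoduleOf (S.Eminus ζ))
      ((S.incSpace τ ζ).submoduleOf (S.Eminus ζ)))

/-- `Π^e_{ℂ^N}(ζ)`, the projection of `ℂ^N` onto `E^e_-(ζ)` according to the decomposition of
`ℂ^N` into outgoing, unstable elliptic, incoming and stable elliptic components, for `ζ` not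
glancing. -/
def Coeffs.projFull (S : Coeffs n N) (τ : Fin N → EuclideanSpace ℝ (Fin n) × ℝ → ℝ)
    (ζ : Freq n) : Amp N →L[ℂ] Amp N :=
  LinearMap.toContinuousLinearMap
    (projAlong (S.ellMinus ζ) (S.outSpace τ ζ ⊔ S.ellPlus ζ ⊔ S.incSpace τ ζ))

/-- `e^{t𝒜(ζ)}`. -/
def Coeffs.expA (S : Coeffs n N) (t : ℝ) (ζ : Freq n) : Amp N →L[ℂ] Amp N :=
  NormedSpace.exp ((t : ℂ) • S.opAReal ζ)

/-- The decompositions `E_-(ζ) = Inc ⊕ E^e_-` and `ℂ^N = Out ⊕ E^e_+ ⊕ Inc ⊕ E^e_-` that define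
the projections `Π^e_-(ζ)` and `Π^e_{ℂ^N}(ζ)`. -/
structure Coeffs.Decomposes (S : Coeffs n N) (τ : Fin N → EuclideanSpace ℝ (Fin n) × ℝ → ℝ)
    (ζ : Freq n) : Prop where
  sup_minus : S.incSpace τ ζ ⊔ S.ellMinus ζ = S.Eminus ζ
  disjoint_minus : Disjoint (S.incSpace τ ζ) (S.ellMinus ζ)
  indep_full : iSupIndep
    ![S.outSpace τ ζ, S.ellPlus ζ, S.incSpace τ ζ, S.ellMinus ζ]
  sup_full : S.outSpace τ ζ ⊔ S.ellPlus ζ ⊔ S.incSpace τ ζ ⊔ S.ellMinus ζ = ⊤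

end HypBVP

end

/-!
The eigenvalues of `𝒜(σ, η)` are the numbers `iξ`, where `ξ` runs through the roots of the
polynomial `det L(σ, η, ·)`; so every assertion is one about these roots. On a sheet `τ = τ_k` the
derivatives of `det L` are those of `τ - τ_k` up to a common nonzero factor
(`Coeffs.derivs_on_sheet`). Hence glancing means that `ξ` is a real double root, with
`∂_σ det L ≠ 0` and `∂_ξ² det L ≠ 0`, and incoming or outgoing frequencies are recognized by the
sign of `∂_ξ det L · ∂_σ det L`. From there on only `det L` is used, through `Coeffs.Regular`.

*The space `E_-(ζ)`.* Since `det L` commutes with complex conjugation, its imaginary part near a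
real point is `Im σ ∂_σ det L + Im ξ ∂_ξ det L` to first order (`eventually_im_expansion`). So, as
`Im σ` becomes negative, a real root leaves the axis upwards exactly if it is incoming. Off the
glancing set the roots with a stable limit are therefore the stable ones, the polynomial in
`𝒜(σ, η)` formed with the stable roots converges, and `E_-(ζ)` is the kernel of its limit
(`Coeffs.Regular.Eminus_eq`). The limits are taken along ultrafilters, which makes it unnecessary
to choose the roots continuously.

*Gaps.* By homogeneity the unit sphere suffices, and it is compact. The map
`(τ, η, ξ) ↦ (det L, η, ∂_ξ det L)` is a local diffeomorphism at glancing points. Its inverse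
shows that a root which is nearly real and nearly double produces a nearby glancing frequency, so
that separation of the roots, from each other or from the real axis, is at least a multiple of the
distance to the glancing set (`Coeffs.Regular.exists_gap`). Among stable roots the separation is
even uniform (`Coeffs.Regular.exists_stable_gap`): of the two roots that merge at a glancing point
at most one is stable.

*Bounds.* If `∏ (B - μ_i)` annihilates a vector, the isolated `μ_i` can be split off one by one, at
the price of a power of (norm of `B`) / gap, and the others decay fast enough to absorb the powers
of `t` (`norm_exp_le_of_separated`). The same peeling bounds the projection between two groups
of eigenvalues at a given distance (`norm_right_le_of_gap`). On `E_-(ζ)` only gaps between stable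
roots enter, whence a uniform constant; on `ℂ^N` the gap is of the order of the distance to the
glancing set, which the small divisor condition bounds below by a power of `|ζ|`.
-/

open Filter Topology

noncomputable section

namespace HypBVP

open Polynomial

/-! ### Exponentials on kernels of polynomials -/

/-- The polynomial `∏_{i ∈ s} (X - μ_i)`. -/
def rootPoly {ι : Type*} (μ : ι → ℂ) (s : Finset ι) : ℂ[X] := ∏ i ∈ s, (X - C (μ i))

section ExpBounds

variable {ι E : Type*} [NormedAddCommGroup E] [NormedSpace ℂ E]

lemma rootPoly_insert [DecidableEq ι] {μ : ι → ℂ} {s : Finset ι} {a : ι} (ha : a ∉ s) :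
    rootPoly μ (insert a s) = (X - C (μ a)) * rootPoly μ s :=
  Finset.prod_insert ha

lemma aeval_X_sub_C_apply (B : E →L[ℂ] E) (a : ℂ) (w : E) :
    aeval B (X - C a) w = B w - a • w := by
  simp [Algebra.algebraMap_eq_smul_one]

lemma norm_aeval_rootPoly_le (B : E →L[ℂ] E) (μ : ι → ℂ) (s : Finset ι) {M : ℝ}
    (hM : ∀ i ∈ s, ‖aeval B (X - C (μ i))‖ ≤ M) :
    ‖aeval B (rootPoly μ s)‖ ≤ M ^ s.card := by
  classical
  induction s using Finset.induction_on with
  | empty =>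
    simp only [rootPoly, Finset.prod_empty, map_one, Finset.card_empty, pow_zero]
    exact ContinuousLinearMap.norm_id_le
  | insert a s ha ih =>
    rw [rootPoly_insert ha, map_mul, Finset.card_insert_of_notMem ha, pow_succ']
    have h1 := hM a (Finset.mem_insert_self _ _)
    have h2 := ih fun i hi => hM i (Finset.mem_insert_of_mem hi)
    exact (norm_mul_le _ _).trans (mul_le_mul h1 h2 (norm_nonneg _) ((norm_nonneg _).trans h1))

lemma pow_le_norm_eval_rootPoly (μ : ι → ℂ) (s : Finset ι) {a : ℂ} {g : ℝ} (hg : 0 ≤ g)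
    (h : ∀ i ∈ s, g ≤ ‖a - μ i‖) : g ^ s.card ≤ ‖(rootPoly μ s).eval a‖ := by
  rw [rootPoly, eval_prod, norm_prod, ← Finset.prod_const]
  exact Finset.prod_le_prod (fun _ _ => hg) fun i hi => by simpa using h i hi

/-- If `(X - a) r` annihilates `w` and `r(a) ≠ 0`, the component of `w` in the eigenspace of `a`
is `r(a)⁻¹ r(B) w`. -/
lemma exists_peel (B : E →L[ℂ] E) {a : ℂ} {r : ℂ[X]} (hr : r.eval a ≠ 0) (w : E) :
    let v := (r.eval a)⁻¹ • aeval B r w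
    (aeval B ((X - C a) * r) w = 0 → B v = a • v ∧ aeval B r (w - v) = 0) := by
  intro v hw
  have h1 : B v = a • v := by
    have : aeval B (X - C a) v = 0 := by
      simp only [v, map_smul]
      rw [map_mul, mul_apply_eq_comp] at hw
      rw [hw, smul_zero]
    rwa [aeval_X_sub_C_apply, sub_eq_zero] at this
  refine ⟨h1, ?_⟩
  obtain ⟨k, hk⟩ : (X - C a) ∣ (C (r.eval a) - r) := by
    rw [dvd_iff_isRoot]; simp
  have h2 : w - v = (r.eval a)⁻¹ • aeval B (C (r.eval a) - r) w := by
    simp [v, Algebra.algebraMap_eq_smul_one, smul_sub, smul_smul, hr]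
  rw [h2, map_smul, hk, ← mul_apply_eq_comp, ← map_mul]
  have : r * ((X - C a) * k) = k * ((X - C a) * r) := by ring
  rw [this, map_mul, mul_apply_eq_comp, hw, map_zero, smul_zero]

/-- The operator `r(B) / r(a)`, with `r = ∏ (X - μ_i)`, is bounded by a power of `M / g` if all `μ_i`
are at distance at least `g` from `a`. It is the spectral projection used to split off `a`. -/
lemma norm_peel_le (B : E →L[ℂ] E) (μ : ι → ℂ) (s : Finset ι) {a : ℂ} {g M : ℝ} {n : ℕ}
    (hg : 0 < g) (hgM : g ≤ M) (hs : s.card ≤ n)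
    (hM : ∀ i ∈ s, ‖aeval B (X - C (μ i))‖ ≤ M) (h : ∀ i ∈ s, g ≤ ‖a - μ i‖) (w : E) :
    (rootPoly μ s).eval a ≠ 0 ∧
      ‖((rootPoly μ s).eval a)⁻¹ • aeval B (rootPoly μ s) w‖ ≤ (M / g) ^ n * ‖w‖ := by
  have h1 := pow_le_norm_eval_rootPoly μ s hg.le h
  have h0 : 0 < g ^ s.card := by positivity
  have hne : (rootPoly μ s).eval a ≠ 0 := norm_pos_iff.1 (h0.trans_le h1)
  refine ⟨hne, ?_⟩
  rw [norm_smul, norm_inv]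
  have h2 := (aeval B (rootPoly μ s)).le_of_opNorm_le (norm_aeval_rootPoly_le B μ s hM) w
  have h3 : (M / g) ^ s.card ≤ (M / g) ^ n := pow_le_pow_right₀ ((one_le_div hg).2 hgM) hs
  calc _ ≤ (g ^ s.card)⁻¹ * (M ^ s.card * ‖w‖) := by gcongr
    _ = (M / g) ^ s.card * ‖w‖ := by rw [div_pow]; ring
    _ ≤ _ := by gcongr

/-- Two groups of eigenvalues at distance at least `g` are separated by a projection whose norm is
bounded by a power of `M / g`. -/
lemma norm_right_le_of_gap (B : E →L[ℂ] E) (μ : ι → ℂ) (s k : Finset ι) {g M : ℝ} {n : ℕ}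
    (hg : 0 < g) (hgM : g ≤ M) (hk : k.card ≤ n)
    (hM : ∀ i ∈ k, ‖aeval B (X - C (μ i))‖ ≤ M) (h : ∀ i ∈ s, ∀ j ∈ k, g ≤ ‖μ i - μ j‖)
    {u v : E} (hu : aeval B (rootPoly μ s) u = 0) (hv : aeval B (rootPoly μ k) v = 0) :
    ‖v‖ ≤ (1 + (M / g) ^ n) ^ s.card * ‖u + v‖ := by
  classical
  induction s using Finset.induction_on generalizing u with
  | empty =>
    have : u = 0 := by simpa [rootPoly] using hu
    simp [this]
  | insert a s ha ih =>
    obtain ⟨hne, -⟩ := norm_peel_le B μ k hg hgM hk hM (h a (Finset.mem_insert_self _ _)) u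
    obtain ⟨-, hn⟩ := norm_peel_le B μ k hg hgM hk hM (h a (Finset.mem_insert_self _ _)) (u + v)
    set r := rootPoly μ k
    -- `1 - r(B) / r(a)` fixes `v` and removes the factor of `a` from the polynomial killing `u`
    set u' := u - (r.eval (μ a))⁻¹ • aeval B r u
    have hu' : aeval B (rootPoly μ s) u' = 0 := by
      obtain ⟨c, hc⟩ : (X - C (μ a)) ∣ (C (r.eval (μ a)) - r) := by
        rw [dvd_iff_isRoot]; simp
      have h2 : u' = (r.eval (μ a))⁻¹ • aeval B (C (r.eval (μ a)) - r) u := by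
        simp [u', Algebra.algebraMap_eq_smul_one, smul_sub, smul_smul, hne]
      rw [rootPoly_insert ha] at hu
      rw [h2, map_smul, hc, ← mul_apply_eq_comp, ← map_mul]
      have : rootPoly μ s * ((X - C (μ a)) * c) = c * ((X - C (μ a)) * rootPoly μ s) := by ring
      rw [this, map_mul, mul_apply_eq_comp, hu, map_zero, smul_zero]
    have h3 := ih (fun i hi => h i (Finset.mem_insert_of_mem hi)) hu'
    have h4 : u' + v = (u + v) - (r.eval (μ a))⁻¹ • aeval B r (u + v) := by
      simp only [u', map_add, hv, add_zero]; abel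
    rw [Finset.card_insert_of_notMem ha, pow_succ, mul_assoc]
    have h5 : (0:ℝ) ≤ M / g := div_nonneg (hg.le.trans hgM) hg.le
    refine h3.trans (mul_le_mul_of_nonneg_left ?_ (by positivity))
    rw [h4, add_mul, one_mul]
    exact (norm_sub_le _ _).trans (by gcongr)

variable [CompleteSpace E]

lemma hasDerivAt_exp_smul_apply (B : E →L[ℂ] E) (w : E) (t : ℝ) :
    HasDerivAt (fun s : ℝ => NormedSpace.exp ((s : ℂ) • B) w)
      (NormedSpace.exp ((t : ℂ) • B) (B w)) t := by
  have h := (hasDerivAt_exp_smul_const B (t : ℂ)).scomp t Complex.ofRealCLM.hasDerivAt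
  have h2 := ((ContinuousLinearMap.apply ℂ E w).restrictScalars ℝ).hasFDerivAt.comp_hasDerivAt t h
  simpa [Function.comp_def] using h2

lemma exp_smul_apply_of_eigenvector (B : E →L[ℂ] E) {a : ℂ} {v : E} (h : B v = a • v) (t : ℝ) :
    NormedSpace.exp ((t : ℂ) • B) v = Complex.exp (t * a) • v := by
  have h0 : ∀ s : ℝ, HasDerivAt (fun s : ℝ => Complex.exp (-(s * a)) •
      NormedSpace.exp ((s : ℂ) • B) v) 0 s := by
    intro s
    have h1 : HasDerivAt (fun s : ℝ => Complex.exp (-(s * a))) (Complex.exp (-(s * a)) * (-a)) s := by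
      have : HasDerivAt (fun s : ℝ => -((s : ℂ) * a)) (-a) s := by
        simpa [Pi.neg_def] using ((Complex.ofRealCLM.hasDerivAt (x := s)).mul_const a).neg
      exact this.cexp
    refine (h1.smul (hasDerivAt_exp_smul_apply B v s)).congr_deriv ?_
    rw [h, map_smul, smul_smul, ← add_smul]; simp
  have h2 : Complex.exp (-(t * a)) • NormedSpace.exp ((t : ℂ) • B) v = v := by
    have := is_const_of_deriv_eq_zero (fun s => (h0 s).differentiableAt) (fun s => (h0 s).deriv) t 0
    simpa using this
  conv_rhs => rw [← h2]
  rw [smul_smul, ← Complex.exp_add]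
  simp

/-- Exponential decay with a polynomial loss, for a vector annihilated by `∏ (B - μ_i)`. -/
lemma norm_exp_le_poly_mul_exp (B : E →L[ℂ] E) (μ : ι → ℂ) (s : Finset ι) {δ M : ℝ} (hM0 : 0 ≤ M)
    (hM : ∀ i ∈ s, ‖aeval B (X - C (μ i))‖ ≤ M) (hre : ∀ i ∈ s, (μ i).re ≤ -δ) {w : E}
    (hw : aeval B (rootPoly μ s) w = 0) {t : ℝ} (ht : 0 ≤ t) :
    ‖NormedSpace.exp ((t : ℂ) • B) w‖ ≤ Real.exp (-(δ * t)) * (1 + M * t) ^ s.card * ‖w‖ := by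
  classical
  induction s using Finset.induction_on generalizing w t with
  | empty =>
    have : w = 0 := by simpa [rootPoly] using hw
    simp [this]
  | insert a s ha ih =>
    set v := aeval B (X - C (μ a)) w with hv
    have hv0 : aeval B (rootPoly μ s) v = 0 := by
      rwa [hv, ← mul_apply_eq_comp, ← map_mul, mul_comm, ← rootPoly_insert ha]
    have hvn : ‖v‖ ≤ M * ‖w‖ :=
      (aeval B (X - C (μ a))).le_of_opNorm_le (hM a (Finset.mem_insert_self _ _)) w
    have hrea := hre a (Finset.mem_insert_self _ _)
    have ih' := fun {r : ℝ} (hr : 0 ≤ r) => ih (fun i hi => hM i (Finset.mem_insert_of_mem hi))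
      (fun i hi => hre i (Finset.mem_insert_of_mem hi)) hv0 hr
    -- Duhamel: the derivative of `e^{-sμ} e^{sB} w` is `e^{-sμ} e^{sB} v`
    have hd : ∀ r : ℝ, HasDerivAt (fun s : ℝ => Complex.exp (-(s * μ a)) •
        NormedSpace.exp ((s : ℂ) • B) w)
        (Complex.exp (-(r * μ a)) • NormedSpace.exp ((r : ℂ) • B) v) r := by
      intro r
      have h1 : HasDerivAt (fun s : ℝ => Complex.exp (-(s * μ a)))
          (Complex.exp (-(r * μ a)) * (-μ a)) r := by
        have : HasDerivAt (fun s : ℝ => -((s : ℂ) * μ a)) (-μ a) r := by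
          simpa [Pi.neg_def] using ((Complex.ofRealCLM.hasDerivAt (x := r)).mul_const (μ a)).neg
        exact this.cexp
      refine (h1.smul (hasDerivAt_exp_smul_apply B w r)).congr_deriv ?_
      rw [hv, aeval_X_sub_C_apply, map_sub, map_smul, smul_sub, smul_smul, mul_neg, neg_smul]
      abel
    have hbd : ∀ r ∈ Set.Ico (0 : ℝ) t, ‖Complex.exp (-(r * μ a)) •
        NormedSpace.exp ((r : ℂ) • B) v‖ ≤
        Real.exp (-(δ + (μ a).re) * t) * (1 + M * t) ^ s.card * ‖v‖ := by
      intro r hr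
      rw [norm_smul, Complex.norm_exp]
      have e1 : (-((r : ℂ) * μ a)).re = -(r * (μ a).re) := by simp
      rw [e1]
      have hr0 : 0 ≤ r := hr.1
      have hrt : r ≤ t := hr.2.le
      calc _ ≤ Real.exp (-(r * (μ a).re)) *
            (Real.exp (-(δ * r)) * (1 + M * r) ^ s.card * ‖v‖) := by gcongr; exact ih' hr0
        _ = Real.exp (-(δ + (μ a).re) * r) * (1 + M * r) ^ s.card * ‖v‖ := by
            rw [← mul_assoc, ← mul_assoc, ← Real.exp_add]; ring_nf
        _ ≤ _ := by
            have : -(δ + (μ a).re) * r ≤ -(δ + (μ a).re) * t :=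
              mul_le_mul_of_nonneg_left hrt (by linarith)
            gcongr
    have key := norm_image_sub_le_of_norm_deriv_le_segment' (fun r _ => (hd r).hasDerivWithinAt)
      hbd t ⟨ht, le_rfl⟩
    simp only [Complex.ofReal_zero, zero_mul, neg_zero, Complex.exp_zero, zero_smul,
      NormedSpace.exp_zero, one_smul, one_apply_eq_self, sub_zero] at key
    have h5 : NormedSpace.exp ((t : ℂ) • B) w = Complex.exp (t * μ a) •
        (Complex.exp (-(t * μ a)) • NormedSpace.exp ((t : ℂ) • B) w) := by
      rw [smul_smul, ← Complex.exp_add]; simp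
    have h6 : ‖Complex.exp (-(t * μ a)) • NormedSpace.exp ((t : ℂ) • B) w‖ ≤
        ‖w‖ + Real.exp (-(δ + (μ a).re) * t) * (1 + M * t) ^ s.card * (M * ‖w‖) * t := by
      refine (norm_le_norm_add_norm_sub' _ w).trans (add_le_add le_rfl (key.trans ?_))
      gcongr
    have e2 : ((t : ℂ) * μ a).re = (μ a).re * t := by simp [mul_comm]
    rw [h5, norm_smul, Complex.norm_exp, e2, Finset.card_insert_of_notMem ha]
    have h7 : Real.exp ((μ a).re * t) ≤ Real.exp (-(δ * t)) := by
      apply Real.exp_le_exp.2; nlinarith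
    have h8 : Real.exp ((μ a).re * t) * Real.exp (-(δ + (μ a).re) * t) = Real.exp (-(δ * t)) := by
      rw [← Real.exp_add]; ring_nf
    have h9 : 1 ≤ (1 + M * t) ^ s.card := one_le_pow₀ (by nlinarith [mul_nonneg hM0 ht])
    calc _ ≤ Real.exp ((μ a).re * t) * (‖w‖ + Real.exp (-(δ + (μ a).re) * t) *
          (1 + M * t) ^ s.card * (M * ‖w‖) * t) := by gcongr
      _ = Real.exp ((μ a).re * t) * ‖w‖ +
          Real.exp (-(δ * t)) * ((1 + M * t) ^ s.card * (M * t) * ‖w‖) := by rw [← h8]; ring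
      _ ≤ Real.exp (-(δ * t)) * ((1 + M * t) ^ s.card * ‖w‖) +
          Real.exp (-(δ * t)) * ((1 + M * t) ^ s.card * (M * t) * ‖w‖) := by
            gcongr
            exact le_mul_of_one_le_left (norm_nonneg _) h9
      _ = _ := by ring

/-- A polynomial factor in `t` is absorbed by `e^{gt}`; writing `e^{gt}` as a power of
`e^{gt / (n + 1)}` reduces this to `1 + x ≤ e^x`. -/
lemma one_add_mul_pow_le_exp {M g t : ℝ} (n : ℕ) (hg : 0 < g) (hgM : g ≤ M) (ht : 0 ≤ t) :
    (1 + M * t) ^ n ≤ ((n + 1) * (M / g)) ^ n * Real.exp (g * t) := by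
  have hM : 0 < M := hg.trans_le hgM
  have h1 : 1 ≤ M / g := (one_le_div hg).2 hgM
  have h2 : 1 + M * t ≤ ((n + 1) * (M / g)) * Real.exp (g * t / (n + 1)) := by
    have h3 := Real.add_one_le_exp (g * t / (n + 1))
    calc 1 + M * t ≤ ((n + 1) * (M / g)) * (g * t / (n + 1) + 1) := by
          have : ((n + 1 : ℝ) * (M / g)) * (g * t / (n + 1) + 1) = M * t + (n + 1) * (M / g) := by
            field_simp
          rw [this]
          nlinarith [Nat.cast_nonneg (α := ℝ) n]
      _ ≤ _ := by gcongr
  calc (1 + M * t) ^ n ≤ (((n + 1) * (M / g)) * Real.exp (g * t / (n + 1))) ^ n := by gcongr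
    _ = ((n + 1) * (M / g)) ^ n * Real.exp (n * (g * t / (n + 1))) := by
        rw [mul_pow, Real.exp_nat_mul]
    _ ≤ _ := by
        have : n * (g * t / (n + 1)) ≤ g * t := by
          rw [mul_div_assoc', div_le_iff₀ (by positivity)]
          nlinarith [mul_nonneg hg.le ht]
        gcongr

/-- The eigenvalues `μ_i` have real part at most `-γ`, and any two of them are at distance at least
`g` unless both have real part at most `-(γ + g)`. Then the decay `e^{-γt}` holds without loss in
`t`, and the constant depends polynomially on `M / g`. The isolated eigenvalues are split off one
by one; the others decay fast enough to absorb their polynomial factor. -/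
theorem norm_exp_le_of_separated (B : E →L[ℂ] E) (μ : ι → ℂ) (s : Finset ι) {g M γ : ℝ} {n : ℕ}
    (hg : 0 < g) (hgM : g ≤ M) (hs : s.card ≤ n)
    (hM : ∀ i ∈ s, ‖aeval B (X - C (μ i))‖ ≤ M) (hre : ∀ i ∈ s, (μ i).re ≤ -γ)
    (hsep : ∀ i ∈ s, ∀ j ∈ s, i ≠ j →
      g ≤ ‖μ i - μ j‖ ∨ ((μ i).re ≤ -(γ + g) ∧ (μ j).re ≤ -(γ + g)))
    {w : E} (hw : aeval B (rootPoly μ s) w = 0) {t : ℝ} (ht : 0 ≤ t) :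
    ‖NormedSpace.exp ((t : ℂ) • B) w‖ ≤
      ((3 * (n + 1)) ^ n * (M / g) ^ (n + n * n)) * Real.exp (-(γ * t)) * ‖w‖ := by
  classical
  set R := (M / g) ^ n with hR
  set L := ((n + 1) * (M / g)) ^ n with hL
  have h1 : 1 ≤ M / g := (one_le_div hg).2 hgM
  have hM0 : 0 < M := hg.trans_le hgM
  have hR1 : 1 ≤ R := one_le_pow₀ h1
  have hL1 : 1 ≤ L := one_le_pow₀ (by nlinarith [Nat.cast_nonneg (α := ℝ) n])
  set s₂ := s.filter fun i => (μ i).re ≤ -(γ + g)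
  -- splitting off the isolated eigenvalues in a set `s₁`
  have main : ∀ s₁ : Finset ι, s₁ ⊆ s → Disjoint s₁ s₂ → ∀ w : E,
      aeval B (rootPoly μ (s₁ ∪ s₂)) w = 0 →
      ‖NormedSpace.exp ((t : ℂ) • B) w‖ ≤ L * (1 + 2 * R) ^ s₁.card * Real.exp (-(γ * t)) * ‖w‖ := by
    intro s₁
    induction s₁ using Finset.induction_on with
    | empty =>
      intro _ _ w hw
      rw [Finset.empty_union] at hw
      have h2 := norm_exp_le_poly_mul_exp B μ s₂ hM0.le
        (fun i hi => hM i (Finset.filter_subset _ _ hi)) (δ := γ + g)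
        (fun i hi => (Finset.mem_filter.1 hi).2) hw ht
      have h3 : (1 + M * t) ^ s₂.card ≤ (1 + M * t) ^ n :=
        pow_le_pow_right₀ (by nlinarith [mul_nonneg hM0.le ht])
          ((Finset.card_le_card (Finset.filter_subset _ _)).trans hs)
      have h4 := one_add_mul_pow_le_exp n hg hgM ht
      calc _ ≤ Real.exp (-((γ + g) * t)) * (L * Real.exp (g * t)) * ‖w‖ := by
            refine h2.trans ?_
            gcongr
            exact h3.trans h4
        _ = _ := by
            have : Real.exp (-(γ * t)) = Real.exp (-((γ + g) * t)) * Real.exp (g * t) := by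
              rw [← Real.exp_add]; ring_nf
            rw [this, Finset.card_empty, pow_zero]; ring
    | insert a s₁ ha ih =>
      intro hsub hdis w hw
      have has : a ∈ s := hsub (Finset.mem_insert_self _ _)
      have ha2 : a ∉ s₂ := Finset.disjoint_left.1 hdis (Finset.mem_insert_self _ _)
      have hau : a ∉ s₁ ∪ s₂ := by simp [ha, ha2]
      have hus : s₁ ∪ s₂ ⊆ s := Finset.union_subset
        ((Finset.subset_insert _ _).trans hsub) (Finset.filter_subset _ _)
      have hsepa : ∀ i ∈ s₁ ∪ s₂, g ≤ ‖μ a - μ i‖ := by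
        intro i hi
        rcases hsep a has i (hus hi) (fun h => hau (h ▸ hi)) with h | h
        · exact h
        · exact absurd (Finset.mem_filter.2 ⟨has, h.1⟩) ha2
      obtain ⟨hne, hn⟩ := norm_peel_le B μ (s₁ ∪ s₂) hg hgM ((Finset.card_le_card hus).trans hs)
        (fun i hi => hM i (hus hi)) hsepa w
      rw [Finset.insert_union, rootPoly_insert hau] at hw
      obtain ⟨hp1, hp2⟩ := exists_peel B hne w hw
      set v := ((rootPoly μ (s₁ ∪ s₂)).eval (μ a))⁻¹ • aeval B (rootPoly μ (s₁ ∪ s₂)) w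
      have h3 := ih ((Finset.subset_insert _ _).trans hsub)
        (hdis.mono_left (Finset.subset_insert _ _)) (w - v) hp2
      have h4 : ‖NormedSpace.exp ((t : ℂ) • B) v‖ ≤ Real.exp (-(γ * t)) * ‖v‖ := by
        rw [exp_smul_apply_of_eigenvector B hp1, norm_smul, Complex.norm_exp]
        gcongr
        have := hre a has
        simp only [Complex.mul_re, Complex.ofReal_re, Complex.ofReal_im, zero_mul, sub_zero]
        nlinarith
      have h5 : ‖w - v‖ ≤ (1 + R) * ‖w‖ := by
        rw [add_mul, one_mul]; exact (norm_sub_le _ _).trans (by gcongr)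
      set e := Real.exp (-(γ * t))
      set Q := (1 + 2 * R) ^ s₁.card with hQ
      have hQ1 : 1 ≤ Q := one_le_pow₀ (by linarith)
      have hLQ : 1 ≤ L * Q := one_le_mul_of_one_le_of_one_le hL1 hQ1
      rw [Finset.card_insert_of_notMem ha, pow_succ, ← hQ]
      calc ‖NormedSpace.exp ((t : ℂ) • B) w‖
          = ‖NormedSpace.exp ((t : ℂ) • B) v + NormedSpace.exp ((t : ℂ) • B) (w - v)‖ := by
            rw [← map_add]; simp
        _ ≤ e * (R * ‖w‖) + L * Q * e * ((1 + R) * ‖w‖) := by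
            refine (norm_add_le _ _).trans (add_le_add (h4.trans ?_) (h3.trans ?_)) <;> gcongr
        _ ≤ L * Q * (e * (R * ‖w‖)) + L * Q * e * ((1 + R) * ‖w‖) := by
            exact add_le_add (le_mul_of_one_le_left (by positivity) hLQ) le_rfl
        _ = _ := by ring
  have hun : (s \ s₂) ∪ s₂ = s := Finset.sdiff_union_of_subset (Finset.filter_subset _ _)
  have h2 := main (s \ s₂) Finset.sdiff_subset Finset.sdiff_disjoint w (by rwa [hun])
  refine h2.trans ?_
  have h3 : (1 + 2 * R) ^ (s \ s₂).card ≤ (1 + 2 * R) ^ n :=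
    pow_le_pow_right₀ (by linarith) ((Finset.card_le_card Finset.sdiff_subset).trans hs)
  have h4 : (1 + 2 * R) ^ n ≤ (3 * R) ^ n := by gcongr; linarith
  have h5 : L * (3 * R) ^ n = (3 * (n + 1)) ^ n * (M / g) ^ (n + n * n) := by
    rw [hL, hR, pow_add, pow_mul]; simp only [mul_pow]; ring
  rw [← h5]
  gcongr
  exact h3.trans h4

end ExpBounds

/-! ### Sums of generalized eigenspaces -/

section SpectralSpaces

variable {N : ℕ} {ι : Type*}

/-- The sum of the generalized eigenspaces of `T` for the eigenvalues `μ` satisfying `P`. -/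
def specSpace (T : Amp N →L[ℂ] Amp N) (P : ℂ → Prop) : Submodule ℂ (Amp N) :=
  ⨆ (μ : ℂ) (_ : P μ), Module.End.maxGenEigenspace T.toLinearMap μ

/-- `μ` lists the eigenvalues of `T` with their algebraic multiplicities. -/
def IsSpectrum [Fintype ι] (T : Amp N →L[ℂ] Amp N) (μ : ι → ℂ) : Prop :=
  T.toLinearMap.charpoly = rootPoly μ Finset.univ

lemma aeval_toLinearMap_apply (T : Amp N →L[ℂ] Amp N) (p : ℂ[X]) (w : Amp N) :
    aeval T.toLinearMap p w = aeval T p w := by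
  induction p using Polynomial.induction_on' with
  | add p q hp hq => simp [hp, hq]
  | monomial n a =>
    simp only [aeval_monomial, Algebra.algebraMap_eq_smul_one, smul_mul_assoc, one_mul,
      LinearMap.smul_apply, smul_apply]
    rw [← ContinuousLinearMap.toLinearMap_pow]
    rfl

lemma isCoprime_rootPoly {κ : Type*} {μ : ι → ℂ} {ν : κ → ℂ} {s : Finset ι} {t : Finset κ}
    (h : ∀ i ∈ s, ∀ j ∈ t, μ i ≠ ν j) : IsCoprime (rootPoly μ s) (rootPoly ν t) :=
  IsCoprime.prod_left fun i hi => IsCoprime.prod_right fun j hj =>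
    isCoprime_X_sub_C_of_isUnit_sub (sub_ne_zero.2 (h i hi j hj)).isUnit

lemma eq_zero_of_isCoprime (T : Amp N →L[ℂ] Amp N) {p q : ℂ[X]} (h : IsCoprime p q) {w : Amp N}
    (hp : aeval T p w = 0) (hq : aeval T q w = 0) : w = 0 := by
  obtain ⟨a, b, hab⟩ := h
  have := congrArg (fun r => aeval T r w) hab
  simpa [hp, hq] using this.symm

lemma rootPoly_filter_mul_filter_not [Fintype ι] (μ : ι → ℂ) (P : ι → Prop) [DecidablePred P] :
    rootPoly μ (Finset.univ.filter P) * rootPoly μ (Finset.univ.filter fun i => ¬ P i) =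
      rootPoly μ Finset.univ :=
  Finset.prod_filter_mul_prod_filter_not _ _ _

lemma specSpace_sup (T : Amp N →L[ℂ] Amp N) (P Q : ℂ → Prop) :
    specSpace T P ⊔ specSpace T Q = specSpace T fun μ => P μ ∨ Q μ := by
  simp only [specSpace, iSup_or, iSup_sup_eq]

lemma specSpace_disjoint (T : Amp N →L[ℂ] Amp N) {P Q : ℂ → Prop} (h : ∀ μ, P μ → ¬ Q μ) :
    Disjoint (specSpace T P) (specSpace T Q) :=
  (Module.End.independent_maxGenEigenspace T.toLinearMap).disjoint_biSup_biSup
    (s := {μ | P μ}) (t := {μ | Q μ}) (Set.disjoint_left.2 h)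

lemma specSpace_iSupIndep {κ : Type*} (T : Amp N →L[ℂ] Amp N) (P : κ → ℂ → Prop)
    (h : ∀ i j, i ≠ j → ∀ μ, P i μ → ¬ P j μ) : iSupIndep fun i => specSpace T (P i) := by
  intro i
  refine (specSpace_disjoint T (P := P i) (Q := fun μ => ∃ j, j ≠ i ∧ P j μ) ?_).mono_right ?_
  · rintro μ hμ ⟨j, hj, hj'⟩
    exact h i j hj.symm μ hμ hj'
  · refine iSup₂_le fun j hj => iSup₂_le fun μ hμ => ?_
    exact le_iSup₂_of_le (f := fun (μ : ℂ) (_ : ∃ j, j ≠ i ∧ P j μ) =>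
      Module.End.maxGenEigenspace T.toLinearMap μ) μ ⟨j, hj, hμ⟩ le_rfl

variable [Fintype ι] {T : Amp N →L[ℂ] Amp N} {μ : ι → ℂ}

lemma IsSpectrum.aeval_eq_zero (h : IsSpectrum T μ) (w : Amp N) :
    aeval T (rootPoly μ Finset.univ) w = 0 := by
  rw [← aeval_toLinearMap_apply, ← h, LinearMap.aeval_self_charpoly, LinearMap.zero_apply]

open Classical in
/-- A sum of generalized eigenspaces is the kernel of a polynomial in `T` whose coefficients depend
continuously on the eigenvalues. -/
lemma IsSpectrum.mem_specSpace_iff (h : IsSpectrum T μ) (P : ℂ → Prop) {w : Amp N} :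
    w ∈ specSpace T P ↔ aeval T (rootPoly μ (Finset.univ.filter fun i => P (μ i))) w = 0 := by
  have key : ∀ P : ℂ → Prop, ∀ w ∈ specSpace T P,
      aeval T (rootPoly μ (Finset.univ.filter fun i => P (μ i))) w = 0 := by
    intro P w hw
    have hle : specSpace T P ≤ LinearMap.ker
        (aeval T (rootPoly μ (Finset.univ.filter fun i => P (μ i)))).toLinearMap := by
      refine iSup₂_le fun a ha w hw => ?_
      rw [Module.End.mem_maxGenEigenspace] at hw
      obtain ⟨k, hk⟩ := hw
      rw [LinearMap.mem_ker]
      refine eq_zero_of_isCoprime T (p := (X - C a) ^ k)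
        (q := rootPoly μ (Finset.univ.filter fun i => ¬ P (μ i))) ?_ ?_ ?_
      · have h1 := isCoprime_rootPoly (μ := fun _ : Unit => a) (ν := μ) (s := {()})
          (t := Finset.univ.filter fun i => ¬ P (μ i)) (by
            intro _ _ j hj he
            exact (Finset.mem_filter.1 hj).2 (he ▸ ha))
        rw [rootPoly, Finset.prod_singleton] at h1
        exact h1.pow_left
      · change aeval T _ (aeval T _ w) = 0
        rw [← mul_apply_eq_comp, ← map_mul, mul_comm, map_mul, mul_apply_eq_comp]
        have : aeval T ((X - C a) ^ k) w = 0 := by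
          rw [← aeval_toLinearMap_apply, map_pow, map_sub, aeval_X, aeval_C]
          exact hk
        rw [this, map_zero]
      · change aeval T _ (aeval T _ w) = 0
        rw [← mul_apply_eq_comp, ← map_mul, mul_comm,
          rootPoly_filter_mul_filter_not μ fun i => P (μ i)]
        exact h.aeval_eq_zero w
    exact hle hw
  refine ⟨key P w, fun hw => ?_⟩
  have htop : w ∈ specSpace T P ⊔ specSpace T fun μ => ¬ P μ := by
    rw [specSpace_sup]
    have : specSpace T (fun μ => P μ ∨ ¬ P μ) = ⊤ := by
      rw [← Module.End.iSup_maxGenEigenspace_eq_top T.toLinearMap]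
      simp [specSpace, Classical.em]
    rw [this]; trivial
  obtain ⟨a, ha, b, hb, rfl⟩ := Submodule.mem_sup.1 htop
  rw [map_add, key P a ha, zero_add] at hw
  have hb0 : b = 0 := eq_zero_of_isCoprime T
    (isCoprime_rootPoly (μ := μ) (ν := μ) (s := Finset.univ.filter fun i => P (μ i))
      (t := Finset.univ.filter fun i => ¬ P (μ i)) (by
        intro i hi j hj he
        exact (Finset.mem_filter.1 hj).2 (he ▸ (Finset.mem_filter.1 hi).2))) hw (by convert key _ b hb)
  simpa [hb0] using ha

open Classical in
lemma IsSpectrum.aeval_mem_specSpace (h : IsSpectrum T μ) (P : ℂ → Prop) (v : Amp N) :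
    aeval T (rootPoly μ (Finset.univ.filter fun i => ¬ P (μ i))) v ∈ specSpace T P := by
  rw [h.mem_specSpace_iff, ← mul_apply_eq_comp, ← map_mul,
    rootPoly_filter_mul_filter_not μ fun i => P (μ i)]
  exact h.aeval_eq_zero v

open Classical in
/-- A sum of generalized eigenspaces is also the range of the complementary polynomial in `T`. -/
lemma IsSpectrum.exists_aeval_eq (h : IsSpectrum T μ) (P : ℂ → Prop) {w : Amp N}
    (hw : w ∈ specSpace T P) :
    ∃ v, aeval T (rootPoly μ (Finset.univ.filter fun i => ¬ P (μ i))) v = w := by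
  rw [h.mem_specSpace_iff] at hw
  obtain ⟨a, b, hab⟩ := isCoprime_rootPoly (μ := μ) (ν := μ)
    (s := Finset.univ.filter fun i => P (μ i))
    (t := Finset.univ.filter fun i => ¬ P (μ i)) (by
      intro i hi j hj he
      exact (Finset.mem_filter.1 hj).2 (he ▸ (Finset.mem_filter.1 hi).2))
  refine ⟨aeval T b w, ?_⟩
  rw [← mul_apply_eq_comp, ← map_mul, mul_comm]
  have := congrArg (fun r => aeval T r w) hab
  simpa [hw] using this

lemma IsSpectrum.specSpace_congr (h : IsSpectrum T μ) {P Q : ℂ → Prop}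
    (hPQ : ∀ i, P (μ i) ↔ Q (μ i)) : specSpace T P = specSpace T Q := by
  classical
  ext w
  rw [h.mem_specSpace_iff, h.mem_specSpace_iff, Finset.filter_congr fun i _ => hPQ i]

lemma IsSpectrum.specSpace_eq_top (h : IsSpectrum T μ) {P : ℂ → Prop}
    (hP : ∀ i, P (μ i)) : specSpace T P = ⊤ := by
  classical
  ext w
  rw [h.mem_specSpace_iff]
  simpa [hP] using h.aeval_eq_zero w

/-- At a simple eigenvalue the generalized eigenspace is the eigenspace. -/
lemma IsSpectrum.maxGenEigenspace_eq (h : IsSpectrum T μ) {i : ι}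
    (hi : ∀ j, j ≠ i → μ j ≠ μ i) {w : Amp N} :
    w ∈ Module.End.maxGenEigenspace T.toLinearMap (μ i) ↔ T w = μ i • w := by
  classical
  have h1 : Module.End.maxGenEigenspace T.toLinearMap (μ i) = specSpace T (· = μ i) := by
    simp [specSpace]
  have h2 : (Finset.univ.filter fun j => μ j = μ i) = {i} := by
    ext j
    simp only [Finset.mem_filter, Finset.mem_univ, true_and, Finset.mem_singleton]
    exact ⟨fun hj => by_contra fun hne => hi j hne hj, fun hj => hj ▸ rfl⟩
  rw [h1, h.mem_specSpace_iff, h2, rootPoly, Finset.prod_singleton, aeval_X_sub_C_apply,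
    sub_eq_zero]

/-- The partial products do not depend on the enumeration of the eigenvalues. -/
lemma IsSpectrum.rootPoly_filter_eq {ν : ι → ℂ} (h : IsSpectrum T μ)
    (h' : IsSpectrum T ν) (P : ℂ → Prop) [DecidablePred P] :
    rootPoly μ (Finset.univ.filter fun i => P (μ i)) =
      rootPoly ν (Finset.univ.filter fun i => P (ν i)) := by
  have key : ∀ ν : ι → ℂ, rootPoly ν (Finset.univ.filter fun i => P (ν i)) =
        (((rootPoly ν Finset.univ).roots.filter P).map fun a => X - C a).prod := by
    intro ν
    have h1 : (rootPoly ν Finset.univ).roots = Finset.univ.val.map ν := by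
      have := roots_multiset_prod_X_sub_C (Finset.univ.val.map ν)
      rwa [Multiset.map_map] at this
    rw [h1, Multiset.filter_map, Multiset.map_map]
    rfl
  rw [key μ, key ν, ← h, ← h']

lemma IsSpectrum.norm_le (h : IsSpectrum T μ) (i : ι) : ‖μ i‖ ≤ ‖T‖ := by
  have h1 : Module.End.HasEigenvalue T.toLinearMap (μ i) := by
    rw [Module.End.hasEigenvalue_iff_isRoot_charpoly, h, IsRoot, rootPoly, eval_prod]
    exact Finset.prod_eq_zero (Finset.mem_univ i) (by simp)
  obtain ⟨v, hv⟩ := h1.exists_hasEigenvector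
  have h2 : T v = μ i • v := hv.apply_eq_smul
  have h3 := T.le_opNorm v
  rw [h2, norm_smul] at h3
  exact le_of_mul_le_mul_right h3 (norm_pos_iff.2 hv.2)

lemma exists_isSpectrum (T : Amp N →L[ℂ] Amp N) : ∃ μ : Fin N → ℂ, IsSpectrum T μ := by
  set p := T.toLinearMap.charpoly
  have hsp : p.Splits := IsAlgClosed.splits p
  have hm : p.Monic := LinearMap.charpoly_monic _
  obtain ⟨l, hl⟩ := Quot.exists_rep p.roots
  have hl' : (l : Multiset ℂ) = p.roots := hl
  have hlen : l.length = N := by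
    have : p.natDegree = N := by simp [p, LinearMap.charpoly_natDegree]
    rw [← this, hsp.natDegree_eq_card_roots, ← hl', Multiset.coe_card]
  subst hlen
  refine ⟨fun i => l.get i, ?_⟩
  have h1 := hsp.eq_prod_roots_of_monic hm
  rw [IsSpectrum, rootPoly]
  change p = _
  rw [h1, ← hl', Multiset.map_coe, Multiset.prod_coe]
  conv_lhs => rw [← List.ofFn_get l, List.map_ofFn, List.prod_ofFn]
  rfl

end SpectralSpaces

/-! ### The determinant of the symbol -/

section CharacteristicFunction

variable {n N : ℕ}

/-- Complex frequencies `(σ, η, ξ)`. -/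
abbrev CFreq (n : ℕ) : Type := ℂ × (Fin n → ℂ) × ℂ

/-- The complex frequency `(σ, η, ξ)` with `η` real. -/
def pt (σ : ℂ) (η : EuclideanSpace ℝ (Fin n)) (ξ : ℂ) : CFreq n := (σ, fun j => (η j : ℂ), ξ)

/-- The holomorphic extension of `(τ, η, ξ) ↦ det L(0, (τ, η, ξ))` to complex frequencies. -/
def Coeffs.charFun (S : Coeffs n N) (z : CFreq n) : ℂ :=
  (z.1 • (1 : Matrix (Fin N) (Fin N) ℂ) + ∑ j, z.2.1 j • (S.tan j).map Complex.ofReal +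
    z.2.2 • S.nor.map Complex.ofReal).det

/-- `∂_σ det L`. -/
def Coeffs.dSigma (S : Coeffs n N) (z : CFreq n) : ℂ := fderiv ℂ S.charFun z (1, 0, 0)

/-- `∂_ξ det L`. -/
def Coeffs.dXi (S : Coeffs n N) (z : CFreq n) : ℂ := fderiv ℂ S.charFun z (0, 0, 1)

/-- `∂_ξ² det L`. -/
def Coeffs.dXiXi (S : Coeffs n N) (z : CFreq n) : ℂ := fderiv ℂ S.dXi z (0, 0, 1)

variable (S : Coeffs n N)

lemma Coeffs.contDiff_charFun : ContDiff ℂ ⊤ S.charFun := by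
  unfold Coeffs.charFun
  simp only [Matrix.det_apply']
  refine ContDiff.sum fun σ _ => contDiff_const.mul (contDiff_prod fun i _ => ?_)
  simp only [Matrix.add_apply, Matrix.sum_apply, Matrix.smul_apply, smul_eq_mul]
  fun_prop

lemma Coeffs.contDiff_dXi : ContDiff ℂ ⊤ S.dXi :=
  (S.contDiff_charFun.fderiv_right (m := ⊤) (by simp)).clm_apply contDiff_const

lemma Coeffs.contDiff_dSigma : ContDiff ℂ ⊤ S.dSigma :=
  (S.contDiff_charFun.fderiv_right (m := ⊤) (by simp)).clm_apply contDiff_const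

lemma Coeffs.continuous_dXiXi : Continuous S.dXiXi :=
  ((S.contDiff_dXi.fderiv_right (m := ⊤) (by simp)).clm_apply contDiff_const).continuous

lemma Coeffs.hasStrictFDerivAt_charFun (z : CFreq n) :
    HasStrictFDerivAt S.charFun (fderiv ℂ S.charFun z) z :=
  S.contDiff_charFun.contDiffAt.hasStrictFDerivAt (by simp)

lemma Coeffs.hasStrictFDerivAt_dXi (z : CFreq n) :
    HasStrictFDerivAt S.dXi (fderiv ℂ S.dXi z) z :=
  S.contDiff_dXi.contDiffAt.hasStrictFDerivAt (by simp)

lemma hasDerivAt_pt (σ : ℂ) (η : EuclideanSpace ℝ (Fin n)) (ξ : ℂ) :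
    HasDerivAt (fun ξ => pt σ η ξ) (0, 0, 1) ξ :=
  (hasDerivAt_const _ _).prodMk ((hasDerivAt_const _ _).prodMk (hasDerivAt_id _))

lemma Coeffs.hasDerivAt_charFun (σ : ℂ) (η : EuclideanSpace ℝ (Fin n)) (ξ : ℂ) :
    HasDerivAt (fun ξ => S.charFun (pt σ η ξ)) (S.dXi (pt σ η ξ)) ξ :=
  (S.hasStrictFDerivAt_charFun _).hasFDerivAt.comp_hasDerivAt ξ (hasDerivAt_pt σ η ξ)

lemma Coeffs.hasDerivAt_dXi (σ : ℂ) (η : EuclideanSpace ℝ (Fin n)) (ξ : ℂ) :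
    HasDerivAt (fun ξ => S.dXi (pt σ η ξ)) (S.dXiXi (pt σ η ξ)) ξ :=
  (S.hasStrictFDerivAt_dXi _).hasFDerivAt.comp_hasDerivAt ξ (hasDerivAt_pt σ η ξ)

lemma Coeffs.hasDerivAt_charFun_sigma (σ : ℂ) (η : EuclideanSpace ℝ (Fin n)) (ξ : ℂ) :
    HasDerivAt (fun σ => S.charFun (pt σ η ξ)) (S.dSigma (pt σ η ξ)) σ :=
  (S.hasStrictFDerivAt_charFun _).hasFDerivAt.comp_hasDerivAt σ
    ((hasDerivAt_id _).prodMk (hasDerivAt_const _ _))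

lemma continuous_pt : Continuous fun p : ℂ × EuclideanSpace ℝ (Fin n) × ℂ => pt p.1 p.2.1 p.2.2 := by
  unfold pt; fun_prop

lemma star_pt (σ : ℂ) (η : EuclideanSpace ℝ (Fin n)) (ξ : ℂ) :
    star (pt σ η ξ) = pt (star σ) η (star ξ) := by
  simp only [pt, Prod.star_def]
  congr 2
  ext j
  simp [Pi.star_apply]

lemma Coeffs.charFun_star (z : CFreq n) : S.charFun (star z) = star (S.charFun z) := by
  simp only [Coeffs.charFun]
  rw [← starRingEnd_apply (R := ℂ), RingHom.map_det]
  congr 1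
  ext i j
  simp [Matrix.sum_apply, Matrix.one_apply, apply_ite]

lemma fderiv_star {f : CFreq n → ℂ} (hf : Differentiable ℂ f)
    (h : ∀ z, f (star z) = star (f z)) (z v : CFreq n) :
    fderiv ℂ f (star z) (star v) = star (fderiv ℂ f z v) := by
  have key : ∀ z v : CFreq n, HasDerivAt (fun t : ℂ => f (z + t • v)) (fderiv ℂ f z v) 0 := by
    intro z v
    have h1 : HasDerivAt (fun t : ℂ => z + t • v) v 0 := by
      simpa using ((hasDerivAt_id (0 : ℂ)).smul_const v).const_add z
    have h2 : HasFDerivAt f (fderiv ℂ f z) (z + (0 : ℂ) • v) := by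
      simpa using (hf z).hasFDerivAt
    exact h2.comp_hasDerivAt 0 h1
  have h1 := (key z v).star_conj
  have h2 := key (star z) (star v)
  refine h2.unique ?_
  convert h1 using 1
  · ext t
    simp only [Function.comp_apply]
    rw [← h, star_add, star_smul, starRingEnd_apply, star_star]
  · simp

lemma Coeffs.dXi_star (z : CFreq n) : S.dXi (star z) = star (S.dXi z) := by
  have := fderiv_star (S.contDiff_charFun.differentiable (by simp)) S.charFun_star z (0, 0, 1)
  rw [← Coeffs.dXi] at this
  rw [← this, Coeffs.dXi]
  simp [Prod.star_def]

lemma Coeffs.charFun_smul (c : ℂ) (z : CFreq n) : S.charFun (c • z) = c ^ N * S.charFun z := by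
  simp only [Coeffs.charFun]
  have := Matrix.det_smul (z.1 • (1 : Matrix (Fin N) (Fin N) ℂ) +
    ∑ j, z.2.1 j • (S.tan j).map Complex.ofReal + z.2.2 • S.nor.map Complex.ofReal) c
  rw [Fintype.card_fin] at this
  rw [← this]
  congr 1
  simp [smul_add, smul_smul, Finset.smul_sum]

/-- Euler homogeneity of the derivatives. The factor `c` stands on the left because `c ^ (N - 1)` would
be truncated at `N = 0`. -/
lemma Coeffs.fderiv_charFun_smul (c : ℂ) (z v : CFreq n) :
    c * fderiv ℂ S.charFun (c • z) v = c ^ N * fderiv ℂ S.charFun z v := by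
  have h1 : HasFDerivAt (fun z => S.charFun (c • z)) _ z :=
    (S.hasStrictFDerivAt_charFun (c • z)).hasFDerivAt.comp z ((hasFDerivAt_id z).const_smul c)
  have h2 : HasFDerivAt (fun z => S.charFun (c • z)) (c ^ N • fderiv ℂ S.charFun z) z := by
    simp only [S.charFun_smul]
    exact (S.hasStrictFDerivAt_charFun z).hasFDerivAt.const_mul (c ^ N)
  simpa using congrArg (fun f : CFreq n →L[ℂ] ℂ => f v) (h1.unique h2)

lemma Coeffs.charFun_ofReal (τ : ℝ) (η : EuclideanSpace ℝ (Fin n)) (ξ : ℝ) :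
    S.charFun (pt τ η ξ) = ((S.symbol τ η ξ).det : ℂ) := by
  rw [Coeffs.charFun, ← Complex.ofRealHom_eq_coe (Matrix.det _), RingHom.map_det]
  congr 1
  ext i j
  simp [pt, Coeffs.symbol, Coeffs.tanSymbol, Matrix.sum_apply, Matrix.one_apply, apply_ite]

/-- On the sheet `τ = τ_k(η, ξ)` the derivatives of `det L` are those of `τ - τ_k`, up to the
nonzero factor `∏_{j ≠ k} (τ - τ_j)`. -/
lemma Coeffs.derivs_on_sheet {S : Coeffs n N} {τ : Fin N → EuclideanSpace ℝ (Fin n) × ℝ → ℝ}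
    (hτ : S.StrictlyHyperbolic τ) {t : ℝ} {η : EuclideanSpace ℝ (Fin n)} {ξ : ℝ}
    (hne : (η, ξ) ≠ (0 : EuclideanSpace ℝ (Fin n) × ℝ)) {k : Fin N} (hk : t = τ k (η, ξ)) :
    ∃ r : ℝ, r ≠ 0 ∧ S.dSigma (pt t η ξ) = r ∧
      S.dXi (pt t η ξ) = ((-dNormal (τ k) (η, ξ) * r : ℝ) : ℂ) ∧
      (dNormal (τ k) (η, ξ) = 0 →
        S.dXiXi (pt t η ξ) = ((-dNormal (dNormal (τ k)) (η, ξ) * r : ℝ) : ℂ)) := by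
  classical
  have hline : ∀ j, AnalyticAt ℝ (fun x : ℝ => τ j (η, x)) ξ := fun j =>
    (hτ.analytic j (η, ξ) (by simpa using hne)).comp_of_eq
      (analyticAt_const.prod analyticAt_id) rfl
  set u : ℝ → ℝ := fun x => t - τ k (η, x) with hu
  set R : ℝ → ℝ := fun x => ∏ j ∈ Finset.univ.erase k, (t - τ j (η, x)) with hR
  have hua : AnalyticAt ℝ u ξ := analyticAt_const.sub (hline k)
  have hRa : AnalyticAt ℝ R ξ :=
    Finset.analyticAt_fun_prod _ fun j _ => analyticAt_const.sub (hline j)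
  have hu0 : u ξ = 0 := by simp [hu, hk]
  have hdu : ∀ x, deriv u x = -dNormal (τ k) (η, x) := by
    intro x
    simp [hu, dNormal, deriv_const_sub]
  have hR0 : R ξ ≠ 0 := by
    refine Finset.prod_ne_zero_iff.2 fun j hj => ?_
    rw [hk, sub_ne_zero]
    exact fun h => (Finset.mem_erase.1 hj).1 ((hτ.strictMono _ hne).injective h).symm
  have hev : ∀ᶠ x in 𝓝 ξ, (η, x) ≠ (0 : EuclideanSpace ℝ (Fin n) × ℝ) := by
    have : Continuous fun x : ℝ => (η, x) := by fun_prop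
    exact this.continuousAt.eventually_ne hne
  -- along the line through `(η, ξ)` the determinant is `u R` with `u ξ = 0` and `R ξ ≠ 0`
  have hQ : ∀ᶠ x in 𝓝 ξ, S.charFun (pt t η (x : ℝ)) = ((u x * R x : ℝ) : ℂ) := by
    filter_upwards [hev] with x hx
    rw [S.charFun_ofReal, hτ.factor (η, x) hx, ← Finset.mul_prod_erase _ _ (Finset.mem_univ k)]
  have hd1 : ∀ᶠ x in 𝓝 ξ, S.dXi (pt t η (x : ℝ)) = ((deriv u x * R x + u x * deriv R x : ℝ) : ℂ) := by
    filter_upwards [hQ.eventually_nhds, hua.eventually_analyticAt, hRa.eventually_analyticAt]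
      with x hx hux hRx
    have h1 := (S.hasDerivAt_charFun t η x).comp_ofReal
    have h2 := (hux.differentiableAt.hasDerivAt.mul hRx.differentiableAt.hasDerivAt).ofReal_comp
    exact h1.unique (h2.congr_of_eventuallyEq hx)
  refine ⟨R ξ, hR0, ?_, ?_, fun h0 => ?_⟩
  · have h1 := (S.hasDerivAt_charFun_sigma t η ξ).comp_ofReal
    have h2 : HasDerivAt (fun s : ℝ => (∏ j, (s - τ j (η, ξ)) : ℝ)) (R ξ) t := by
      have h3 : HasDerivAt (fun s : ℝ => (s - τ k (η, ξ)) *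
          ∏ j ∈ Finset.univ.erase k, (s - τ j (η, ξ)))
          (1 * (∏ j ∈ Finset.univ.erase k, (t - τ j (η, ξ))) + (t - τ k (η, ξ)) *
            deriv (fun s : ℝ => ∏ j ∈ Finset.univ.erase k, (s - τ j (η, ξ))) t) t := by
        refine ((hasDerivAt_id t).sub_const _).mul (DifferentiableAt.hasDerivAt ?_)
        fun_prop
      rw [← hk, sub_self, zero_mul, add_zero, one_mul] at h3
      simp only [← Finset.mul_prod_erase _ _ (Finset.mem_univ k)]
      rw [← hk]
      exact h3
    refine h1.unique (h2.ofReal_comp.congr_of_eventuallyEq (Eventually.of_forall fun s => ?_))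
    change S.charFun (pt (s : ℂ) η (ξ : ℝ)) = _
    rw [S.charFun_ofReal, hτ.factor (η, ξ) hne]
  · rw [hd1.self_of_nhds, hu0, hdu]; simp
  · have h1 := (S.hasDerivAt_dXi t η ξ).comp_ofReal
    have h2 := ((hua.deriv.differentiableAt.hasDerivAt.mul hRa.differentiableAt.hasDerivAt).add
      (hua.differentiableAt.hasDerivAt.mul hRa.deriv.differentiableAt.hasDerivAt)).ofReal_comp
    rw [h1.unique (h2.congr_of_eventuallyEq hd1)]
    have h3 : deriv (deriv u) ξ = -dNormal (dNormal (τ k)) (η, ξ) := by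
      have : deriv u = fun x => -dNormal (τ k) (η, x) := funext hdu
      rw [this, deriv.fun_neg]; rfl
    rw [hdu, h0, hu0, h3]
    simp

end CharacteristicFunction

/-! ### Roots of the determinant and eigenvalues -/

section Roots

variable {n N : ℕ}

/-- The roots in `ξ` of `det L(0, (σ, η, ξ))`, with multiplicities. -/
def Coeffs.IsRoots (S : Coeffs n N) (σ : ℂ) (η : EuclideanSpace ℝ (Fin n)) (x : Fin N → ℂ) : Prop :=
  ∀ ξ : ℂ, S.charFun (pt σ η ξ) = (S.nor.det : ℂ) * ∏ i, (ξ - x i)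

variable {S : Coeffs n N} {σ : ℂ} {η : EuclideanSpace ℝ (Fin n)} {x : Fin N → ℂ}

/-- The matrix of `L(0, (σ, η, ξ))` for complex `σ` and `ξ`. -/
def Coeffs.symbolC (S : Coeffs n N) (σ : ℂ) (η : EuclideanSpace ℝ (Fin n)) (ξ : ℂ) :
    Matrix (Fin N) (Fin N) ℂ :=
  σ • (1 : Matrix (Fin N) (Fin N) ℂ) + (S.tanSymbol η).map Complex.ofReal +
    ξ • S.nor.map Complex.ofReal

lemma Coeffs.charFun_pt (S : Coeffs n N) (σ : ℂ) (η : EuclideanSpace ℝ (Fin n)) (ξ : ℂ) :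
    S.charFun (pt σ η ξ) = (S.symbolC σ η ξ).det := by
  rw [Coeffs.charFun, Coeffs.symbolC]
  congr 1
  ext i j
  simp [pt, Coeffs.tanSymbol, Matrix.sum_apply]

lemma Coeffs.nor_mul_inv (hnor : IsUnit S.nor.det) :
    S.nor.map Complex.ofReal * (S.nor⁻¹).map Complex.ofReal = 1 := by
  have h := congrArg (fun M : Matrix (Fin N) (Fin N) ℝ => M.map Complex.ofRealHom)
    (Matrix.mul_nonsing_inv _ hnor)
  rw [Matrix.map_mul, Matrix.map_one _ (map_zero _) (map_one _)] at h
  exact h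

lemma Coeffs.nor_mul_sub_resolvent (hnor : IsUnit S.nor.det) (σ : ℂ)
    (η : EuclideanSpace ℝ (Fin n)) (ξ : ℂ) :
    S.nor.map Complex.ofReal * ((Complex.I * ξ) • 1 - S.resolvent σ η) =
      Complex.I • S.symbolC σ η ξ := by
  rw [Coeffs.resolvent, mul_sub, Matrix.mul_smul, mul_one, Matrix.mul_smul, ← mul_assoc,
    Coeffs.nor_mul_inv hnor, one_mul, Coeffs.symbolC, neg_smul, sub_neg_eq_add, smul_add _ _ (ξ • _),
    smul_smul, add_comm]

lemma Coeffs.toLinearMap_opA (S : Coeffs n N) (σ : ℂ) (η : EuclideanSpace ℝ (Fin n)) :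
    (S.opA σ η).toLinearMap.charpoly = (S.resolvent σ η).charpoly := by
  rw [← Matrix.charpoly_toLin (S.resolvent σ η) (EuclideanSpace.basisFun (Fin N) ℂ).toBasis]
  congr 1

lemma Coeffs.det_mul_eval_charpoly (hnor : IsUnit S.nor.det) (σ : ℂ)
    (η : EuclideanSpace ℝ (Fin n)) (ξ : ℂ) :
    (S.nor.det : ℂ) * (S.opA σ η).toLinearMap.charpoly.eval (Complex.I * ξ) =
      Complex.I ^ N * S.charFun (pt σ η ξ) := by
  have h := congrArg Matrix.det (Coeffs.nor_mul_sub_resolvent hnor σ η ξ)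
  rw [Matrix.det_mul, Matrix.det_smul, Fintype.card_fin] at h
  rw [Coeffs.toLinearMap_opA, Matrix.eval_charpoly, S.charFun_pt, ← h,
    ← Complex.ofRealHom_eq_coe (Matrix.det _), RingHom.map_det, Matrix.smul_one_eq_diagonal]
  rfl

lemma eval_rootPoly_I_mul (x : Fin N → ℂ) (ξ : ℂ) :
    (rootPoly (fun i => Complex.I * x i) Finset.univ).eval (Complex.I * ξ) =
      Complex.I ^ N * ∏ i, (ξ - x i) := by
  rw [rootPoly, eval_prod]
  simp only [eval_sub, eval_X, eval_C, ← mul_sub, Finset.prod_mul_distrib]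
  simp

/-- The eigenvalues of `𝒜(σ, η)` are the `iξ`, `ξ` a root of `det L(0, (σ, η, ·))`. -/
lemma Coeffs.isRoots_iff_isSpectrum (hnor : IsUnit S.nor.det) :
    S.IsRoots σ η x ↔ IsSpectrum (S.opA σ η) fun i => Complex.I * x i := by
  have hd : (S.nor.det : ℂ) ≠ 0 := Complex.ofReal_ne_zero.2 hnor.ne_zero
  have hI : (Complex.I : ℂ) ^ N ≠ 0 := pow_ne_zero _ Complex.I_ne_zero
  constructor
  · intro h
    refine Polynomial.funext fun y => mul_left_cancel₀ hd ?_
    have hy : y = Complex.I * (-Complex.I * y) := by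
      rw [← mul_assoc, mul_neg, Complex.I_mul_I]; simp
    rw [hy, Coeffs.det_mul_eval_charpoly hnor, eval_rootPoly_I_mul, h]
    ring
  · intro h ξ
    have h1 := Coeffs.det_mul_eval_charpoly hnor σ η ξ
    rw [h, eval_rootPoly_I_mul] at h1
    refine mul_left_cancel₀ hI ?_
    rw [← h1]; ring

lemma Coeffs.exists_isRoots (hnor : IsUnit S.nor.det) (σ : ℂ) (η : EuclideanSpace ℝ (Fin n)) :
    ∃ x, S.IsRoots σ η x := by
  obtain ⟨μ, hμ⟩ := exists_isSpectrum (S.opA σ η)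
  refine ⟨fun i => -Complex.I * μ i, (Coeffs.isRoots_iff_isSpectrum hnor).2 ?_⟩
  convert hμ using 2
  rw [← mul_assoc, mul_neg, Complex.I_mul_I]; simp

lemma Coeffs.IsRoots.norm_le (hnor : IsUnit S.nor.det) (h : S.IsRoots σ η x) (i : Fin N) :
    ‖x i‖ ≤ ‖S.opA σ η‖ := by
  simpa using ((Coeffs.isRoots_iff_isSpectrum hnor).1 h).norm_le i

lemma Coeffs.IsRoots.charFun_eq_zero (h : S.IsRoots σ η x) (i : Fin N) :
    S.charFun (pt σ η (x i)) = 0 := by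
  rw [h, Finset.prod_eq_zero (Finset.mem_univ i) (sub_self _), mul_zero]

lemma Coeffs.IsRoots.exists_eq (hnor : IsUnit S.nor.det) (h : S.IsRoots σ η x) {ξ : ℂ}
    (hξ : S.charFun (pt σ η ξ) = 0) : ∃ i, ξ = x i := by
  rw [h, mul_eq_zero, Finset.prod_eq_zero_iff] at hξ
  obtain h1 | ⟨i, -, hi⟩ := hξ
  · exact absurd h1 (Complex.ofReal_ne_zero.2 hnor.ne_zero)
  · exact ⟨i, sub_eq_zero.1 hi⟩

lemma Coeffs.IsRoots.dXi_eq (h : S.IsRoots σ η x) (i : Fin N) :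
    S.dXi (pt σ η (x i)) = (S.nor.det : ℂ) * ∏ j ∈ Finset.univ.erase i, (x i - x j) := by
  have h1 := S.hasDerivAt_charFun σ η (x i)
  have h2 : HasDerivAt (fun ξ => (S.nor.det : ℂ) *
      ((ξ - x i) * ∏ j ∈ Finset.univ.erase i, (ξ - x j)))
      ((S.nor.det : ℂ) * (1 * (∏ j ∈ Finset.univ.erase i, (x i - x j)) + (x i - x i) *
        deriv (fun ξ => ∏ j ∈ Finset.univ.erase i, (ξ - x j)) (x i))) (x i) := by
    refine (((hasDerivAt_id (x i)).sub_const _).mul (DifferentiableAt.hasDerivAt ?_)).const_mul _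
    fun_prop
  rw [sub_self, zero_mul, add_zero, one_mul] at h2
  refine h1.unique (h2.congr_of_eventuallyEq (Eventually.of_forall fun ξ => ?_))
  simp only [h ξ, ← Finset.mul_prod_erase _ _ (Finset.mem_univ i)]

lemma pt_smul (c : ℝ) (σ : ℂ) (η : EuclideanSpace ℝ (Fin n)) (ξ : ℂ) :
    pt (c * σ) (c • η) (c * ξ) = (c : ℂ) • pt σ η ξ := by
  simp only [pt, Prod.smul_mk, smul_eq_mul]
  congr 2
  ext j; simp

lemma Coeffs.IsRoots.smul (h : S.IsRoots σ η x) {c : ℝ} (hc : c ≠ 0) :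
    S.IsRoots (c * σ) (c • η) fun i => c * x i := by
  intro ξ
  have hc' : (c : ℂ) ≠ 0 := Complex.ofReal_ne_zero.2 hc
  have hξ : ξ = c * ((c : ℂ)⁻¹ * ξ) := by rw [mul_inv_cancel_left₀ hc']
  rw [hξ, pt_smul, S.charFun_smul, h]
  simp only [← mul_sub, Finset.prod_mul_distrib]
  simp only [Finset.prod_const, Finset.card_univ, Fintype.card_fin]
  ring

lemma Coeffs.opA_smul (S : Coeffs n N) (c : ℝ) (σ : ℂ) (η : EuclideanSpace ℝ (Fin n)) :
    S.opA (c * σ) (c • η) = (c : ℂ) • S.opA σ η := by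
  have h : S.resolvent (c * σ) (c • η) = (c : ℂ) • S.resolvent σ η := by
    have h1 : (S.tanSymbol (c • η)).map Complex.ofReal =
        (c : ℂ) • (S.tanSymbol η).map Complex.ofReal := by
      ext i j
      simp [Coeffs.tanSymbol, Matrix.sum_apply, Finset.mul_sum, mul_assoc]
    rw [Coeffs.resolvent, Coeffs.resolvent, h1, mul_smul, ← smul_add, Matrix.mul_smul, smul_comm]
  rw [Coeffs.opA, Coeffs.opA, h, map_smul]

lemma Coeffs.continuous_opA (S : Coeffs n N) :
    Continuous fun p : ℂ × EuclideanSpace ℝ (Fin n) => S.opA p.1 p.2 := by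
  unfold Coeffs.opA
  have h1 : Continuous fun M : Matrix (Fin N) (Fin N) ℂ => Matrix.toEuclideanCLM (𝕜 := ℂ) M :=
    LinearMap.continuous_of_finiteDimensional
      (Matrix.toEuclideanCLM (n := Fin N) (𝕜 := ℂ)).toAlgEquiv.toLinearMap
  refine h1.comp ?_
  have h2 : Continuous fun p : ℂ × EuclideanSpace ℝ (Fin n) =>
      (S.tanSymbol p.2).map Complex.ofReal := by
    refine Continuous.matrix_map ?_ Complex.continuous_ofReal
    unfold Coeffs.tanSymbol
    fun_prop
  have h3 : Continuous fun p : ℂ × EuclideanSpace ℝ (Fin n) =>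
      p.1 • (1 : Matrix (Fin N) (Fin N) ℂ) := by fun_prop
  have h4 : Continuous fun _ : ℂ × EuclideanSpace ℝ (Fin n) =>
      (S.nor⁻¹).map Complex.ofReal := continuous_const
  exact (h4.matrix_mul (h3.add h2)).const_smul (-Complex.I)

lemma Coeffs.mem_kerSymbol_iff (hnor : IsUnit S.nor.det) (ζ : Freq n) (ξ : ℝ) (w : Amp N) :
    w ∈ S.kerSymbol ζ ξ ↔ S.opAReal ζ w = (Complex.I * ξ) • w := by
  have hsym : (S.symbol ζ.fst ζ.snd ξ).map Complex.ofReal = S.symbolC ζ.fst ζ.snd ξ := by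
    ext i j
    simp [Coeffs.symbol, Coeffs.symbolC, Matrix.one_apply, apply_ite]
  set Φ := Matrix.toEuclideanCLM (n := Fin N) (𝕜 := ℂ)
  have h1 := congrArg Φ (Coeffs.nor_mul_sub_resolvent hnor (ζ.fst : ℂ) ζ.snd ξ)
  rw [map_mul, map_sub, map_smul, map_smul, map_one] at h1
  have h2 : Φ (S.nor.map Complex.ofReal) ((Complex.I * ξ) • w - S.opAReal ζ w) =
      Complex.I • Φ (S.symbolC ζ.fst ζ.snd ξ) w := congrArg (fun T : Amp N →L[ℂ] Amp N => T w) h1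
  have h3 : Φ ((S.nor⁻¹).map Complex.ofReal) * Φ (S.nor.map Complex.ofReal) = 1 := by
    rw [← map_mul, mul_eq_one_comm.1 (Coeffs.nor_mul_inv hnor), map_one]
  change Φ ((S.symbol ζ.fst ζ.snd ξ).map Complex.ofReal) w = 0 ↔ _
  rw [hsym]
  constructor
  · intro h
    rw [h, smul_zero] at h2
    have h4 := congrArg (fun T : Amp N →L[ℂ] Amp N =>
      T ((Complex.I * ξ) • w - S.opAReal ζ w)) h3
    simp only [mul_apply_eq_comp, h2, map_zero, one_apply_eq_self] at h4
    exact (sub_eq_zero.1 h4.symm).symm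
  · intro h
    rw [h, sub_self, map_zero] at h2
    exact (smul_eq_zero.1 h2.symm).resolve_left Complex.I_ne_zero

lemma Coeffs.IsRoots.exists_star_eq (hnor : IsUnit S.nor.det) {t : ℝ}
    (h : S.IsRoots t η x) (i : Fin N) : ∃ j, star (x i) = x j := by
  refine h.exists_eq hnor ?_
  have := S.charFun_star (pt t η (x i))
  rw [h.charFun_eq_zero, star_zero, star_pt] at this
  simpa using this

end Roots

/-! ### Incoming, outgoing and glancing frequencies -/

section RealFrequencies

variable {n N : ℕ}

/-- `(ζ, ξ)` is characteristic and `∂_ξ det L · ∂_σ det L` has a positive real part; for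
`ζ ≠ 0` these are the incoming frequencies. -/
def Coeffs.InFreq (S : Coeffs n N) (ζ : Freq n) (ξ : ℂ) : Prop :=
  S.charFun (pt ζ.fst ζ.snd ξ) = 0 ∧ 0 < (S.dXi (pt ζ.fst ζ.snd ξ) * S.dSigma (pt ζ.fst ζ.snd ξ)).re

/-- `(ζ, ξ)` is characteristic and `∂_ξ det L · ∂_σ det L` has a negative real part; for
`ζ ≠ 0` these are the outgoing frequencies. -/
def Coeffs.OutFreq (S : Coeffs n N) (ζ : Freq n) (ξ : ℂ) : Prop :=
  S.charFun (pt ζ.fst ζ.snd ξ) = 0 ∧ (S.dXi (pt ζ.fst ζ.snd ξ) * S.dSigma (pt ζ.fst ζ.snd ξ)).re < 0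

/-- What the geometry of the sheets gives for `det L`: at real characteristic frequencies with
`ζ ≠ 0`, the derivatives are real, `∂_σ det L ≠ 0`, and `∂_ξ² det L ≠ 0` where
`∂_ξ det L = 0`. -/
def Coeffs.Regular (S : Coeffs n N) : Prop :=
  ∀ ζ : Freq n, ζ ≠ 0 → ∀ ξ : ℝ, S.charFun (pt ζ.fst ζ.snd ξ) = 0 →
    ∃ r s : ℝ, r ≠ 0 ∧ S.dSigma (pt ζ.fst ζ.snd ξ) = r ∧ S.dXi (pt ζ.fst ζ.snd ξ) = s ∧
      (s = 0 → ∃ q : ℝ, q ≠ 0 ∧ S.dXiXi (pt ζ.fst ζ.snd ξ) = q)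

variable {S : Coeffs n N} {τ : Fin N → EuclideanSpace ℝ (Fin n) × ℝ → ℝ}

/-- If `ζ ≠ 0` then `(η, ξ) ≠ 0` at a characteristic frequency, because `det L(τ, 0, 0) = τ ^ N`. -/
lemma Coeffs.exists_sheet (hτ : S.StrictlyHyperbolic τ) {ζ : Freq n} (hζ : ζ ≠ 0) {ξ : ℝ}
    (h : S.charFun (pt ζ.fst ζ.snd ξ) = 0) :
    (ζ.snd, ξ) ≠ (0 : EuclideanSpace ℝ (Fin n) × ℝ) ∧ ∃ k, ζ.fst = τ k (ζ.snd, ξ) := by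
  rw [S.charFun_ofReal, Complex.ofReal_eq_zero] at h
  have hne : (ζ.snd, ξ) ≠ (0 : EuclideanSpace ℝ (Fin n) × ℝ) := by
    intro h0
    rw [Prod.mk_eq_zero] at h0
    rw [h0.1, h0.2] at h
    have h1 : S.symbol ζ.fst 0 0 = ζ.fst • (1 : Matrix (Fin N) (Fin N) ℝ) := by
      simp [Coeffs.symbol, Coeffs.tanSymbol]
    rw [h1, Matrix.det_smul, Matrix.det_one, mul_one] at h
    have h2 : ζ.fst = 0 := eq_zero_of_pow_eq_zero h
    apply hζ
    apply (WithLp.equiv 2 _).injective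
    exact Prod.ext h2 h0.1
  refine ⟨hne, ?_⟩
  rw [hτ.factor (ζ.snd, ξ) hne, Finset.prod_eq_zero_iff] at h
  obtain ⟨k, -, hk⟩ := h
  exact ⟨k, sub_eq_zero.1 hk⟩

lemma Coeffs.charFun_eq_zero_of_charWith (hτ : S.StrictlyHyperbolic τ) {P : ℝ → Prop} {ζ : Freq n}
    {ξ : ℝ} (h : CharWith τ P ζ ξ) : S.charFun (pt ζ.fst ζ.snd ξ) = 0 := by
  obtain ⟨hne, k, hk, -⟩ := h
  rw [S.charFun_ofReal, hτ.factor (ζ.snd, ξ) hne,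
    Finset.prod_eq_zero (Finset.mem_univ k) (sub_eq_zero.2 hk), Complex.ofReal_zero]

lemma Coeffs.StrictlyHyperbolic.regular (hτ : S.StrictlyHyperbolic τ)
    (hg : GlancingNondegenerate τ) : S.Regular := by
  intro ζ hζ ξ h
  obtain ⟨hne, k, hk⟩ := Coeffs.exists_sheet hτ hζ h
  obtain ⟨r, hr, h1, h2, h3⟩ := Coeffs.derivs_on_sheet hτ hne hk
  refine ⟨r, _, hr, h1, h2, fun h0 => ?_⟩
  have h0' : dNormal (τ k) (ζ.snd, ξ) = 0 := by
    simpa [hr] using h0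
  exact ⟨_, mul_ne_zero (neg_ne_zero.2 (hg k _ hne h0')) hr, h3 h0'⟩

/-- Characteristic frequencies are classified by the sign of `-∂_ξ det L · ∂_σ det L`. -/
lemma Coeffs.charWith_iff (hτ : S.StrictlyHyperbolic τ) {ζ : Freq n} (hζ : ζ ≠ 0) {ξ : ℝ}
    {P : ℝ → Prop} (hP : ∀ v r : ℝ, r ≠ 0 → (P v ↔ P (v * (r * r)))) :
    CharWith τ P ζ ξ ↔ S.charFun (pt ζ.fst ζ.snd ξ) = 0 ∧
      P (-(S.dXi (pt ζ.fst ζ.snd ξ) * S.dSigma (pt ζ.fst ζ.snd ξ)).re) := by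
  have key : ∀ k, (ζ.snd, ξ) ≠ (0 : EuclideanSpace ℝ (Fin n) × ℝ) → ζ.fst = τ k (ζ.snd, ξ) →
      (P (dNormal (τ k) (ζ.snd, ξ)) ↔
        P (-(S.dXi (pt ζ.fst ζ.snd ξ) * S.dSigma (pt ζ.fst ζ.snd ξ)).re)) := by
    intro k hne hk
    obtain ⟨r, hr, h1, h2, -⟩ := Coeffs.derivs_on_sheet hτ hne hk
    rw [h1, h2, ← Complex.ofReal_mul, Complex.ofReal_re, hP _ r hr]
    congr! 1
    ring
  constructor
  · intro h
    refine ⟨Coeffs.charFun_eq_zero_of_charWith hτ h, ?_⟩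
    obtain ⟨hne, k, hk, hPk⟩ := h
    exact (key k hne hk).1 hPk
  · rintro ⟨h0, h⟩
    obtain ⟨hne, k, hk⟩ := Coeffs.exists_sheet hτ hζ h0
    exact ⟨hne, k, hk, (key k hne hk).2 h⟩

lemma Coeffs.incoming_iff (hτ : S.StrictlyHyperbolic τ) {ζ : Freq n} (hζ : ζ ≠ 0) {ξ : ℝ} :
    Incoming τ ζ ξ ↔ S.InFreq ζ ξ := by
  rw [Incoming, Coeffs.charWith_iff hτ hζ, Coeffs.InFreq, neg_lt_zero]
  intro v r hr
  have := mul_self_pos.2 hr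
  constructor <;> intro <;> nlinarith

lemma Coeffs.outgoing_iff (hτ : S.StrictlyHyperbolic τ) {ζ : Freq n} (hζ : ζ ≠ 0) {ξ : ℝ} :
    Outgoing τ ζ ξ ↔ S.OutFreq ζ ξ := by
  rw [Outgoing, Coeffs.charWith_iff hτ hζ, Coeffs.OutFreq, neg_pos]
  intro v r hr
  have := mul_self_pos.2 hr
  constructor <;> intro <;> nlinarith

lemma Coeffs.mem_glancingSet_iff (hτ : S.StrictlyHyperbolic τ) (hS : S.Regular) {ζ : Freq n} :
    ζ ∈ glancingSet τ ↔ ζ ≠ 0 ∧ ∃ ξ : ℝ, S.charFun (pt ζ.fst ζ.snd ξ) = 0 ∧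
      S.dXi (pt ζ.fst ζ.snd ξ) = 0 := by
  rw [glancingSet, Set.mem_ofPred_eq]
  refine and_congr_right fun hζ => exists_congr fun ξ => ?_
  rw [Glancing, Coeffs.charWith_iff hτ hζ]
  · refine and_congr_right fun h0 => ?_
    obtain ⟨r, s, hr, h1, h2, -⟩ := hS ζ hζ ξ h0
    rw [h1, h2, ← Complex.ofReal_mul, Complex.ofReal_re]
    simp [hr]
  · intro v r hr
    simp [hr]

lemma Coeffs.Regular.glancing_or_in_or_out (hS : S.Regular) {ζ : Freq n} (hζ : ζ ≠ 0) {ξ : ℝ}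
    (h0 : S.charFun (pt ζ.fst ζ.snd ξ) = 0) :
    S.dXi (pt ζ.fst ζ.snd ξ) = 0 ∨ S.InFreq ζ ξ ∨ S.OutFreq ζ ξ := by
  obtain ⟨r, s, hr, h1, h2, -⟩ := hS ζ hζ ξ h0
  rw [Coeffs.InFreq, Coeffs.OutFreq, h1, h2, ← Complex.ofReal_mul, Complex.ofReal_re]
  rcases lt_trichotomy (s * r) 0 with h | h | h
  · exact Or.inr (Or.inr ⟨h0, h⟩)
  · left
    simpa [hr] using h
  · exact Or.inr (Or.inl ⟨h0, h⟩)

end RealFrequencies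

/-! ### Roots near a real frequency -/

section LocalAnalysis

variable {n N : ℕ}

/-- A function commuting with conjugation is real at real points, and strict differentiability
there, applied to `z` and its conjugate, expands its imaginary part to first order in `Im z`. -/
lemma eventually_im_expansion {f : CFreq n → ℂ} {f' : CFreq n →L[ℂ] ℂ} {z₀ : CFreq n}
    (hf : HasStrictFDerivAt f f' z₀) (hstar : ∀ z, f (star z) = star (f z)) (hz₀ : star z₀ = z₀)
    {ε : ℝ} (hε : 0 < ε) :
    ∀ᶠ z in 𝓝 z₀, ∀ σ η ξ, z = pt σ η ξ →
      |(f z).im - (σ.im * (f' (1, 0, 0)).re + ξ.im * (f' (0, 0, 1)).re)| ≤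
        ε * (|σ.im| + |ξ.im|) := by
  have h1 := (hasStrictFDerivAt_iff_isLittleO.1 hf).def hε
  have h2 : Tendsto (fun z : CFreq n => (z, star z)) (𝓝 z₀) (𝓝 (z₀, z₀)) := by
    have : Continuous fun z : CFreq n => (z, star z) := continuous_id.prodMk continuous_star
    simpa [hz₀] using this.tendsto z₀
  filter_upwards [h2.eventually h1] with z hz σ η ξ hzpt
  have h3 : z - star z = (2 * σ.im * Complex.I) • ((1, 0, 0) : CFreq n) +
      (2 * ξ.im * Complex.I) • ((0, 0, 1) : CFreq n) := by
    rw [hzpt, star_pt]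
    refine Prod.ext ?_ (Prod.ext ?_ ?_)
    · apply Complex.ext <;> simp [pt]; ring
    · ext j; simp [pt]
    · apply Complex.ext <;> simp [pt]; ring
  have h4 : ‖z - star z‖ ≤ 2 * (|σ.im| + |ξ.im|) := by
    rw [h3]
    refine (norm_add_le _ _).trans ?_
    rw [norm_smul, norm_smul]
    simp [Prod.norm_def]
    linarith
  have h5 := (Complex.abs_im_le_norm _).trans (hz.trans (mul_le_mul_of_nonneg_left h4 hε.le))
  simp only [hstar, h3, map_add, map_smul] at h5
  have h6 : (f z - star (f z) - ((2 * (σ.im : ℂ) * Complex.I) • f' (1, 0, 0) +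
      (2 * (ξ.im : ℂ) * Complex.I) • f' (0, 0, 1))).im =
      2 * ((f z).im - (σ.im * (f' (1, 0, 0)).re + ξ.im * (f' (0, 0, 1)).re)) := by
    simp; ring
  rw [h6, abs_mul, abs_two] at h5
  linarith

lemma star_pt_ofReal (t : ℝ) (η : EuclideanSpace ℝ (Fin n)) (ξ : ℝ) :
    star (pt (t : ℂ) η (ξ : ℂ)) = pt (t : ℂ) η (ξ : ℂ) := by
  rw [star_pt]; simp

lemma continuous_ptFreq : Continuous fun p : Freq n × ℂ => pt (p.1.fst : ℂ) p.1.snd p.2 := by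
  refine continuous_pt.comp (f := fun p : Freq n × ℂ => ((p.1.fst : ℂ), p.1.snd, p.2)) ?_
  fun_prop

lemma tendsto_ptFreq (ζ₀ : Freq n) (ξ₀ : ℂ) :
    Tendsto (fun p : Freq n × ℂ => pt (p.1.fst : ℂ) p.1.snd p.2) (𝓝 ζ₀ ×ˢ 𝓝 ξ₀)
      (𝓝 (pt (ζ₀.fst : ℂ) ζ₀.snd ξ₀)) := by
  rw [← nhds_prod_eq]
  exact continuous_ptFreq.tendsto (ζ₀, ξ₀)

variable {S : Coeffs n N}

/-- A property holding near `(ζ₀, ξ₀)` holds for `ζ` near `ζ₀` on a whole disc around `ξ₀`. -/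
lemma exists_ball_of_eventually {ζ₀ : Freq n} {ξ₀ : ℂ} {P : CFreq n → Prop}
    (h : ∀ᶠ z in 𝓝 (pt (ζ₀.fst : ℂ) ζ₀.snd ξ₀), P z) :
    ∃ δ > 0, ∀ᶠ ζ in 𝓝 ζ₀, ∀ ξ ∈ Metric.ball ξ₀ δ, P (pt (ζ.fst : ℂ) ζ.snd ξ) := by
  obtain ⟨pa, ha, pb, hb, hab⟩ := eventually_prod_iff.1 ((tendsto_ptFreq ζ₀ ξ₀).eventually h)
  obtain ⟨δ, hδ, hball⟩ := Metric.eventually_nhds_iff_ball.1 hb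
  exact ⟨δ, hδ, ha.mono fun ζ hζ ξ hξ => hab hζ (hball ξ hξ)⟩

/-- Near a nondegenerate double root, a root in the open upper half-plane is simple, and it is the
only root in the closed upper half-plane: on the segment between two such roots the imaginary part
of `∂_ξ det L` would not vanish. -/
lemma Coeffs.eventually_unique_upper_root (S : Coeffs n N) {ζ₀ : Freq n} {ξ₀ q : ℝ} (hq : q ≠ 0)
    (h : S.dXiXi (pt ζ₀.fst ζ₀.snd ξ₀) = q) :
    ∃ δ > 0, ∀ᶠ ζ in 𝓝 ζ₀, ∀ ξ₁ ∈ Metric.ball (ξ₀ : ℂ) δ, ∀ ξ₂ ∈ Metric.ball (ξ₀ : ℂ) δ,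
      0 ≤ ξ₁.im → 0 ≤ ξ₂.im → 0 < ξ₁.im + ξ₂.im →
      S.charFun (pt ζ.fst ζ.snd ξ₁) = 0 → S.charFun (pt ζ.fst ζ.snd ξ₂) = 0 →
      ξ₁ = ξ₂ ∧ S.dXi (pt ζ.fst ζ.snd ξ₁) ≠ 0 := by
  have h1 := eventually_im_expansion (S.hasStrictFDerivAt_dXi (pt ζ₀.fst ζ₀.snd ξ₀)) S.dXi_star
    (star_pt_ofReal _ _ _) (ε := |q| / 2) (by positivity)
  obtain ⟨δ, hδ, hev⟩ := exists_ball_of_eventually h1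
  refine ⟨δ, hδ, hev.mono fun ζ hζ => ?_⟩
  -- to first order `Im ∂_ξ det L` is `q Im ξ`
  have him : ∀ ξ ∈ Metric.ball (ξ₀ : ℂ) δ, 0 < ξ.im → (S.dXi (pt ζ.fst ζ.snd ξ)).im ≠ 0 := by
    intro ξ hξ hpos h0
    have h2 := hζ ξ hξ _ _ _ rfl
    have h3 : (fderiv ℂ S.dXi (pt (ζ₀.fst : ℂ) ζ₀.snd ξ₀)) (0, 0, 1) = q := h
    rw [h3, h0] at h2
    simp only [Complex.ofReal_im, zero_mul, zero_add, Complex.ofReal_re, zero_sub, abs_neg, abs_mul,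
      abs_zero, abs_of_pos hpos] at h2
    nlinarith [mul_pos hpos (abs_pos.2 hq)]
  intro ξ₁ h₁ ξ₂ h₂ hp₁ hp₂ hp hQ₁ hQ₂
  have heq : ξ₁ = ξ₂ := by
    by_contra hne
    have hd : ξ₂ - ξ₁ ≠ 0 := sub_ne_zero.2 (Ne.symm hne)
    -- Rolle's theorem needs a real function; division by `ξ₂ - ξ₁` makes its derivative `Im ∂_ξ det L`
    have hder : ∀ s : ℝ, HasDerivAt (fun s : ℝ =>
        (S.charFun (pt ζ.fst ζ.snd (ξ₁ + s * (ξ₂ - ξ₁))) / (ξ₂ - ξ₁)).im)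
        (S.dXi (pt ζ.fst ζ.snd (ξ₁ + s * (ξ₂ - ξ₁)))).im s := by
      intro s
      have e1 : HasDerivAt (fun s : ℝ => ξ₁ + s * (ξ₂ - ξ₁)) (ξ₂ - ξ₁) s := by
        simpa using ((Complex.ofRealCLM.hasDerivAt (x := s)).mul_const (ξ₂ - ξ₁)).const_add ξ₁
      have e2 := (((S.hasDerivAt_charFun ζ.fst ζ.snd (ξ₁ + s * (ξ₂ - ξ₁))).comp s e1).div_const
        (ξ₂ - ξ₁))
      rw [mul_div_cancel_right₀ _ hd] at e2
      exact Complex.imCLM.hasFDerivAt.comp_hasDerivAt s e2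
    obtain ⟨s, hs, hs0⟩ := exists_hasDerivAt_eq_zero (zero_lt_one' ℝ)
      (fun s _ => (hder s).continuousAt.continuousWithinAt) (by simp [hQ₁, hQ₂])
      (fun s _ => hder s)
    refine him _ ?_ ?_ hs0
    · have := (convex_ball (ξ₀ : ℂ) δ).add_smul_sub_mem h₁ h₂ (t := s) ⟨hs.1.le, hs.2.le⟩
      simpa using this
    · have : (ξ₁ + s * (ξ₂ - ξ₁)).im = (1 - s) * ξ₁.im + s * ξ₂.im := by simp; ring
      rw [this]
      rcases hp₁.lt_or_eq with h3 | h3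
      · exact add_pos_of_pos_of_nonneg (mul_pos (by linarith [hs.2]) h3) (mul_nonneg hs.1.le hp₂)
      · rw [← h3] at hp ⊢
        have := mul_pos hs.1 (show 0 < ξ₂.im by linarith)
        linarith
  refine ⟨heq, fun h0 => him ξ₁ h₁ ?_ (by rw [h0]; rfl)⟩
  rw [← heq] at hp; linarith

/-- Near a nondegenerate double root there is at most one incoming root: `det L` is strictly convex
or concave in `ξ`, so that its derivatives at two real roots have opposite signs. -/
lemma Coeffs.Regular.eventually_unique_in (hS : S.Regular) {ζ₀ : Freq n} (hζ₀ : ζ₀ ≠ 0)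
    {ξ₀ q r : ℝ} (hq : q ≠ 0) (hr : r ≠ 0) (h : S.dXiXi (pt ζ₀.fst ζ₀.snd ξ₀) = q)
    (h' : S.dSigma (pt ζ₀.fst ζ₀.snd ξ₀) = r) :
    ∃ δ > 0, ∀ᶠ ζ in 𝓝 ζ₀, ∀ a b : ℝ, (a : ℂ) ∈ Metric.ball (ξ₀ : ℂ) δ →
      (b : ℂ) ∈ Metric.ball (ξ₀ : ℂ) δ → S.InFreq ζ a → S.InFreq ζ b → ¬ a < b := by
  have hsign : ∀ {c : ℝ} {f : CFreq n → ℂ}, Continuous f → c ≠ 0 →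
      f (pt ζ₀.fst ζ₀.snd ξ₀) = c →
      ∀ᶠ z in 𝓝 (pt (ζ₀.fst : ℂ) ζ₀.snd (ξ₀ : ℂ)), 0 < (f z).re * c := by
    intro c f hf hc hfc
    have h1 : Continuous fun z => (f z).re * c := (Complex.continuous_re.comp hf).mul_const c
    refine h1.continuousAt.eventually_mem (Ioi_mem_nhds ?_)
    rw [hfc, Complex.ofReal_re]
    exact mul_self_pos.2 hc
  obtain ⟨δ, hδ, hev⟩ := exists_ball_of_eventually
    ((hsign S.continuous_dXiXi hq h).and (hsign S.contDiff_dSigma.continuous hr h'))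
  refine ⟨δ, hδ, ?_⟩
  filter_upwards [hev, eventually_ne_nhds hζ₀] with ζ hζ hζ0 a b ha hb hIa hIb hab
  have hseg : ∀ y ∈ Set.Icc a b, ((y : ℝ) : ℂ) ∈ Metric.ball (ξ₀ : ℂ) δ := by
    intro y hy
    rw [Metric.mem_ball, Complex.dist_eq, ← Complex.ofReal_sub, Complex.norm_real,
      Real.norm_eq_abs, abs_lt] at ha hb ⊢
    constructor <;> linarith [hy.1, hy.2]
  have hd1 : ∀ y : ℝ, HasDerivAt (fun y : ℝ => (S.charFun (pt ζ.fst ζ.snd y)).re)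
      (S.dXi (pt ζ.fst ζ.snd y)).re y := fun y =>
    (S.hasDerivAt_charFun ζ.fst ζ.snd y).real_of_complex
  have hd2 : ∀ y : ℝ, HasDerivAt (fun y : ℝ => (S.dXi (pt ζ.fst ζ.snd y)).re)
      (S.dXiXi (pt ζ.fst ζ.snd y)).re y := fun y =>
    (S.hasDerivAt_dXi ζ.fst ζ.snd y).real_of_complex
  -- a critical point `e` between the two roots, and the sign of `∂_ξ² det L` on either side of it
  obtain ⟨e, he, he0⟩ := exists_hasDerivAt_eq_zero hab
    (fun s _ => (hd1 s).continuousAt.continuousWithinAt) (by simp [hIa.1, hIb.1])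
    (fun s _ => hd1 s)
  obtain ⟨d₁, hd₁, he₁⟩ := exists_hasDerivAt_eq_slope _ _ he.1
    (fun s _ => (hd2 s).continuousAt.continuousWithinAt) (fun s _ => hd2 s)
  obtain ⟨d₂, hd₂, he₂⟩ := exists_hasDerivAt_eq_slope _ _ he.2
    (fun s _ => (hd2 s).continuousAt.continuousWithinAt) (fun s _ => hd2 s)
  rw [he0, zero_sub, eq_div_iff (sub_pos.2 he.1).ne'] at he₁
  rw [he0, sub_zero, eq_div_iff (sub_pos.2 he.2).ne'] at he₂
  have hc₁ := (hζ d₁ (hseg d₁ ⟨hd₁.1.le, (hd₁.2.trans he.2).le⟩)).1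
  have hc₂ := (hζ d₂ (hseg d₂ ⟨(he.1.trans hd₂.1).le, hd₂.2.le⟩)).1
  have hpos : ∀ y ∈ Set.Icc a b, S.InFreq ζ y → 0 < (S.dXi (pt ζ.fst ζ.snd y)).re * r := by
    intro y hy hIy
    obtain ⟨r', s', hr', e1, e2, -⟩ := hS ζ hζ0 y hIy.1
    have e3 := hIy.2
    have e4 := (hζ y (hseg y hy)).2
    rw [e1, e2, ← Complex.ofReal_mul, Complex.ofReal_re] at e3
    rw [e1, Complex.ofReal_re] at e4
    rw [e2, Complex.ofReal_re]
    have e5 : 0 < (s' * r) * (r' * r') := by nlinarith [mul_pos e3 e4]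
    exact pos_of_mul_pos_left e5 (mul_self_nonneg _)
  have hpa := hpos a ⟨le_rfl, hab.le⟩ hIa
  have hpb := hpos b ⟨hab.le, le_rfl⟩ hIb
  set sa := (S.dXi (pt ζ.fst ζ.snd a)).re
  set sb := (S.dXi (pt ζ.fst ζ.snd b)).re
  have f1 : 0 < -sa * q := by rw [← he₁]; nlinarith [mul_pos hc₁ (sub_pos.2 he.1)]
  have f2 : 0 < sb * q := by rw [← he₂]; nlinarith [mul_pos hc₂ (sub_pos.2 he.2)]
  have f3 : 0 < (-sa * q) * (sb * q) := mul_pos f1 f2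
  have f4 : 0 < (sa * r) * (sb * r) := mul_pos hpa hpb
  have f5 : 0 < sa * sb := by
    have : (sa * r) * (sb * r) = (sa * sb) * (r * r) := by ring
    rw [this] at f4
    exact pos_of_mul_pos_left f4 (mul_self_nonneg _)
  nlinarith [mul_nonneg f5.le (mul_self_nonneg q)]

/-- A root `ξ` at a real frequency that belongs to the stable part: `Im ξ > 0`, or `ξ` real and
incoming. -/
def Coeffs.StableRoot (S : Coeffs n N) (ζ : Freq n) (ξ : ℂ) : Prop :=
  0 < ξ.im ∨ (ξ.im = 0 ∧ S.InFreq ζ ξ)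

/-- Near a nonglancing frequency with `Im σ < 0`, the roots in the open upper half-plane are those
close to stable roots. -/
lemma Coeffs.Regular.eventually_im_pos_iff (hS : S.Regular) {ζ : Freq n} (hζ : ζ ≠ 0) {ξ₀ : ℂ}
    (h0 : S.charFun (pt ζ.fst ζ.snd ξ₀) = 0) (hng : ξ₀.im = 0 → S.dXi (pt ζ.fst ζ.snd ξ₀) ≠ 0) :
    ∀ᶠ p : (ℂ × EuclideanSpace ℝ (Fin n)) × ℂ in 𝓝 (((ζ.fst : ℂ), ζ.snd), ξ₀),
      p.1.1.im < 0 → S.charFun (pt p.1.1 p.1.2 p.2) = 0 → (0 < p.2.im ↔ S.StableRoot ζ ξ₀) := by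
  have him : Continuous fun p : (ℂ × EuclideanSpace ℝ (Fin n)) × ℂ => p.2.im := by fun_prop
  rcases lt_trichotomy ξ₀.im 0 with h | h | h
  · filter_upwards [him.continuousAt.eventually_mem (Iio_mem_nhds h)] with p hp _ _
    have hp' : p.2.im < 0 := hp
    simp [Coeffs.StableRoot, h.ne, not_lt.2 hp'.le, not_lt.2 h.le]
  · obtain ⟨ξr, rfl⟩ : ∃ ξr : ℝ, ξ₀ = ξr := ⟨ξ₀.re, Complex.ext rfl (by simpa using h)⟩
    obtain ⟨r, s, hr, h1, h2, -⟩ := hS ζ hζ ξr h0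
    have hs : s ≠ 0 := fun h3 => hng (by simp) (by rw [h2, h3]; simp)
    have hmin : 0 < min |r| |s| / 2 := by
      have := lt_min (abs_pos.2 hr) (abs_pos.2 hs); linarith
    have h3 := eventually_im_expansion (S.hasStrictFDerivAt_charFun (pt ζ.fst ζ.snd ξr))
      S.charFun_star (star_pt_ofReal _ _ _) hmin
    have hcont : Continuous fun p : (ℂ × EuclideanSpace ℝ (Fin n)) × ℂ =>
        pt p.1.1 p.1.2 p.2 :=
      continuous_pt.comp (f := fun p : (ℂ × EuclideanSpace ℝ (Fin n)) × ℂ =>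
        (p.1.1, p.1.2, p.2)) (by fun_prop)
    have h4 := (hcont.tendsto (((ζ.fst : ℂ), ζ.snd), (ξr : ℂ))).eventually h3
    filter_upwards [h4] with p hp hσ hQ
    have h5 := hp _ _ _ rfl
    have e1 : (fderiv ℂ S.charFun (pt (ζ.fst : ℂ) ζ.snd ξr)) (1, 0, 0) = r := h1
    have e2 : (fderiv ℂ S.charFun (pt (ζ.fst : ℂ) ζ.snd ξr)) (0, 0, 1) = s := h2
    rw [e1, e2, hQ] at h5
    simp only [Complex.ofReal_re, Complex.zero_im, zero_sub, abs_neg, abs_of_neg hσ] at h5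
    have hm1 := min_le_left |r| |s|
    have hm2 := min_le_right |r| |s|
    set y := p.2.im
    set v := p.1.1.im
    have hm0 : 0 < min |r| |s| := by linarith
    -- at a root the first-order term `v r + y s` is at most half of `|v r| + |y s|`
    have hrhs : min |r| |s| / 2 * (-v + |y|) ≤ (|r| * (-v) + |s| * |y|) / 2 := by
      nlinarith [abs_nonneg y]
    have hlt : |v * r + y * s| < |r| * (-v) + |s| * |y| := by
      have : 0 < |r| * (-v) + |s| * |y| :=
        add_pos_of_pos_of_nonneg (mul_pos (abs_pos.2 hr) (by linarith)) (by positivity)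
      linarith
    have hst : S.StableRoot ζ ξr ↔ 0 < s * r := by
      simp only [Coeffs.StableRoot, Complex.ofReal_im, lt_irrefl, false_or, true_and,
        Coeffs.InFreq, h0, h1, h2, ← Complex.ofReal_mul, Complex.ofReal_re]
    rw [hst]
    -- equal signs of `v r` and `y s` would exclude cancellation in `v r + y s`
    rcases lt_or_gt_of_ne hr with hr' | hr' <;> rcases lt_or_gt_of_ne hs with hs' | hs'
    · refine iff_of_true ?_ (mul_pos_of_neg_of_neg hs' hr')
      by_contra hy
      rw [abs_of_neg hr', abs_of_neg hs', abs_of_nonpos (not_lt.1 hy)] at hlt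
      have := le_abs_self (v * r + y * s); linarith
    · refine iff_of_false ?_ (not_lt.2 (mul_nonpos_of_nonneg_of_nonpos hs'.le hr'.le))
      intro hy
      rw [abs_of_neg hr', abs_of_pos hs', abs_of_pos hy] at hlt
      have := le_abs_self (v * r + y * s); linarith
    · refine iff_of_false ?_ (not_lt.2 (mul_nonpos_of_nonpos_of_nonneg hs'.le hr'.le))
      intro hy
      rw [abs_of_pos hr', abs_of_neg hs', abs_of_pos hy] at hlt
      have := neg_le_abs (v * r + y * s); linarith
    · refine iff_of_true ?_ (mul_pos hs' hr')
      by_contra hy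
      rw [abs_of_pos hr', abs_of_pos hs', abs_of_nonpos (not_lt.1 hy)] at hlt
      have := neg_le_abs (v * r + y * s); linarith
  · filter_upwards [him.continuousAt.eventually_mem (Ioi_mem_nhds h)] with p hp _ _
    have hp' : 0 < p.2.im := hp
    simp [Coeffs.StableRoot, h, hp']

end LocalAnalysis

/-! ### Separation of the roots and distance to the glancing set -/

section GlancingDistance

variable {n N : ℕ} {S : Coeffs n N}

/-- The frequencies `ζ ≠ 0` at which `det L(0, (ζ, ·))` has a real multiple root. -/
def Coeffs.doubleSet (S : Coeffs n N) : Set (Freq n) :=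
  {ζ | ζ ≠ 0 ∧ ∃ ξ : ℝ, S.charFun (pt ζ.fst ζ.snd ξ) = 0 ∧ S.dXi (pt ζ.fst ζ.snd ξ) = 0}

/-- The inclusion of real frequencies into complex ones. -/
def realPt (n : ℕ) : (ℝ × EuclideanSpace ℝ (Fin n) × ℝ) →L[ℝ] CFreq n :=
  LinearMap.toContinuousLinearMap
    { toFun := fun w => pt w.1 w.2.1 w.2.2
      map_add' := fun v w => by
        refine Prod.ext ?_ (Prod.ext ?_ ?_)
        · simp [pt]
        · ext j; simp [pt]
        · simp [pt]
      map_smul' := fun c w => by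
        refine Prod.ext ?_ (Prod.ext ?_ ?_)
        · simp [pt]
        · ext j; simp [pt]
        · simp [pt] }

lemma realPt_apply (w : ℝ × EuclideanSpace ℝ (Fin n) × ℝ) : realPt n w = pt w.1 w.2.1 w.2.2 := rfl

/-- Near a glancing point the distance to the glancing set is controlled by `|det L|` and
`|∂_ξ det L|`: the map `(τ, η, ξ) ↦ (det L, η, ∂_ξ det L)` is a local diffeomorphism because
`∂_σ det L ≠ 0` and `∂_ξ² det L ≠ 0`. -/
lemma Coeffs.Regular.exists_double_near (hS : S.Regular) {ζ₀ : Freq n} (hζ₀ : ζ₀ ≠ 0) {ξ₀ : ℝ}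
    (h0 : S.charFun (pt ζ₀.fst ζ₀.snd ξ₀) = 0) (h1 : S.dXi (pt ζ₀.fst ζ₀.snd ξ₀) = 0) :
    ∃ C > 0, ∀ᶠ p : Freq n × ℝ in 𝓝 (ζ₀, ξ₀), ∃ ζ' ∈ S.doubleSet,
      dist p.1 ζ' ≤ C * (‖S.charFun (pt p.1.fst p.1.snd p.2)‖ + ‖S.dXi (pt p.1.fst p.1.snd p.2)‖) := by
  obtain ⟨r, s, hr, hσ, hs, hq⟩ := hS ζ₀ hζ₀ ξ₀ h0
  obtain ⟨q, hq0, hqq⟩ := hq (by rw [h1] at hs; exact_mod_cast hs.symm)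
  set w₀ : ℝ × EuclideanSpace ℝ (Fin n) × ℝ := (ζ₀.fst, ζ₀.snd, ξ₀) with hw₀
  have d1 := Complex.reCLM.hasStrictFDerivAt.comp w₀
    (((S.hasStrictFDerivAt_charFun (realPt n w₀)).restrictScalars ℝ).comp w₀
      (realPt n).hasStrictFDerivAt)
  have d2 := Complex.reCLM.hasStrictFDerivAt.comp w₀
    (((S.hasStrictFDerivAt_dXi (realPt n w₀)).restrictScalars ℝ).comp w₀
      (realPt n).hasStrictFDerivAt)
  have d3 := ((ContinuousLinearMap.fst ℝ (EuclideanSpace ℝ (Fin n)) ℝ).comp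
    (ContinuousLinearMap.snd ℝ ℝ (EuclideanSpace ℝ (Fin n) × ℝ))).hasStrictFDerivAt (x := w₀)
  have d := d1.prodMk (d3.prodMk d2)
  set Φ : ℝ × EuclideanSpace ℝ (Fin n) × ℝ → ℝ × EuclideanSpace ℝ (Fin n) × ℝ := fun w =>
    ((S.charFun (realPt n w)).re, w.2.1, (S.dXi (realPt n w)).re) with hΦ
  obtain ⟨L, hL, hLs⟩ : ∃ L, HasStrictFDerivAt Φ L w₀ ∧ ∀ v, L v =
      ((fderiv ℂ S.charFun (realPt n w₀) (realPt n v)).re, v.2.1,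
        (fderiv ℂ S.dXi (realPt n w₀) (realPt n v)).re) := ⟨_, d, fun v => rfl⟩
  have hinj : Function.Injective L.toLinearMap := by
    rw [← LinearMap.ker_eq_bot, LinearMap.ker_eq_bot']
    intro v hv
    have hv' : L v = 0 := hv
    rw [hLs] at hv'
    obtain ⟨a, e, y⟩ := v
    simp only [Prod.mk_eq_zero] at hv'
    obtain ⟨v1, v2, v3⟩ := hv'
    subst v2
    have hdec : realPt n (a, 0, y) = (a : ℂ) • ((1, 0, 0) : CFreq n) + (y : ℂ) • ((0, 0, 1) : CFreq n) := by
      refine Prod.ext ?_ (Prod.ext ?_ ?_)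
      · simp [realPt_apply, pt]
      · ext j; simp [realPt_apply, pt]
      · simp [realPt_apply, pt]
    rw [hdec, map_add, map_smul, map_smul] at v1 v3
    have e1 : fderiv ℂ S.charFun (realPt n w₀) (1, 0, 0) = r := hσ
    have e2 : fderiv ℂ S.charFun (realPt n w₀) (0, 0, 1) = 0 := h1
    have e3 : fderiv ℂ S.dXi (realPt n w₀) (0, 0, 1) = q := hqq
    rw [e1, e2, smul_zero, add_zero, smul_eq_mul, ← Complex.ofReal_mul, Complex.ofReal_re] at v1
    have ha : a = 0 := (mul_eq_zero.1 v1).resolve_right hr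
    rw [e3, ha, Complex.ofReal_zero, zero_smul, zero_add, smul_eq_mul, ← Complex.ofReal_mul,
      Complex.ofReal_re] at v3
    have hy : y = 0 := (mul_eq_zero.1 v3).resolve_right hq0
    rw [ha, hy]; rfl
  set e := (LinearEquiv.ofInjectiveEndo L.toLinearMap hinj).toContinuousLinearEquiv
  have hΦ' : HasStrictFDerivAt Φ
      (e : (ℝ × EuclideanSpace ℝ (Fin n) × ℝ) →L[ℝ] (ℝ × EuclideanSpace ℝ (Fin n) × ℝ)) w₀ := by
    have he : (e : (ℝ × EuclideanSpace ℝ (Fin n) × ℝ) →L[ℝ] (ℝ × EuclideanSpace ℝ (Fin n) × ℝ)) = L :=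
      ContinuousLinearMap.ext fun _ => rfl
    rw [he]
    exact hL
  have hΦ₀ : Φ w₀ = (0, ζ₀.snd, 0) := by
    have a1 : S.charFun (realPt n w₀) = 0 := h0
    have a2 : S.dXi (realPt n w₀) = 0 := h1
    exact Prod.ext (congrArg Complex.re a1) (Prod.ext rfl (congrArg Complex.re a2))
  set ψ := hΦ'.localInverse Φ e w₀
  obtain ⟨C, hC, hbd⟩ := (hΦ'.to_localInverse.isBigO_sub).exists_pos
  rw [Asymptotics.IsBigOWith_def] at hbd
  have hinv := hΦ'.eventually_left_inverse
  have hrinv := hΦ'.eventually_right_inverse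
  have hψ0 : ψ (Φ w₀) = w₀ := hinv.self_of_nhds
  have hψc : Tendsto ψ (𝓝 (Φ w₀)) (𝓝 w₀) := by
    have h := hΦ'.to_localInverse.continuousAt.tendsto
    change Tendsto ψ _ (𝓝 (ψ (Φ w₀))) at h
    rwa [hψ0] at h
  -- the nearby glancing point is the inverse image of `(0, η, 0)`; it has the same `η`
  have t1 : Tendsto (fun p : Freq n × ℝ => ((p.1.fst, p.1.snd, p.2) :
      ℝ × EuclideanSpace ℝ (Fin n) × ℝ)) (𝓝 (ζ₀, ξ₀)) (𝓝 w₀) := by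
    have : Continuous fun p : Freq n × ℝ => ((p.1.fst, p.1.snd, p.2) :
      ℝ × EuclideanSpace ℝ (Fin n) × ℝ) := by fun_prop
    exact this.tendsto (ζ₀, ξ₀)
  have t2 : Tendsto (fun p : Freq n × ℝ => ((0, p.1.snd, 0) :
      ℝ × EuclideanSpace ℝ (Fin n) × ℝ)) (𝓝 (ζ₀, ξ₀)) (𝓝 (Φ w₀)) := by
    have : Continuous fun p : Freq n × ℝ => ((0, p.1.snd, 0) :
      ℝ × EuclideanSpace ℝ (Fin n) × ℝ) := by fun_prop
    rw [hΦ₀]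
    exact this.tendsto (ζ₀, ξ₀)
  have t3 := (hΦ'.continuousAt.tendsto.comp t1).prodMk_nhds t2
  have t4 : Tendsto (fun p : Freq n × ℝ => (WithLp.toLp 2 ((ψ (0, p.1.snd, 0)).1, p.1.snd) : Freq n))
      (𝓝 (ζ₀, ξ₀)) (𝓝 ζ₀) := by
    have a1 : Tendsto (fun p : Freq n × ℝ => (ψ (0, p.1.snd, 0)).1) (𝓝 (ζ₀, ξ₀)) (𝓝 ζ₀.fst) :=
      (continuous_fst.tendsto w₀).comp (hψc.comp t2)
    have a2 : Tendsto (fun p : Freq n × ℝ => p.1.snd) (𝓝 (ζ₀, ξ₀)) (𝓝 ζ₀.snd) := by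
      have : Continuous fun p : Freq n × ℝ => p.1.snd := by fun_prop
      exact this.tendsto (ζ₀, ξ₀)
    exact ((WithLp.prod_continuous_toLp 2 ℝ (EuclideanSpace ℝ (Fin n))).tendsto _).comp
      (a1.prodMk_nhds a2)
  refine ⟨C, hC, ?_⟩
  filter_upwards [t1.eventually hinv, t2.eventually hrinv, t3.eventually hbd,
    t4.eventually (eventually_ne_nhds hζ₀)] with p p1 p2 p3 p4
  have b1 : (S.charFun (realPt n (ψ (0, p.1.snd, 0)))).re = 0 := congrArg Prod.fst p2
  have b2 : (ψ (0, p.1.snd, 0)).2.1 = p.1.snd := congrArg (fun v => v.2.1) p2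
  have b3 : (S.dXi (realPt n (ψ (0, p.1.snd, 0)))).re = 0 := congrArg (fun v => v.2.2) p2
  have b4 : realPt n (ψ (0, p.1.snd, 0)) =
      pt ((ψ (0, p.1.snd, 0)).1 : ℝ) p.1.snd ((ψ (0, p.1.snd, 0)).2.2 : ℝ) := by
    rw [realPt_apply, b2]
  rw [b4] at b1 b3
  refine ⟨_, ⟨p4, (ψ (0, p.1.snd, 0)).2.2, ?_, ?_⟩, ?_⟩
  · rw [S.charFun_ofReal, Complex.ofReal_re] at b1
    have b5 : S.charFun (pt ((ψ (0, p.1.snd, 0)).1 : ℝ) p.1.snd ((ψ (0, p.1.snd, 0)).2.2 : ℝ)) = 0 := by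
      rw [S.charFun_ofReal, b1, Complex.ofReal_zero]
    exact b5
  · refine Complex.ext b3 ?_
    have := S.dXi_star (pt ((ψ (0, p.1.snd, 0)).1 : ℝ) p.1.snd ((ψ (0, p.1.snd, 0)).2.2 : ℝ))
    rw [star_pt_ofReal] at this
    exact Complex.conj_eq_iff_im.1 this.symm
  · have c1 : dist p.1 (WithLp.toLp 2 ((ψ (0, p.1.snd, 0)).1, p.1.snd) : Freq n) =
        ‖p.1.fst - (ψ (0, p.1.snd, 0)).1‖ := by
      rw [dist_eq_norm, ← WithLp.norm_toLp_fst 2 ℝ (EuclideanSpace ℝ (Fin n))]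
      congr 1
      apply (WithLp.equiv 2 _).injective
      exact Prod.ext rfl (sub_self _)
    rw [c1]
    change ‖ψ (Φ (p.1.fst, p.1.snd, p.2)) - ψ (0, p.1.snd, 0)‖ ≤
      C * ‖Φ (p.1.fst, p.1.snd, p.2) - (0, p.1.snd, 0)‖ at p3
    have c2 : ψ (Φ (p.1.fst, p.1.snd, p.2)) = (p.1.fst, p.1.snd, p.2) := p1
    rw [c2] at p3
    refine (norm_fst_le ((p.1.fst, p.1.snd, p.2) - ψ (0, p.1.snd, 0))).trans (p3.trans ?_)
    refine mul_le_mul_of_nonneg_left ?_ hC.le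
    have c3 : Φ (p.1.fst, p.1.snd, p.2) - (0, p.1.snd, 0) =
        ((S.charFun (pt p.1.fst p.1.snd p.2)).re, 0, (S.dXi (pt p.1.fst p.1.snd p.2)).re) := by
      simp [hΦ, realPt_apply]
    rw [c3, Prod.norm_def, Prod.norm_def]
    have c4 := Complex.abs_re_le_norm (S.charFun (pt p.1.fst p.1.snd p.2))
    have c5 := Complex.abs_re_le_norm (S.dXi (pt p.1.fst p.1.snd p.2))
    have c6 := norm_nonneg (S.charFun (pt p.1.fst p.1.snd p.2))
    have c7 := norm_nonneg (S.dXi (pt p.1.fst p.1.snd p.2))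
    simp only [Real.norm_eq_abs, norm_zero]
    refine max_le (by linarith) (max_le (by linarith) (by linarith))

/-- Real unit frequencies with their roots. -/
def Coeffs.rootBundle (S : Coeffs n N) : Set (Freq n × (Fin N → ℂ)) :=
  {p | ‖p.1‖ = 1 ∧ S.IsRoots p.1.fst p.1.snd p.2}

lemma Coeffs.continuous_opAReal (S : Coeffs n N) : Continuous S.opAReal :=
  S.continuous_opA.comp (f := fun ζ : Freq n => ((ζ.fst : ℂ), ζ.snd)) (by fun_prop)

lemma Coeffs.exists_opNorm_le (S : Coeffs n N) :
    ∃ M : ℝ, 1 ≤ M ∧ ∀ ζ : Freq n, ‖ζ‖ = 1 → ‖S.opAReal ζ‖ ≤ M := by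
  obtain ⟨M, hM⟩ := (isCompact_sphere (0 : Freq n) 1).exists_bound_of_continuousOn
    S.continuous_opAReal.continuousOn
  exact ⟨max M 1, le_max_right _ _, fun ζ hζ => (hM ζ (by simpa using hζ)).trans (le_max_left _ _)⟩

lemma Coeffs.isCompact_rootBundle (hnor : IsUnit S.nor.det) : IsCompact S.rootBundle := by
  obtain ⟨M, -, hM⟩ := S.exists_opNorm_le
  refine Metric.isCompact_of_isClosed_isBounded ?_ ?_
  · have h1 : IsClosed {p : Freq n × (Fin N → ℂ) | ‖p.1‖ = 1} :=
      isClosed_eq (by fun_prop) continuous_const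
    have h2 : IsClosed {p : Freq n × (Fin N → ℂ) | S.IsRoots p.1.fst p.1.snd p.2} := by
      have : {p : Freq n × (Fin N → ℂ) | S.IsRoots p.1.fst p.1.snd p.2} =
          ⋂ ξ : ℂ, {p | S.charFun (pt p.1.fst p.1.snd ξ) = (S.nor.det : ℂ) * ∏ i, (ξ - p.2 i)} := by
        ext p; simp [Coeffs.IsRoots]
      rw [this]
      refine isClosed_iInter fun ξ => isClosed_eq ?_ (by fun_prop)
      exact S.contDiff_charFun.continuous.comp
        (continuous_ptFreq.comp (f := fun p : Freq n × (Fin N → ℂ) => (p.1, ξ)) (by fun_prop))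
    exact h1.inter h2
  · refine (Metric.isBounded_closedBall (x := (0 : Freq n × (Fin N → ℂ))) (r := max 1 M)).subset ?_
    rintro ⟨ζ, x⟩ ⟨h1, h2⟩
    rw [mem_closedBall_zero_iff, Prod.norm_def]
    refine max_le_max h1.le ?_
    have hM0 := (norm_nonneg _).trans (hM ζ h1)
    exact (pi_norm_le_iff_of_nonneg hM0).2 fun i => (h2.norm_le hnor i).trans (hM ζ h1)

/-- A constant that may be decreased can be chosen uniformly on a compact set if it can be chosen
locally. -/
lemma exists_pos_of_local {X : Type*} [TopologicalSpace X] {K : Set X} (hK : IsCompact K)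
    {P : X → ℝ → Prop} (hmono : ∀ x a b, a ≤ b → P x b → P x a)
    (h : ∀ x ∈ K, ∃ c > 0, ∀ᶠ y in 𝓝[K] x, P y c) : ∃ c > 0, ∀ x ∈ K, P x c := by
  have := hK.induction_on (p := fun s => ∃ c > 0, ∀ x ∈ s, P x c) ⟨1, one_pos, by simp⟩
    (fun s t hst ⟨c, hc, ht⟩ => ⟨c, hc, fun x hx => ht x (hst hx)⟩)
    (fun s t ⟨c, hc, hs⟩ ⟨d, hd, ht⟩ => ⟨min c d, lt_min hc hd, fun x hx => hx.elim
      (fun h => hmono _ _ _ (min_le_left _ _) (hs x h))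
      (fun h => hmono _ _ _ (min_le_right _ _) (ht x h))⟩)
    (fun x hx => by
      obtain ⟨c, hc, hev⟩ := h x hx
      exact ⟨_, hev, c, hc, fun y hy => hy⟩)
  exact this

lemma exists_pos_forall_of_finite {κ : Type*} [Finite κ] {P : κ → ℝ → Prop}
    (hmono : ∀ k a b, a ≤ b → P k b → P k a) (h : ∀ k, ∃ c > 0, P k c) :
    ∃ c > 0, ∀ k, P k c := by
  let _ : TopologicalSpace κ := ⊥
  have _ : DiscreteTopology κ := ⟨rfl⟩
  obtain ⟨c, hc, h'⟩ := exists_pos_of_local (Set.finite_univ (α := κ)).isCompact hmono fun x _ => by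
    obtain ⟨c, hc, hx⟩ := h x
    exact ⟨c, hc, by simpa using hx⟩
  exact ⟨c, hc, fun k => h' k trivial⟩

/-- Roots are separated, from each other or from the real axis, by the distance to the glancing
set. -/
theorem Coeffs.Regular.exists_gap (hS : S.Regular) (hnor : IsUnit S.nor.det) :
    ∃ c > 0, ∀ ζ : Freq n, ‖ζ‖ = 1 → ∀ x, S.IsRoots ζ.fst ζ.snd x → ∀ i j, i ≠ j →
      ∀ g : ℝ, 0 ≤ g → g ≤ 1 → ENNReal.ofReal g ≤ Metric.infEDist ζ S.doubleSet →
        c * g ≤ ‖x i - x j‖ + |(x i).im| := by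
  classical
  suffices h : ∃ c > 0, ∀ k : Fin N × Fin N, ∀ p ∈ S.rootBundle, k.1 ≠ k.2 →
      ∀ g : ℝ, 0 ≤ g → g ≤ 1 → ENNReal.ofReal g ≤ Metric.infEDist p.1 S.doubleSet →
        c * g ≤ ‖p.2 k.1 - p.2 k.2‖ + |(p.2 k.1).im| by
    obtain ⟨c, hc, h⟩ := h
    exact ⟨c, hc, fun ζ hζ x hx i j => h (i, j) (ζ, x) ⟨hζ, hx⟩⟩
  refine exists_pos_forall_of_finite
    (fun k a b hab h p hp hk g h0 h1 hg => (mul_le_mul_of_nonneg_right hab h0).trans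
      (h p hp hk g h0 h1 hg)) fun ⟨i, j⟩ => ?_
  refine exists_pos_of_local (Coeffs.isCompact_rootBundle hnor)
    (fun p a b hab h hk g h0 h1 hg => (mul_le_mul_of_nonneg_right hab h0).trans
      (h hk g h0 h1 hg)) ?_
  rintro ⟨ζ₀, x₀⟩ ⟨hζ₀, hx₀⟩
  dsimp only at hζ₀ hx₀ ⊢
  by_cases hij : i = j
  · exact ⟨1, one_pos, Eventually.of_forall fun _ h => absurd hij h⟩
  have hcontF : Continuous fun p : Freq n × (Fin N → ℂ) => ‖p.2 i - p.2 j‖ + |(p.2 i).im| := by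
    have : Continuous fun p : Freq n × (Fin N → ℂ) => (p.2 i).im :=
      Complex.continuous_im.comp (by fun_prop)
    fun_prop
  by_cases hF : ‖x₀ i - x₀ j‖ + |(x₀ i).im| = 0
  swap
  · -- away from real double roots the left-hand side is bounded below
    have hpos : 0 < ‖x₀ i - x₀ j‖ + |(x₀ i).im| := lt_of_le_of_ne (by positivity) (Ne.symm hF)
    refine ⟨_, half_pos hpos, mem_nhdsWithin_of_mem_nhds ?_⟩
    filter_upwards [hcontF.continuousAt.eventually_mem (Ioi_mem_nhds (half_lt_self hpos))]
      with p hp _ g hg0 hg1 _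
    have hp' : (‖x₀ i - x₀ j‖ + |(x₀ i).im|) / 2 < ‖p.2 i - p.2 j‖ + |(p.2 i).im| := hp
    nlinarith
  have hxij : x₀ i = x₀ j := by
    have : ‖x₀ i - x₀ j‖ = 0 := by linarith [norm_nonneg (x₀ i - x₀ j), abs_nonneg (x₀ i).im]
    exact sub_eq_zero.1 (norm_eq_zero.1 this)
  have him : (x₀ i).im = 0 := by
    have : |(x₀ i).im| = 0 := by linarith [norm_nonneg (x₀ i - x₀ j), abs_nonneg (x₀ i).im]
    exact abs_eq_zero.1 this
  have hre : ((x₀ i).re : ℂ) = x₀ i := Complex.ext rfl (by simp [him])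
  have hne : ζ₀ ≠ 0 := by rintro rfl; simp at hζ₀
  have hQ0 : S.charFun (pt ζ₀.fst ζ₀.snd (x₀ i)) = 0 := hx₀.charFun_eq_zero i
  have hd0 : S.dXi (pt ζ₀.fst ζ₀.snd (x₀ i)) = 0 := by
    rw [hx₀.dXi_eq, Finset.prod_eq_zero (Finset.mem_erase.2 ⟨Ne.symm hij, Finset.mem_univ j⟩)
      (sub_eq_zero.2 hxij), mul_zero]
  -- near a real double root, `det L` and `∂_ξ det L` at `(ζ, Re x_i)` are bounded by the left-hand
  -- side: the first vanishes at `x_i`, and the second contains the factor `x_i - x_j` there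
  obtain ⟨C, hC, hdist⟩ := hS.exists_double_near hne (ξ₀ := (x₀ i).re) (by rwa [hre]) (by rwa [hre])
  obtain ⟨K₁, s₁, hs₁, hK₁⟩ :=
    (S.hasStrictFDerivAt_charFun (pt (ζ₀.fst : ℂ) ζ₀.snd (x₀ i))).exists_lipschitzOnWith
  obtain ⟨K₂, s₂, hs₂, hK₂⟩ :=
    (S.hasStrictFDerivAt_dXi (pt (ζ₀.fst : ℂ) ζ₀.snd (x₀ i))).exists_lipschitzOnWith
  have t1 : Tendsto (fun p : Freq n × (Fin N → ℂ) => pt (p.1.fst : ℂ) p.1.snd (p.2 i)) (𝓝 (ζ₀, x₀))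
      (𝓝 (pt (ζ₀.fst : ℂ) ζ₀.snd (x₀ i))) :=
    (continuous_ptFreq.comp (f := fun p : Freq n × (Fin N → ℂ) => (p.1, p.2 i))
      (by fun_prop)).tendsto (ζ₀, x₀)
  have hcre : Continuous fun p : Freq n × (Fin N → ℂ) => (p.2 i).re :=
    Complex.continuous_re.comp (by fun_prop)
  have t2 : Tendsto (fun p : Freq n × (Fin N → ℂ) => pt (p.1.fst : ℂ) p.1.snd ((p.2 i).re : ℂ))
      (𝓝 (ζ₀, x₀)) (𝓝 (pt (ζ₀.fst : ℂ) ζ₀.snd (x₀ i))) := by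
    have := (continuous_ptFreq.comp (f := fun p : Freq n × (Fin N → ℂ) => (p.1, ((p.2 i).re : ℂ)))
      (by fun_prop)).tendsto (ζ₀, x₀)
    simpa only [Function.comp_def, hre] using this
  have t3 : Tendsto (fun p : Freq n × (Fin N → ℂ) => (p.1, (p.2 i).re)) (𝓝 (ζ₀, x₀))
      (𝓝 (ζ₀, (x₀ i).re)) := by
    have : Continuous fun p : Freq n × (Fin N → ℂ) => (p.1, (p.2 i).re) := by fun_prop
    exact this.tendsto (ζ₀, x₀)
  set R : Freq n × (Fin N → ℂ) → ℝ := fun p => ‖(S.nor.det : ℂ) *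
    ∏ l ∈ (Finset.univ.erase i).erase j, (p.2 i - p.2 l)‖ with hR
  have hRc : Continuous R := by
    have : Continuous fun p : Freq n × (Fin N → ℂ) =>
      ∏ l ∈ (Finset.univ.erase i).erase j, (p.2 i - p.2 l) := by fun_prop
    fun_prop
  have t4 := hRc.continuousAt.eventually_mem (Iio_mem_nhds (lt_add_one (R (ζ₀, x₀))))
  set B := C * (K₁ + K₂ + (R (ζ₀, x₀) + 1)) with hB
  have hR0 : 0 ≤ R (ζ₀, x₀) := norm_nonneg _
  have hB0 : 0 < B := mul_pos hC (by positivity)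
  refine ⟨B⁻¹, inv_pos.2 hB0, ?_⟩
  filter_upwards [mem_nhdsWithin_of_mem_nhds (t1.eventually hs₁),
    mem_nhdsWithin_of_mem_nhds (t1.eventually hs₂), mem_nhdsWithin_of_mem_nhds (t2.eventually hs₁),
    mem_nhdsWithin_of_mem_nhds (t2.eventually hs₂),
    mem_nhdsWithin_of_mem_nhds (t3.eventually hdist), mem_nhdsWithin_of_mem_nhds t4,
    self_mem_nhdsWithin] with p p1 p2 p3 p4 p5 p6 p7 _ g hg0 hg1 hg
  obtain ⟨ζ', hζ', hd⟩ := p5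
  have hle : g ≤ dist p.1 ζ' := by
    have := hg.trans (Metric.infEDist_le_edist_of_mem hζ')
    rw [edist_dist] at this
    exact (ENNReal.ofReal_le_ofReal_iff dist_nonneg).1 this
  have hdpt : dist (pt (p.1.fst : ℂ) p.1.snd ((p.2 i).re : ℂ)) (pt (p.1.fst : ℂ) p.1.snd (p.2 i)) =
      |(p.2 i).im| := by
    have e : ((p.2 i).re : ℂ) - p.2 i = -((p.2 i).im * Complex.I) := by
      apply Complex.ext <;> simp
    simp only [pt, Prod.dist_eq, dist_self, Complex.dist_eq, e]
    simp
  have hQ : S.charFun (pt (p.1.fst : ℂ) p.1.snd (p.2 i)) = 0 := p7.2.charFun_eq_zero i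
  have hb1 : ‖S.charFun (pt p.1.fst p.1.snd ((p.2 i).re : ℂ))‖ ≤ K₁ * |(p.2 i).im| := by
    have := hK₁.dist_le_mul _ p3 _ p1
    rwa [hdpt, hQ, dist_zero_right] at this
  have hb2 : ‖S.dXi (pt p.1.fst p.1.snd (p.2 i))‖ ≤ (R (ζ₀, x₀) + 1) * ‖p.2 i - p.2 j‖ := by
    rw [p7.2.dXi_eq, ← Finset.mul_prod_erase _ _
      (Finset.mem_erase.2 ⟨Ne.symm hij, Finset.mem_univ j⟩), mul_left_comm, norm_mul, mul_comm]
    have : R p < R (ζ₀, x₀) + 1 := p6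
    exact mul_le_mul_of_nonneg_right this.le (norm_nonneg _)
  have hb3 : ‖S.dXi (pt p.1.fst p.1.snd ((p.2 i).re : ℂ))‖ ≤
      K₂ * |(p.2 i).im| + (R (ζ₀, x₀) + 1) * ‖p.2 i - p.2 j‖ := by
    have := hK₂.dist_le_mul _ p4 _ p2
    rw [hdpt, dist_eq_norm] at this
    have h3 := norm_le_norm_add_norm_sub' (S.dXi (pt p.1.fst p.1.snd ((p.2 i).re : ℂ)))
      (S.dXi (pt p.1.fst p.1.snd (p.2 i)))
    linarith
  rw [inv_mul_le_iff₀ hB0]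
  refine hle.trans (hd.trans ?_)
  rw [hB, mul_assoc]
  refine mul_le_mul_of_nonneg_left ((add_le_add hb1 hb3).trans ?_) hC.le
  have k1 := K₁.coe_nonneg
  have k2 := K₂.coe_nonneg
  nlinarith [norm_nonneg (p.2 i - p.2 j), abs_nonneg (p.2 i).im,
    mul_nonneg k1 (norm_nonneg (p.2 i - p.2 j)), mul_nonneg k2 (norm_nonneg (p.2 i - p.2 j)),
    mul_nonneg hR0 (abs_nonneg (p.2 i).im)]

/-- Two stable roots are separated from each other, or both from the real axis, uniformly in the
real frequency. -/
theorem Coeffs.Regular.exists_stable_gap (hS : S.Regular) (hnor : IsUnit S.nor.det) :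
    ∃ c > 0, ∀ ζ : Freq n, ‖ζ‖ = 1 → ∀ x, S.IsRoots ζ.fst ζ.snd x → ∀ i j, i ≠ j →
      S.StableRoot ζ (x i) → S.StableRoot ζ (x j) →
        c ≤ ‖x i - x j‖ ∨ (c ≤ (x i).im ∧ c ≤ (x j).im) := by
  classical
  suffices h : ∃ c > 0, ∀ k : Fin N × Fin N, ∀ p ∈ S.rootBundle, k.1 ≠ k.2 →
      S.StableRoot p.1 (p.2 k.1) → S.StableRoot p.1 (p.2 k.2) →
        c ≤ ‖p.2 k.1 - p.2 k.2‖ ∨ (c ≤ (p.2 k.1).im ∧ c ≤ (p.2 k.2).im) by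
    obtain ⟨c, hc, h⟩ := h
    exact ⟨c, hc, fun ζ hζ x hx i j => h (i, j) (ζ, x) ⟨hζ, hx⟩⟩
  refine exists_pos_forall_of_finite
    (fun k a b hab h p hp hk h1 h2 => (h p hp hk h1 h2).imp hab.trans
      (And.imp hab.trans hab.trans)) fun ⟨i, j⟩ => ?_
  refine exists_pos_of_local (Coeffs.isCompact_rootBundle hnor)
    (fun p a b hab h hk h1 h2 => (h hk h1 h2).imp hab.trans
      (And.imp hab.trans hab.trans)) ?_
  rintro ⟨ζ₀, x₀⟩ ⟨hζ₀, hx₀⟩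
  dsimp only at hζ₀ hx₀ ⊢
  by_cases hij : i = j
  · exact ⟨1, one_pos, Eventually.of_forall fun _ h => absurd hij h⟩
  have hi : Continuous fun p : Freq n × (Fin N → ℂ) => (p.2 i).im :=
    Complex.continuous_im.comp (by fun_prop)
  have hj : Continuous fun p : Freq n × (Fin N → ℂ) => (p.2 j).im :=
    Complex.continuous_im.comp (by fun_prop)
  by_cases hxij : x₀ i = x₀ j
  swap
  · have hpos : 0 < ‖x₀ i - x₀ j‖ := norm_pos_iff.2 (sub_ne_zero.2 hxij)
    have hc : Continuous fun p : Freq n × (Fin N → ℂ) => ‖p.2 i - p.2 j‖ := by fun_prop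
    refine ⟨_, half_pos hpos, mem_nhdsWithin_of_mem_nhds ?_⟩
    filter_upwards [hc.continuousAt.eventually_mem (Ioi_mem_nhds (half_lt_self hpos))]
      with p hp _ _ _
    exact Or.inl (le_of_lt hp)
  rcases lt_trichotomy (x₀ i).im 0 with h | h | h
  · refine ⟨1, one_pos, mem_nhdsWithin_of_mem_nhds ?_⟩
    filter_upwards [hi.continuousAt.eventually_mem (Iio_mem_nhds h)] with p hp _ h1 _
    have hp' : (p.2 i).im < 0 := hp
    rcases h1 with h1 | h1
    · exact absurd h1 (not_lt.2 hp'.le)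
    · exact absurd h1.1 hp'.ne
  · -- a real double root: it cannot be approached by two stable roots
    have hre : ((x₀ i).re : ℂ) = x₀ i := Complex.ext rfl (by simp [h])
    have hne : ζ₀ ≠ 0 := by rintro rfl; simp at hζ₀
    have hd0 : S.dXi (pt ζ₀.fst ζ₀.snd (x₀ i)) = 0 := by
      rw [hx₀.dXi_eq, Finset.prod_eq_zero (Finset.mem_erase.2 ⟨Ne.symm hij, Finset.mem_univ j⟩)
        (sub_eq_zero.2 hxij), mul_zero]
    obtain ⟨r, s, hr, hσ, hs, hq⟩ := hS ζ₀ hne (x₀ i).re (by rw [hre]; exact hx₀.charFun_eq_zero i)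
    obtain ⟨q, hq0, hqq⟩ := hq (by rw [hre, hd0] at hs; exact_mod_cast hs.symm)
    obtain ⟨δ₁, hδ₁, hev₁⟩ := S.eventually_unique_upper_root hq0 hqq
    obtain ⟨δ₂, hδ₂, hev₂⟩ := hS.eventually_unique_in hne hq0 hr hqq hσ
    rw [hre] at hev₁ hev₂
    have hball : ∀ k, x₀ k = x₀ i → ∀ δ > 0, ∀ᶠ p : Freq n × (Fin N → ℂ) in 𝓝 (ζ₀, x₀),
        p.2 k ∈ Metric.ball (x₀ i) δ := by
      intro k hk δ hδ
      have hc : Continuous fun p : Freq n × (Fin N → ℂ) => p.2 k := by fun_prop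
      exact hc.continuousAt.eventually_mem (by
        change _ ∈ 𝓝 (x₀ k)
        rw [hk]; exact Metric.ball_mem_nhds _ hδ)
    have hfst : Tendsto (fun p : Freq n × (Fin N → ℂ) => p.1) (𝓝 (ζ₀, x₀)) (𝓝 ζ₀) :=
      continuous_fst.tendsto (ζ₀, x₀)
    refine ⟨1, one_pos, ?_⟩
    filter_upwards [mem_nhdsWithin_of_mem_nhds (hfst.eventually hev₁),
      mem_nhdsWithin_of_mem_nhds (hfst.eventually hev₂),
      mem_nhdsWithin_of_mem_nhds (hball i rfl δ₁ hδ₁), mem_nhdsWithin_of_mem_nhds (hball i rfl δ₂ hδ₂),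
      mem_nhdsWithin_of_mem_nhds (hball j hxij.symm δ₁ hδ₁),
      mem_nhdsWithin_of_mem_nhds (hball j hxij.symm δ₂ hδ₂), self_mem_nhdsWithin]
      with p e1 e2 bi1 bi2 bj1 bj2 hp _ hsi hsj
    exfalso
    have hd : p.2 i = p.2 j → S.dXi (pt p.1.fst p.1.snd (p.2 i)) = 0 := fun h => by
      rw [hp.2.dXi_eq, Finset.prod_eq_zero (Finset.mem_erase.2 ⟨Ne.symm hij, Finset.mem_univ j⟩)
        (sub_eq_zero.2 h), mul_zero]
    have hin : ∀ k, S.StableRoot p.1 (p.2 k) → 0 ≤ (p.2 k).im := fun k hk =>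
      hk.elim le_of_lt fun h => h.1.ge
    by_cases hsum : 0 < (p.2 i).im + (p.2 j).im
    · obtain ⟨f1, f2⟩ := e1 _ bi1 _ bj1 (hin i hsi) (hin j hsj) hsum (hp.2.charFun_eq_zero i)
        (hp.2.charFun_eq_zero j)
      exact f2 (hd f1)
    · have hi0 : (p.2 i).im = 0 := by linarith [hin i hsi, hin j hsj]
      have hj0 : (p.2 j).im = 0 := by linarith [hin i hsi, hin j hsj]
      have hri : ((p.2 i).re : ℂ) = p.2 i := Complex.ext rfl (by simp [hi0])
      have hrj : ((p.2 j).re : ℂ) = p.2 j := Complex.ext rfl (by simp [hj0])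
      have hIi := (hsi.resolve_left (by simp [hi0])).2
      have hIj := (hsj.resolve_left (by simp [hj0])).2
      have hne' : p.2 i ≠ p.2 j := fun h => by
        have := hIi.2
        rw [hd h, zero_mul] at this
        simp at this
      have hne'' : (p.2 i).re ≠ (p.2 j).re := fun h => hne' (by rw [← hri, ← hrj, h])
      rw [← hri] at bi2 hIi
      rw [← hrj] at bj2 hIj
      rcases lt_or_gt_of_ne hne'' with h | h
      · exact e2 _ _ bi2 bj2 hIi hIj h
      · exact e2 _ _ bj2 bi2 hIj hIi h
  · refine ⟨_, half_pos h, mem_nhdsWithin_of_mem_nhds ?_⟩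
    have hj' : (x₀ i).im / 2 < (x₀ j).im := by rw [← hxij]; linarith
    filter_upwards [hi.continuousAt.eventually_mem (Ioi_mem_nhds (half_lt_self h)),
      hj.continuousAt.eventually_mem (Ioi_mem_nhds hj')] with p hp hp' _ _ _
    exact Or.inr ⟨le_of_lt hp, le_of_lt hp'⟩

end GlancingDistance

/-! ### The space `E_-(ζ)` and the decompositions -/

section Decomposition

variable {n N : ℕ} {S : Coeffs n N}

lemma Coeffs.IsRoots.isSpectrum (hnor : IsUnit S.nor.det) {ζ : Freq n} {x : Fin N → ℂ}
    (hx : S.IsRoots ζ.fst ζ.snd x) : IsSpectrum (S.opAReal ζ) fun i => Complex.I * x i :=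
  (Coeffs.isRoots_iff_isSpectrum hnor).1 hx

lemma tendsto_aeval_rootPoly {X ι : Type*} {l : Filter X} {T : X → Amp N →L[ℂ] Amp N}
    {T₀ : Amp N →L[ℂ] Amp N} {μ : X → ι → ℂ} {μ₀ : ι → ℂ} (hT : Tendsto T l (𝓝 T₀))
    (hμ : Tendsto μ l (𝓝 μ₀)) (s : Finset ι) :
    Tendsto (fun p => aeval (T p) (rootPoly (μ p) s)) l (𝓝 (aeval T₀ (rootPoly μ₀ s))) := by
  classical
  induction s using Finset.induction_on with
  | empty => simpa [rootPoly] using tendsto_const_nhds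
  | insert a s ha ih =>
    simp only [rootPoly_insert ha, map_mul, map_sub, aeval_X, aeval_C,
      Algebra.algebraMap_eq_smul_one]
    exact (hT.sub ((tendsto_pi_nhds.1 hμ a).smul_const _)).mul ih

lemma tendsto_aeval_rootPoly_apply {X ι : Type*} {l : Filter X} {T : X → Amp N →L[ℂ] Amp N}
    {T₀ : Amp N →L[ℂ] Amp N} {μ : X → ι → ℂ} {μ₀ : ι → ℂ} (hT : Tendsto T l (𝓝 T₀))
    (hμ : Tendsto μ l (𝓝 μ₀)) (s : Finset ι) {f : X → Amp N} {w : Amp N}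
    (hf : Tendsto f l (𝓝 w)) :
    Tendsto (fun p => aeval (T p) (rootPoly (μ p) s) (f p)) l (𝓝 (aeval T₀ (rootPoly μ₀ s) w)) :=
  ((isBoundedBilinearMap_apply (𝕜 := ℂ) (E := Amp N) (F := Amp N)).continuous.tendsto _).comp
    ((tendsto_aeval_rootPoly hT hμ s).prodMk_nhds hf)

/-- Along any ultrafilter converging to a nonglancing real frequency from `Im σ < 0`, the roots
converge, and those in the open upper half-plane are those with a stable limit. -/
lemma Coeffs.Regular.exists_limit_roots (hS : S.Regular) (hnor : IsUnit S.nor.det) {ζ : Freq n}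
    (hζ : ζ ≠ 0) (hng : ζ ∉ S.doubleSet) {x : ℂ × EuclideanSpace ℝ (Fin n) → Fin N → ℂ}
    (hx : ∀ p, S.IsRoots p.1 p.2 (x p)) (U : Ultrafilter (ℂ × EuclideanSpace ℝ (Fin n)))
    (hU : (U : Filter (ℂ × EuclideanSpace ℝ (Fin n))) ≤
      𝓝[{p | p.1.im < 0}] ((ζ.fst : ℂ), ζ.snd)) :
    ∃ x₀, S.IsRoots ζ.fst ζ.snd x₀ ∧ Tendsto x U (𝓝 x₀) ∧
      ∀ᶠ p in (U : Filter _), ∀ i, 0 < (x p i).im ↔ S.StableRoot ζ (x₀ i) := by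
  have hU1 : (U : Filter (ℂ × EuclideanSpace ℝ (Fin n))) ≤ 𝓝 ((ζ.fst : ℂ), ζ.snd) :=
    hU.trans nhdsWithin_le_nhds
  have hU2 : ∀ᶠ p in (U : Filter (ℂ × EuclideanSpace ℝ (Fin n))), p.1.im < 0 :=
    hU self_mem_nhdsWithin
  have hbd : ∀ᶠ p in (U : Filter (ℂ × EuclideanSpace ℝ (Fin n))),
      x p ∈ Metric.closedBall (0 : Fin N → ℂ) (‖S.opA ζ.fst ζ.snd‖ + 1) := by
    have h1 : ∀ᶠ p in 𝓝 ((ζ.fst : ℂ), ζ.snd), ‖S.opA p.1 p.2‖ < ‖S.opA ζ.fst ζ.snd‖ + 1 :=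
      (S.continuous_opA.norm.tendsto ((ζ.fst : ℂ), ζ.snd)).eventually_lt_const (lt_add_one _)
    filter_upwards [hU1 h1] with p hp
    rw [mem_closedBall_zero_iff]
    have hp' : ‖S.opA p.1 p.2‖ < ‖S.opA ζ.fst ζ.snd‖ + 1 := hp
    exact (pi_norm_le_iff_of_nonneg (by positivity)).2 fun i =>
      ((hx p).norm_le hnor i).trans hp'.le
  obtain ⟨x₀, -, hx₀⟩ := (isCompact_closedBall (0 : Fin N → ℂ)
    (‖S.opA ζ.fst ζ.snd‖ + 1)).ultrafilter_le_nhds (U.map x) (le_principal_iff.2 hbd)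
  have hlim : Tendsto x U (𝓝 x₀) := hx₀
  have hroots : S.IsRoots ζ.fst ζ.snd x₀ := by
    intro ξ
    have h1 : Tendsto (fun p : ℂ × EuclideanSpace ℝ (Fin n) => S.charFun (pt p.1 p.2 ξ)) U
        (𝓝 (S.charFun (pt ζ.fst ζ.snd ξ))) := by
      have : Continuous fun p : ℂ × EuclideanSpace ℝ (Fin n) => S.charFun (pt p.1 p.2 ξ) :=
        S.contDiff_charFun.continuous.comp (continuous_pt.comp
          (f := fun p : ℂ × EuclideanSpace ℝ (Fin n) => (p.1, p.2, ξ)) (by fun_prop))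
      exact (this.tendsto ((ζ.fst : ℂ), ζ.snd)).mono_left hU1
    have h2 : Tendsto (fun p => (S.nor.det : ℂ) * ∏ i, (ξ - x p i)) U
        (𝓝 ((S.nor.det : ℂ) * ∏ i, (ξ - x₀ i))) := by
      have : Continuous fun x : Fin N → ℂ => (S.nor.det : ℂ) * ∏ i, (ξ - x i) := by fun_prop
      exact (this.tendsto x₀).comp hlim
    refine tendsto_nhds_unique h1 (h2.congr fun p => (hx p ξ).symm)
  refine ⟨x₀, hroots, hlim, eventually_all.2 fun i => ?_⟩
  have hev := hS.eventually_im_pos_iff hζ (hroots.charFun_eq_zero i) (fun him h => by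
    have hre : ((x₀ i).re : ℂ) = x₀ i := Complex.ext rfl (by simp [him])
    refine hng ⟨hζ, (x₀ i).re, ?_, ?_⟩
    · rw [hre]; exact hroots.charFun_eq_zero i
    · rwa [hre])
  have hlim2 : Tendsto (fun p => (p, x p i)) U (𝓝 (((ζ.fst : ℂ), ζ.snd), x₀ i)) :=
    Tendsto.prodMk_nhds hU1 (tendsto_pi_nhds.1 hlim i)
  filter_upwards [hlim2.eventually hev, hU2] with p hp hσ
  exact hp hσ ((hx p).charFun_eq_zero i)

lemma neg_I_mul_I_mul (x : ℂ) : -Complex.I * (Complex.I * x) = x := by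
  rw [← mul_assoc, neg_mul, Complex.I_mul_I]; simp

/-- At a nonglancing frequency, `E_-(ζ)` is the sum of the generalized eigenspaces of the stable
roots. The stable space of `𝒜(σ, η)` is the kernel of the product over its stable roots and the
range of the product over the others; both products converge. -/
theorem Coeffs.Regular.Eminus_eq (hS : S.Regular) (hnor : IsUnit S.nor.det) {ζ : Freq n}
    (hζ : ζ ≠ 0) (hng : ζ ∉ S.doubleSet) :
    S.Eminus ζ = specSpace (S.opAReal ζ) fun μ => S.StableRoot ζ (-Complex.I * μ) := by
  classical
  choose x hx using fun p : ℂ × EuclideanSpace ℝ (Fin n) => Coeffs.exists_isRoots (S := S) hnor p.1 p.2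
  have hsp := fun p => (Coeffs.isRoots_iff_isSpectrum hnor).1 (hx p)
  have hre : ∀ p i, (Complex.I * x p i).re < 0 ↔ 0 < (x p i).im := fun p i => by simp
  have hopA : ∀ U : Ultrafilter (ℂ × EuclideanSpace ℝ (Fin n)),
      (U : Filter (ℂ × EuclideanSpace ℝ (Fin n))) ≤ 𝓝[{p | p.1.im < 0}] ((ζ.fst : ℂ), ζ.snd) →
      Tendsto (fun p : ℂ × EuclideanSpace ℝ (Fin n) => S.opA p.1 p.2) U (𝓝 (S.opAReal ζ)) := by
    intro U hU
    rw [Coeffs.opAReal]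
    exact (S.continuous_opA.tendsto ((ζ.fst : ℂ), ζ.snd)).mono_left (hU.trans nhdsWithin_le_nhds)
  have hmulI : ∀ {U : Ultrafilter (ℂ × EuclideanSpace ℝ (Fin n))} {x₀ : Fin N → ℂ},
      Tendsto x U (𝓝 x₀) →
      Tendsto (fun p i => Complex.I * x p i) U (𝓝 fun i => Complex.I * x₀ i) := by
    intro U x₀ h
    exact tendsto_pi_nhds.2 fun i => (tendsto_pi_nhds.1 h i).const_mul _
  ext w
  constructor
  · rintro ⟨f, hf, hfw⟩
    have : (𝓝[{p : ℂ × EuclideanSpace ℝ (Fin n) | p.1.im < 0}] ((ζ.fst : ℂ), ζ.snd)).NeBot := by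
      rw [← mem_closure_iff_nhdsWithin_neBot]
      have h1 : Tendsto (fun ε : ℝ => ((ζ.fst : ℂ) - ε * Complex.I, ζ.snd)) (𝓝[>] 0)
          (𝓝 ((ζ.fst : ℂ), ζ.snd)) := by
        have : Continuous fun ε : ℝ => ((ζ.fst : ℂ) - ε * Complex.I, ζ.snd) := by fun_prop
        have := this.tendsto 0
        simp only [Complex.ofReal_zero, zero_mul, sub_zero] at this
        exact this.mono_left nhdsWithin_le_nhds
      refine mem_closure_of_tendsto h1 ?_
      filter_upwards [self_mem_nhdsWithin] with ε hε
      have : (0 : ℝ) < ε := hε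
      simpa using this
    -- one ultrafilter is enough for this inclusion
    set U := Ultrafilter.of (𝓝[{p : ℂ × EuclideanSpace ℝ (Fin n) | p.1.im < 0}] ((ζ.fst : ℂ), ζ.snd))
    have hU : (U : Filter (ℂ × EuclideanSpace ℝ (Fin n))) ≤
      𝓝[{p | p.1.im < 0}] ((ζ.fst : ℂ), ζ.snd) := Ultrafilter.of_le _
    obtain ⟨x₀, hx₀, hlim, hev⟩ := hS.exists_limit_roots hnor hζ hng hx U hU
    rw [(hx₀.isSpectrum hnor).mem_specSpace_iff]
    simp only [neg_I_mul_I_mul]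
    have h1 := tendsto_aeval_rootPoly_apply (hopA U hU) (hmulI hlim)
      (Finset.univ.filter fun i => S.StableRoot ζ (x₀ i)) (hfw.mono_left hU)
    refine tendsto_nhds_unique_of_eventuallyEq h1 (tendsto_const_nhds (x := (0 : Amp N))) ?_
    have hσ : ∀ᶠ p in (U : Filter (ℂ × EuclideanSpace ℝ (Fin n))), p.1.im < 0 :=
      hU self_mem_nhdsWithin
    filter_upwards [hev, hσ] with p hp hpσ
    have h2 : f p ∈ specSpace (S.opA p.1 p.2) fun μ => μ.re < 0 := hf p hpσ
    rw [(hsp p).mem_specSpace_iff] at h2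
    simpa only [hre, hp] using h2
  · intro hw
    have hspζ := (hx ((ζ.fst : ℂ), ζ.snd)).isSpectrum hnor
    obtain ⟨v, hv⟩ := hspζ.exists_aeval_eq _ hw
    -- `w` is in the range of the product over the unstable roots; perturb that product
    refine ⟨fun p => aeval (S.opA p.1 p.2) (rootPoly (fun i => Complex.I * x p i)
      (Finset.univ.filter fun i => ¬ (Complex.I * x p i).re < 0)) v, fun p _ =>
        (hsp p).aeval_mem_specSpace (fun μ => μ.re < 0) v, ?_⟩
    rw [tendsto_iff_ultrafilter]
    intro U hU
    obtain ⟨x₀, hx₀, hlim, hev⟩ := hS.exists_limit_roots hnor hζ hng hx U hU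
    have h1 := tendsto_aeval_rootPoly_apply (hopA U hU) (hmulI hlim)
      (Finset.univ.filter fun i => ¬ S.StableRoot ζ (-Complex.I * (Complex.I * x₀ i)))
      (tendsto_const_nhds (x := v))
    rw [(hx₀.isSpectrum hnor).rootPoly_filter_eq hspζ
      fun μ => ¬ S.StableRoot ζ (-Complex.I * μ), hv] at h1
    refine h1.congr' ?_
    filter_upwards [hev] with p hp
    simp only [hre, hp, neg_I_mul_I_mul]

variable {τ : Fin N → EuclideanSpace ℝ (Fin n) × ℝ → ℝ}

/-- At simple real roots the kernels of the symbol are generalized eigenspaces. -/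
lemma Coeffs.iSup_kerSymbol_eq (hnor : IsUnit S.nor.det) {ζ : Freq n} {F : ℝ → Prop} {G : ℂ → Prop}
    (hFG : ∀ ξ : ℝ, F ξ ↔ G ξ)
    (hG : ∀ ξ : ℝ, G ξ → S.charFun (pt ζ.fst ζ.snd ξ) = 0 ∧ S.dXi (pt ζ.fst ζ.snd ξ) ≠ 0) :
    (⨆ (ξ : ℝ) (_ : F ξ), S.kerSymbol ζ ξ) =
      specSpace (S.opAReal ζ) fun μ => μ.re = 0 ∧ G (-Complex.I * μ) := by
  obtain ⟨x, hx⟩ := Coeffs.exists_isRoots (S := S) hnor ζ.fst ζ.snd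
  have hsp := hx.isSpectrum hnor
  apply le_antisymm
  · refine iSup₂_le fun ξ hξ => ?_
    refine le_iSup₂_of_le (f := fun (μ : ℂ) (_ : μ.re = 0 ∧ G (-Complex.I * μ)) =>
      Module.End.maxGenEigenspace (S.opAReal ζ).toLinearMap μ) (Complex.I * ξ)
      ⟨by simp, by rw [neg_I_mul_I_mul]; exact (hFG ξ).1 hξ⟩ fun w hw => ?_
    rw [Coeffs.mem_kerSymbol_iff hnor] at hw
    rw [Module.End.mem_maxGenEigenspace]
    refine ⟨1, ?_⟩
    rw [pow_one]
    exact sub_eq_zero.2 hw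
  · refine iSup₂_le fun μ ⟨hμ0, hμ⟩ => ?_
    have hμI : μ = Complex.I * (μ.im : ℂ) := Complex.ext (by simp [hμ0]) (by simp)
    rw [hμI, neg_I_mul_I_mul] at hμ
    refine le_iSup₂_of_le (f := fun (ξ : ℝ) (_ : F ξ) => S.kerSymbol ζ ξ) μ.im
      ((hFG _).2 hμ) fun w hw => ?_
    obtain ⟨h0, hd⟩ := hG _ hμ
    obtain ⟨i, hi⟩ := hx.exists_eq hnor h0
    have hsimple : ∀ j, j ≠ i → Complex.I * x j ≠ Complex.I * x i := by
      intro j hj h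
      have h' := mul_left_cancel₀ Complex.I_ne_zero h
      refine hd ?_
      rw [hi, hx.dXi_eq, Finset.prod_eq_zero (Finset.mem_erase.2 ⟨hj, Finset.mem_univ j⟩)
        (sub_eq_zero.2 h'.symm), mul_zero]
    rw [hμI, hi] at hw
    have := (hsp.maxGenEigenspace_eq (i := i) hsimple).1 hw
    rw [Coeffs.mem_kerSymbol_iff hnor, hi]
    exact this

lemma Coeffs.incSpace_eq (hτ : S.StrictlyHyperbolic τ) (hnor : IsUnit S.nor.det) {ζ : Freq n}
    (hζ : ζ ≠ 0) : S.incSpace τ ζ =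
      specSpace (S.opAReal ζ) fun μ => μ.re = 0 ∧ S.InFreq ζ (-Complex.I * μ) :=
  Coeffs.iSup_kerSymbol_eq hnor (fun _ => Coeffs.incoming_iff hτ hζ) fun ξ h =>
    ⟨h.1, fun h0 => by simpa [h0] using h.2⟩

lemma Coeffs.outSpace_eq (hτ : S.StrictlyHyperbolic τ) (hnor : IsUnit S.nor.det) {ζ : Freq n}
    (hζ : ζ ≠ 0) : S.outSpace τ ζ =
      specSpace (S.opAReal ζ) fun μ => μ.re = 0 ∧ S.OutFreq ζ (-Complex.I * μ) :=
  Coeffs.iSup_kerSymbol_eq hnor (fun _ => Coeffs.outgoing_iff hτ hζ) fun ξ h =>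
    ⟨h.1, fun h0 => by simpa [h0] using h.2⟩

lemma Coeffs.stableRoot_neg_I_mul_iff (ζ : Freq n) (μ : ℂ) :
    S.StableRoot ζ (-Complex.I * μ) ↔
      (μ.re = 0 ∧ S.InFreq ζ (-Complex.I * μ)) ∨ μ.re < 0 := by
  rw [Coeffs.StableRoot, or_comm]
  simp

theorem Coeffs.Regular.decomposes (hS : S.Regular) (hτ : S.StrictlyHyperbolic τ)
    (hnor : IsUnit S.nor.det) {ζ : Freq n} (hζ : ζ ≠ 0) (hng : ζ ∉ S.doubleSet) :
    S.Decomposes τ ζ := by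
  obtain ⟨x, hx⟩ := Coeffs.exists_isRoots (S := S) hnor ζ.fst ζ.snd
  have hsp := hx.isSpectrum hnor
  have hell : S.ellMinus ζ = specSpace (S.opAReal ζ) fun μ => μ.re < 0 := rfl
  have hellp : S.ellPlus ζ = specSpace (S.opAReal ζ) fun μ => 0 < μ.re := rfl
  refine ⟨?_, ?_, ?_, ?_⟩
  · rw [Coeffs.incSpace_eq hτ hnor hζ, hell, specSpace_sup, hS.Eminus_eq hnor hζ hng]
    simp only [Coeffs.stableRoot_neg_I_mul_iff]
  · rw [Coeffs.incSpace_eq hτ hnor hζ, hell]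
    exact specSpace_disjoint _ fun μ h h' => h'.ne h.1
  · have : ![S.outSpace τ ζ, S.ellPlus ζ, S.incSpace τ ζ, S.ellMinus ζ] =
        fun k => specSpace (S.opAReal ζ) ((![fun μ => μ.re = 0 ∧ S.OutFreq ζ (-Complex.I * μ),
          fun μ => 0 < μ.re, fun μ => μ.re = 0 ∧ S.InFreq ζ (-Complex.I * μ),
          fun μ => μ.re < 0] : Fin 4 → ℂ → Prop) k) := by
      rw [Coeffs.incSpace_eq hτ hnor hζ, Coeffs.outSpace_eq hτ hnor hζ, hell, hellp]
      funext k
      fin_cases k <;> rfl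
    rw [this]
    refine specSpace_iSupIndep _ _ fun i j hij μ hi hj => ?_
    have hio : ∀ ξ, S.InFreq ζ ξ → ¬ S.OutFreq ζ ξ := fun ξ h h' => lt_asymm h.2 h'.2
    fin_cases i <;> fin_cases j <;> simp at hij hi hj <;>
      first
        | linarith
        | exact hio _ hi.2 hj.2
        | exact hio _ hj.2 hi.2
  · rw [Coeffs.incSpace_eq hτ hnor hζ, Coeffs.outSpace_eq hτ hnor hζ, hell, hellp,
      specSpace_sup, specSpace_sup, specSpace_sup]
    refine hsp.specSpace_eq_top fun i => ?_
    simp only [neg_I_mul_I_mul]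
    rcases lt_trichotomy (Complex.I * x i).re 0 with h | h | h
    · exact Or.inr h
    · have him : (x i).im = 0 := by simpa using h
      have hre : ((x i).re : ℂ) = x i := Complex.ext rfl (by simp [him])
      have h0 : S.charFun (pt ζ.fst ζ.snd ((x i).re : ℂ)) = 0 := by
        rw [hre]; exact hx.charFun_eq_zero i
      rcases hS.glancing_or_in_or_out hζ h0 with hg | hg | hg
      · exact absurd ⟨hζ, _, h0, hg⟩ hng
      · rw [hre] at hg
        exact Or.inl (Or.inr ⟨h, hg⟩)
      · rw [hre] at hg
        exact Or.inl (Or.inl (Or.inl ⟨h, hg⟩))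
    · exact Or.inl (Or.inl (Or.inr h))

end Decomposition

/-! ### Root bounds at all real frequencies -/

section Homogeneity

variable {n N : ℕ} {S : Coeffs n N}

lemma pt_smul_freq (c : ℝ) (ζ : Freq n) (ξ : ℂ) :
    pt ((c • ζ).fst : ℂ) (c • ζ).snd (c * ξ) = (c : ℂ) • pt ζ.fst ζ.snd ξ := by
  rw [← pt_smul]
  simp

lemma Coeffs.opAReal_smul (S : Coeffs n N) (c : ℝ) (ζ : Freq n) :
    S.opAReal (c • ζ) = (c : ℂ) • S.opAReal ζ := by
  rw [Coeffs.opAReal, Coeffs.opAReal, ← Coeffs.opA_smul]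
  simp

lemma Coeffs.smul_mem_doubleSet {ζ : Freq n} (hζ : ζ ∈ S.doubleSet) {c : ℝ} (hc : c ≠ 0) :
    c • ζ ∈ S.doubleSet := by
  obtain ⟨h0, ξ, h1, h2⟩ := hζ
  have hc' : (c : ℂ) ≠ 0 := Complex.ofReal_ne_zero.2 hc
  refine ⟨smul_ne_zero hc h0, c * ξ, ?_, ?_⟩
  · rw [Complex.ofReal_mul, pt_smul_freq, S.charFun_smul, h1, mul_zero]
  · have h3 := S.fderiv_charFun_smul c (pt ζ.fst ζ.snd ξ) (0, 0, 1)
    rw [← Coeffs.dXi, ← Coeffs.dXi, h2, mul_zero] at h3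
    rw [Complex.ofReal_mul, pt_smul_freq]
    exact (mul_eq_zero.1 h3).resolve_left hc'

lemma Coeffs.StableRoot.smul {ζ : Freq n} {ξ : ℂ} (h : S.StableRoot ζ ξ) {c : ℝ} (hc : 0 < c) :
    S.StableRoot (c • ζ) (c * ξ) := by
  rcases h with h | ⟨h1, h2, h3⟩
  · left
    simpa using mul_pos hc h
  · refine Or.inr ⟨by simp [h1], ?_, ?_⟩
    · rw [pt_smul_freq, S.charFun_smul, h2, mul_zero]
    · have e1 := S.fderiv_charFun_smul c (pt ζ.fst ζ.snd ξ) (0, 0, 1)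
      have e2 := S.fderiv_charFun_smul c (pt ζ.fst ζ.snd ξ) (1, 0, 0)
      rw [← Coeffs.dXi, ← Coeffs.dXi] at e1
      rw [← Coeffs.dSigma, ← Coeffs.dSigma] at e2
      rw [pt_smul_freq]
      have e3 : ((c * c : ℝ) : ℂ) * (S.dXi ((c : ℂ) • pt ζ.fst ζ.snd ξ) *
          S.dSigma ((c : ℂ) • pt ζ.fst ζ.snd ξ)) =
          ((c ^ N * c ^ N : ℝ) : ℂ) * (S.dXi (pt ζ.fst ζ.snd ξ) * S.dSigma (pt ζ.fst ζ.snd ξ)) := by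
        push_cast
        linear_combination (c * S.dSigma ((c : ℂ) • pt ζ.fst ζ.snd ξ)) * e1 +
          ((c : ℂ) ^ N * S.dXi (pt ζ.fst ζ.snd ξ)) * e2
      have e4 := congrArg Complex.re e3
      rw [Complex.re_ofReal_mul, Complex.re_ofReal_mul] at e4
      have e5 : 0 < c ^ N * c ^ N * (S.dXi (pt ζ.fst ζ.snd ξ) * S.dSigma (pt ζ.fst ζ.snd ξ)).re := by
        positivity
      rw [← e4] at e5
      exact pos_of_mul_pos_right e5 (by positivity)

lemma Coeffs.IsRoots.smul_freq {ζ : Freq n} {x : Fin N → ℂ} (h : S.IsRoots ζ.fst ζ.snd x) {c : ℝ}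
    (hc : c ≠ 0) : S.IsRoots (c • ζ).fst (c • ζ).snd fun i => c * x i := by
  have := h.smul hc
  simpa using this

/-- The spectral facts at an arbitrary real frequency, obtained from those on the unit sphere by
homogeneity. The number `g` bounds from below the distance of `ζ / |ζ|` to the glancing set. -/
theorem Coeffs.Regular.exists_root_bounds (hS : S.Regular) (hnor : IsUnit S.nor.det) :
    ∃ M c : ℝ, 1 ≤ M ∧ 0 < c ∧ c ≤ 1 ∧ ∀ ζ : Freq n, ζ ≠ 0 → ∀ x, S.IsRoots ζ.fst ζ.snd x →
      (∀ i, ‖aeval (S.opAReal ζ) (X - C (Complex.I * x i))‖ ≤ M * ‖ζ‖) ∧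
      (∀ i j, i ≠ j → S.StableRoot ζ (x i) → S.StableRoot ζ (x j) →
        c * ‖ζ‖ ≤ ‖x i - x j‖ ∨ (c * ‖ζ‖ ≤ (x i).im ∧ c * ‖ζ‖ ≤ (x j).im)) ∧
      ∀ g : ℝ, 0 < g → g ≤ 1 → ENNReal.ofReal g ≤ Metric.infEDist (‖ζ‖⁻¹ • ζ) S.doubleSet →
        (∀ i, (x i).im ≠ 0 → c * g * ‖ζ‖ ≤ |(x i).im|) ∧
        (∀ i j, i ≠ j → (x i).im = 0 → c * g * ‖ζ‖ ≤ ‖x i - x j‖) := by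
  obtain ⟨M, hM1, hM⟩ := S.exists_opNorm_le
  obtain ⟨c₁, hc₁, hgap⟩ := hS.exists_gap hnor
  obtain ⟨c₂, hc₂, hst⟩ := hS.exists_stable_gap hnor
  set c := min (min (c₁ / 3) c₂) 1 with hc
  have hcc₁ : c ≤ c₁ / 3 := (min_le_left _ _).trans (min_le_left _ _)
  have hcc₂ : c ≤ c₂ := (min_le_left _ _).trans (min_le_right _ _)
  refine ⟨2 * M, c, by linarith, by positivity, min_le_right _ _, fun ζ hζ x hx => ?_⟩
  set ρ := ‖ζ‖ with hρ
  have hρ0 : 0 < ρ := norm_pos_iff.2 hζ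
  set ω := ρ⁻¹ • ζ with hω
  have hω1 : ‖ω‖ = 1 := by
    rw [hω, norm_smul, norm_inv, norm_norm, ← hρ, inv_mul_cancel₀ hρ0.ne']
  have hζω : ζ = ρ • ω := by rw [hω, smul_smul, mul_inv_cancel₀ hρ0.ne', one_smul]
  have hy : S.IsRoots ω.fst ω.snd fun i => ((ρ⁻¹ : ℝ) : ℂ) * x i := hx.smul_freq (inv_ne_zero hρ0.ne')
  have him : ∀ i, (((ρ⁻¹ : ℝ) : ℂ) * x i).im = ρ⁻¹ * (x i).im := fun i => Complex.im_ofReal_mul _ _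
  have hsub : ∀ i j, ‖((ρ⁻¹ : ℝ) : ℂ) * x i - ((ρ⁻¹ : ℝ) : ℂ) * x j‖ = ρ⁻¹ * ‖x i - x j‖ := by
    intro i j
    rw [← mul_sub, norm_mul, Complex.norm_real, Real.norm_of_nonneg (by positivity)]
  have hA : ‖S.opAReal ζ‖ ≤ M * ρ := by
    rw [hζω, S.opAReal_smul, norm_smul, Complex.norm_real, Real.norm_of_nonneg hρ0.le, mul_comm]
    exact mul_le_mul_of_nonneg_right (hM ω hω1) hρ0.le
  refine ⟨fun i => ?_, fun i j hij hi hj => ?_, fun g hg0 hg1 hg => ?_⟩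
  · have h1 : ‖x i‖ ≤ M * ρ := (hx.norm_le hnor i).trans hA
    have h2 : aeval (S.opAReal ζ) (X - C (Complex.I * x i)) =
        S.opAReal ζ - (Complex.I * x i) • (1 : Amp N →L[ℂ] Amp N) := by
      simp [Algebra.algebraMap_eq_smul_one]
      rw [smul_smul, mul_comm]
    have h3 : ‖(1 : Amp N →L[ℂ] Amp N)‖ ≤ 1 := ContinuousLinearMap.norm_id_le
    rw [h2]
    refine (norm_sub_le _ _).trans ?_
    rw [norm_smul, norm_mul, Complex.norm_I, one_mul]
    nlinarith [norm_nonneg (x i)]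
  · have h1 := hst ω hω1 _ hy i j hij (hi.smul (inv_pos.2 hρ0)) (hj.smul (inv_pos.2 hρ0))
    rw [hsub, him, him, inv_mul_eq_div, inv_mul_eq_div, inv_mul_eq_div, le_div_iff₀ hρ0,
      le_div_iff₀ hρ0, le_div_iff₀ hρ0] at h1
    have h2 : c * ρ ≤ c₂ * ρ := by gcongr
    exact h1.imp h2.trans (And.imp h2.trans h2.trans)
  · have hU : ∀ i j, i ≠ j → c₁ * g * ρ ≤ ‖x i - x j‖ + |(x i).im| := by
      intro i j hij
      have h1 := hgap ω hω1 _ hy i j hij g hg0.le hg1 hg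
      rw [hsub, him, abs_mul, abs_of_pos (inv_pos.2 hρ0), ← mul_add, inv_mul_eq_div,
        le_div_iff₀ hρ0] at h1
      exact h1
    have hcg : c * g * ρ ≤ c₁ * g * ρ / 3 := by
      have : c * (g * ρ) ≤ c₁ / 3 * (g * ρ) := by gcongr
      linarith
    have hpos : 0 < c₁ * g * ρ := by positivity
    refine ⟨fun i hi => ?_, fun i j hij hi => ?_⟩
    · -- the conjugate root is at distance `2 |Im x i|`
      obtain ⟨j, hj⟩ := hx.exists_star_eq hnor i
      have hij : i ≠ j := by
        rintro rfl
        exact hi (Complex.conj_eq_iff_im.1 hj)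
      have h1 := hU i j hij
      have h2 : ‖x i - x j‖ = 2 * |(x i).im| := by
        have : x i - x j = ((2 * (x i).im : ℝ) : ℂ) * Complex.I := by
          rw [← hj]
          apply Complex.ext <;> simp
          ring
        rw [this, norm_mul, Complex.norm_I, mul_one, Complex.norm_real, Real.norm_eq_abs, abs_mul,
          abs_two]
      rw [h2] at h1
      linarith
    · have h1 := hU i j hij
      rw [hi, abs_zero, add_zero] at h1
      linarith

end Homogeneity

/-! ### The projections -/

section Projections

variable {n N : ℕ} {S : Coeffs n N} {τ : Fin N → EuclideanSpace ℝ (Fin n) × ℝ → ℝ}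

lemma projAlong_spec {W : Type*} [AddCommGroup W] [Module ℂ W] {U V : Submodule ℂ W}
    (h : IsCompl U V) (w : W) : projAlong U V w ∈ U ∧ w - projAlong U V w ∈ V := by
  rw [projAlong, dif_pos h]
  exact ⟨U.projection_apply_mem h w, by
    rw [← Submodule.projection_eq_self_sub_projection]
    exact V.projection_apply_mem _ w⟩

/-- The outgoing, unstable elliptic and incoming components together are the spectral space of the
closed right half-plane. -/
lemma Coeffs.Regular.rest_eq (hS : S.Regular) (hτ : S.StrictlyHyperbolic τ)
    (hnor : IsUnit S.nor.det) {ζ : Freq n} (hζ : ζ ≠ 0) (hng : ζ ∉ S.doubleSet) :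
    S.outSpace τ ζ ⊔ S.ellPlus ζ ⊔ S.incSpace τ ζ =
      specSpace (S.opAReal ζ) fun μ => 0 ≤ μ.re := by
  obtain ⟨x, hx⟩ := Coeffs.exists_isRoots (S := S) hnor ζ.fst ζ.snd
  have hsp := hx.isSpectrum hnor
  have hellp : S.ellPlus ζ = specSpace (S.opAReal ζ) fun μ => 0 < μ.re := rfl
  rw [Coeffs.incSpace_eq hτ hnor hζ, Coeffs.outSpace_eq hτ hnor hζ, hellp, specSpace_sup,
    specSpace_sup]
  refine hsp.specSpace_congr fun i => ?_
  rw [neg_I_mul_I_mul]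
  constructor
  · rintro ((h | h) | h)
    · exact h.1.ge
    · exact h.le
    · exact h.1.ge
  · intro h
    rcases h.lt_or_eq with h | h
    · exact Or.inl (Or.inr h)
    have him : (x i).im = 0 := by simpa using h.symm
    have hre : ((x i).re : ℂ) = x i := Complex.ext rfl (by simp [him])
    have h0 : S.charFun (pt ζ.fst ζ.snd ((x i).re : ℂ)) = 0 := by
      rw [hre]; exact hx.charFun_eq_zero i
    rcases hS.glancing_or_in_or_out hζ h0 with hg | hg | hg
    · exact absurd ⟨hζ, _, h0, hg⟩ hng
    · rw [hre] at hg
      exact Or.inr ⟨h.symm, hg⟩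
    · rw [hre] at hg
      exact Or.inl (Or.inl ⟨h.symm, hg⟩)

lemma Coeffs.Regular.isCompl_full (hS : S.Regular) (hτ : S.StrictlyHyperbolic τ)
    (hnor : IsUnit S.nor.det) {ζ : Freq n} (hζ : ζ ≠ 0) (hng : ζ ∉ S.doubleSet) :
    IsCompl (S.ellMinus ζ) (S.outSpace τ ζ ⊔ S.ellPlus ζ ⊔ S.incSpace τ ζ) := by
  have hd := hS.decomposes hτ hnor hζ hng
  refine ⟨?_, ?_⟩
  · rw [hS.rest_eq hτ hnor hζ hng]
    exact specSpace_disjoint _ fun μ h => not_le.2 h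
  · rw [codisjoint_iff, sup_comm]
    exact hd.sup_full

lemma Coeffs.Decomposes.isCompl_minus {ζ : Freq n} (h : S.Decomposes τ ζ) :
    IsCompl ((S.ellMinus ζ).submoduleOf (S.Eminus ζ)) ((S.incSpace τ ζ).submoduleOf (S.Eminus ζ)) := by
  have h1 : S.ellMinus ζ ≤ S.Eminus ζ := h.sup_minus ▸ le_sup_right
  have h2 : S.incSpace τ ζ ≤ S.Eminus ζ := h.sup_minus ▸ le_sup_left
  refine ⟨?_, ?_⟩
  · rw [Submodule.disjoint_def]
    intro w hw hw'
    exact Subtype.ext (Submodule.disjoint_def.1 h.disjoint_minus w hw' hw)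
  · rw [codisjoint_iff, ← Submodule.submoduleOf_sup_of_le h1 h2, sup_comm, h.sup_minus,
      Submodule.submoduleOf_self]

/-- A vector of `E_-(ζ)` and its component in `E^e_-(ζ)`. -/
lemma Coeffs.Decomposes.projMinus_spec {ζ : Freq n} (h : S.Decomposes τ ζ) (w : S.Eminus ζ) :
    S.projMinus τ ζ w ∈ S.ellMinus ζ ∧ (w : Amp N) - S.projMinus τ ζ w ∈ S.incSpace τ ζ :=
  projAlong_spec h.isCompl_minus w

lemma aeval_neg_X_sub_C_neg (B : Amp N →L[ℂ] Amp N) (z : ℂ) :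
    aeval (-B) (X - C (-z)) = -aeval B (X - C z) := by
  rw [map_sub, map_sub, aeval_X, aeval_X, aeval_C, aeval_C, map_neg]
  abel

lemma aeval_neg_rootPoly {ι : Type*} (B : Amp N →L[ℂ] Amp N) (μ : ι → ℂ) (s : Finset ι) :
    aeval (-B) (rootPoly (fun i => -μ i) s) = (-1 : ℂ) ^ s.card • aeval B (rootPoly μ s) := by
  classical
  induction s using Finset.induction_on with
  | empty => simp [rootPoly]
  | insert a s ha ih =>
    rw [rootPoly_insert ha, rootPoly_insert ha, map_mul, map_mul, ih,
      Finset.card_insert_of_notMem ha, pow_succ, aeval_neg_X_sub_C_neg]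
    ext1 w
    simp [← smul_neg]

end Projections

/-! ### Bounds at one frequency -/

section Bounds

variable {n N : ℕ} {S : Coeffs n N} {τ : Fin N → EuclideanSpace ℝ (Fin n) × ℝ → ℝ}

/-- The bounds at a single frequency. The number `g` bounds from below the distance of `ζ / |ζ|` to
the glancing set. The bound on `E_-(ζ)` is uniform in `g`, because stable roots stay apart from each
other near the glancing set; the others lose a power of `1 / g`. -/
theorem Coeffs.Regular.exists_projection_bounds (hS : S.Regular) (hτ : S.StrictlyHyperbolic τ)
    (hnor : IsUnit S.nor.det) :
    ∃ K κ : ℝ, ∃ q : ℕ, 0 < K ∧ 0 < κ ∧ ∀ ζ : Freq n, ζ ≠ 0 → ∀ g : ℝ, 0 < g → g ≤ 1 →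
      ENNReal.ofReal g ≤ Metric.infEDist (‖ζ‖⁻¹ • ζ) S.doubleSet →
      S.Decomposes τ ζ ∧
      (∀ t : ℝ, 0 ≤ t →
        ‖(S.expA t ζ).comp (S.projMinus τ ζ)‖ ≤ K * Real.exp (-(κ * g * ‖ζ‖ * t))) ∧
      (∀ t : ℝ, 0 ≤ t →
        ‖(S.expA t ζ).comp (S.projFull τ ζ)‖ ≤
          K * g⁻¹ ^ q * Real.exp (-(κ * g * ‖ζ‖ * t))) ∧
      (∀ t : ℝ, t ≤ 0 →
        ‖(S.expA t ζ).comp (ContinuousLinearMap.id ℂ (Amp N) - S.projFull τ ζ)‖ ≤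
          K * g⁻¹ ^ q) := by
  classical
  obtain ⟨M, c, hM1, hc0, hc1, hroots⟩ := hS.exists_root_bounds hnor
  set b := M / c with hb
  have hb1 : 1 ≤ b := (one_le_div hc0).2 (hc1.trans hM1)
  set P : ℝ := (3 * (N + 1)) ^ N with hP
  set R : ℝ := (2 * b ^ N) ^ N with hR
  have hbN : 1 ≤ b ^ N := one_le_pow₀ hb1
  have hR1 : 1 ≤ R := one_le_pow₀ (by linarith)
  have hP0 : 0 < P := by positivity
  set p := N + N * N with hp
  have h2b : 0 < (2 * b) ^ p := by positivity
  refine ⟨P * (2 * b) ^ p * (2 * R), c / 2, p + N * N, by positivity, by positivity,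
    fun ζ hζ g hg0 hg1 hg => ?_⟩
  set ρ := ‖ζ‖ with hρ
  have hρ0 : 0 < ρ := norm_pos_iff.2 hζ
  have hng : ζ ∉ S.doubleSet := by
    intro h
    rw [Metric.infEDist_zero_of_mem (Coeffs.smul_mem_doubleSet h (inv_ne_zero hρ0.ne'))] at hg
    exact absurd (ENNReal.ofReal_pos.2 hg0) (not_lt.2 hg)
  have hdec := hS.decomposes hτ hnor hζ hng
  set B := S.opAReal ζ with hB
  obtain ⟨x, hx⟩ := Coeffs.exists_isRoots (S := S) hnor ζ.fst ζ.snd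
  obtain ⟨hM, hstab, hsep⟩ := hroots ζ hζ x hx
  obtain ⟨him, hreal⟩ := hsep g hg0 hg1 hg
  set μ : Fin N → ℂ := fun i => Complex.I * x i with hμ
  have hsp : IsSpectrum B μ := hx.isSpectrum hnor
  have hre : ∀ i, (μ i).re = -(x i).im := fun i => by simp [hμ]
  have hdist : ∀ i j, ‖μ i - μ j‖ = ‖x i - x j‖ := fun i j => by
    simp only [hμ]
    rw [← mul_sub, norm_mul, Complex.norm_I, one_mul]
  have hcard : ∀ s : Finset (Fin N), s.card ≤ N := fun s => by
    simpa using Finset.card_le_univ s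
  set k := Finset.univ.filter fun i => (μ i).re < 0 with hk
  have hkim : ∀ i, i ∈ k → 0 < (x i).im := fun i hi => by
    have := (Finset.mem_filter.1 hi).2
    rw [hre] at this
    linarith
  have hkbd : ∀ i, i ∈ k → c * g * ρ ≤ (x i).im := fun i hi => by
    have := him i (hkim i hi).ne'
    rwa [abs_of_pos (hkim i hi)] at this
  have hell : ∀ v, v ∈ S.ellMinus ζ → aeval B (rootPoly μ k) v = 0 := fun v hv =>
    (hsp.mem_specSpace_iff fun μ => μ.re < 0).1 hv
  have hgM : c * ρ ≤ M * ρ := by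
    have := hc1.trans hM1
    gcongr
  set a := b * g⁻¹ with ha
  have hg1' : 1 ≤ g⁻¹ := (one_le_inv₀ hg0).2 hg1
  have ha1 : 1 ≤ a := one_le_mul_of_one_le_of_one_le hb1 hg1'
  have haN : 1 ≤ a ^ N := one_le_pow₀ ha1
  have hMa : M * ρ / (c * g * ρ) = a := by
    rw [ha, hb]
    field_simp
  have hcgM : c * g * ρ ≤ M * ρ := by
    have : c * g ≤ M := (mul_le_of_le_one_right hc0.le hg1).trans (hc1.trans hM1)
    gcongr
  have hgap_pow : (1 + a ^ N) ^ N ≤ R * g⁻¹ ^ (N * N) := by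
    calc (1 + a ^ N) ^ N ≤ (2 * a ^ N) ^ N := by gcongr; linarith
      _ = R * g⁻¹ ^ (N * N) := by rw [hR, ha, mul_pow b, pow_mul, ← mul_pow]; ring
  have hgap_pow' : (1 + b ^ N) ^ N ≤ R := by rw [hR]; gcongr; linarith
  -- decay on the stable elliptic space; half of the spectral gap pays for the polynomial factors
  have hdecay : ∀ v, v ∈ S.ellMinus ζ → ∀ t : ℝ, 0 ≤ t →
      ‖S.expA t ζ v‖ ≤ P * (2 * b) ^ p * Real.exp (-(c / 2 * g * ρ * t)) * ‖v‖ := by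
    intro v hv t ht
    have h2 : M * ρ / (c / 2 * ρ) = 2 * b := by
      rw [hb]
      field_simp
    have h3 := norm_exp_le_of_separated B μ k (g := c / 2 * ρ) (M := M * ρ)
      (γ := c / 2 * g * ρ) (n := N) (by positivity)
      (le_trans (by gcongr; linarith) hgM) (hcard k) (fun i _ => hM i)
      (fun i hi => by
        have := hkbd i hi
        have : 0 < c * g * ρ := by positivity
        rw [hre]
        linarith)
      (fun i hi j hj hij => by
        rcases hstab i j hij (Or.inl (hkim i hi)) (Or.inl (hkim j hj)) with h | ⟨h, h'⟩
        · left
          rw [hdist]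
          have : 0 < c * ρ := by positivity
          linarith
        · right
          have : c / 2 * ρ * g ≤ c / 2 * ρ := mul_le_of_le_one_right (by positivity) hg1
          rw [hre, hre]
          constructor <;> linarith)
      (hell v hv) ht
    rwa [h2] at h3
  have hfull : ∀ w, S.projFull τ ζ w ∈ S.ellMinus ζ ∧
      w - S.projFull τ ζ w ∈ specSpace B fun μ => 0 ≤ μ.re := by
    intro w
    have := projAlong_spec (hS.isCompl_full hτ hnor hζ hng) w
    refine ⟨this.1, ?_⟩
    rw [← hS.rest_eq hτ hnor hζ hng]
    exact this.2
  set k' := Finset.univ.filter fun i => 0 ≤ (μ i).re with hk'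
  have hrest : ∀ w, aeval B (rootPoly μ k') (w - S.projFull τ ζ w) = 0 := fun w =>
    (hsp.mem_specSpace_iff fun μ => 0 ≤ μ.re).1 (hfull w).2
  have hprojFull : ∀ w, ‖S.projFull τ ζ w‖ ≤ R * g⁻¹ ^ (N * N) * ‖w‖ := by
    intro w
    have h1 := norm_right_le_of_gap B μ k' k (g := c * g * ρ) (M := M * ρ) (n := N)
      (by positivity) hcgM (hcard k) (fun i _ => hM i)
      (fun i hi j hj => by
        have h2 := (Finset.mem_filter.1 hi).2
        have h3 := hkbd j hj
        have h4 := (abs_le.1 (Complex.abs_re_le_norm (μ i - μ j))).2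
        rw [Complex.sub_re, hre j] at h4
        linarith) (hrest w) (hell _ (hfull w).1)
    rw [hMa, sub_add_cancel] at h1
    refine h1.trans (mul_le_mul_of_nonneg_right ?_ (norm_nonneg _))
    exact (pow_le_pow_right₀ (by linarith) (hcard k')).trans hgap_pow
  refine ⟨hdec, fun t ht => ?_, fun t ht => ?_, fun t ht => ?_⟩
  · refine ContinuousLinearMap.opNorm_le_bound _ (by positivity) fun w => ?_
    obtain ⟨hv, hu⟩ := hdec.projMinus_spec w
    rw [Coeffs.incSpace_eq hτ hnor hζ] at hu
    obtain ⟨s, hs, hu⟩ : ∃ s : Finset (Fin N),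
        (∀ i ∈ s, (μ i).re = 0 ∧ S.InFreq ζ (-Complex.I * μ i)) ∧
        aeval B (rootPoly μ s) ((w : Amp N) - S.projMinus τ ζ w) = 0 :=
      ⟨_, fun i hi => (@Finset.mem_filter _ _ (fun _ => Classical.propDecidable _) _ _).1 hi |>.2,
        (hsp.mem_specSpace_iff _).1 hu⟩
    -- near the glancing set an incoming root does not come close to another stable root
    have h1 := norm_right_le_of_gap B μ s k (g := c * ρ) (M := M * ρ) (n := N)
      (by positivity) hgM (hcard k) (fun i _ => hM i)
      (fun i hi j hj => by
        obtain ⟨h2, h3⟩ := hs i hi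
        have h4 : (x i).im = 0 := by
          rw [hre] at h2
          linarith
        have hij : i ≠ j := by
          rintro rfl
          exact (hkim i hj).ne' h4
        rw [hμ, neg_I_mul_I_mul] at h3
        rw [hdist]
        refine (hstab i j hij (Or.inr ⟨h4, h3⟩) (Or.inl (hkim j hj))).resolve_right fun h => ?_
        have : 0 < c * ρ := by positivity
        linarith [h.1]) hu (hell _ hv)
    rw [sub_add_cancel, mul_div_mul_right _ _ hρ0.ne'] at h1
    have h5 : ‖S.projMinus τ ζ w‖ ≤ R * ‖w‖ := by
      refine h1.trans (mul_le_mul_of_nonneg_right ?_ (norm_nonneg _))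
      exact (pow_le_pow_right₀ (by linarith) (hcard _)).trans hgap_pow'
    calc ‖S.expA t ζ (S.projMinus τ ζ w)‖
        ≤ P * (2 * b) ^ p * Real.exp (-(c / 2 * g * ρ * t)) * (R * ‖w‖) :=
          (hdecay _ hv t ht).trans (by gcongr)
      _ ≤ P * (2 * b) ^ p * Real.exp (-(c / 2 * g * ρ * t)) * (2 * R * ‖w‖) := by
          gcongr
          linarith
      _ = _ := by ring
  · refine ContinuousLinearMap.opNorm_le_bound _ (by positivity) fun w => ?_
    calc ‖S.expA t ζ (S.projFull τ ζ w)‖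
        ≤ P * (2 * b) ^ p * Real.exp (-(c / 2 * g * ρ * t)) * (R * g⁻¹ ^ (N * N) * ‖w‖) :=
          (hdecay _ (hfull w).1 t ht).trans (by gcongr; exact hprojFull w)
      _ ≤ P * (2 * b) ^ p * Real.exp (-(c / 2 * g * ρ * t)) *
          (2 * R * g⁻¹ ^ (p + N * N) * ‖w‖) := by
          gcongr
          · linarith
          · omega
      _ = _ := by ring
  · -- for `t ≤ 0` the group of `-B` acts in positive time, with eigenvalues in the left half-plane
    refine ContinuousLinearMap.opNorm_le_bound _ (by positivity) fun w => ?_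
    set u := w - S.projFull τ ζ w with hu
    have hexp : S.expA t ζ u = NormedSpace.exp (((-t : ℝ) : ℂ) • (-B)) u := by
      have : ((-t : ℝ) : ℂ) • (-B) = (t : ℂ) • B := by
        rw [Complex.ofReal_neg, neg_smul_neg]
      rw [Coeffs.expA, this]
    have h0 : aeval (-B) (rootPoly (fun i => -μ i) k') u = 0 := by
      rw [aeval_neg_rootPoly, smul_apply, hrest w, smul_zero]
    have h1 := norm_exp_le_of_separated (-B) (fun i => -μ i) k' (g := c * g * ρ) (M := M * ρ)
      (γ := 0) (n := N) (by positivity) hcgM (hcard k')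
      (fun i _ => by rw [aeval_neg_X_sub_C_neg, norm_neg]; exact hM i)
      (fun i hi => by
        have := (Finset.mem_filter.1 hi).2
        simpa using this)
      (fun i hi j hj hij => by
        have hi0 := (Finset.mem_filter.1 hi).2
        have hj0 := (Finset.mem_filter.1 hj).2
        have hn : ‖-μ i - -μ j‖ = ‖x i - x j‖ := by
          rw [← hdist, neg_sub_neg, norm_sub_rev]
        rw [hre] at hi0 hj0
        rw [hn]
        by_cases hi' : (x i).im = 0
        · exact Or.inl (hreal i j hij hi')
        by_cases hj' : (x j).im = 0
        · rw [norm_sub_rev]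
          exact Or.inl (hreal j i hij.symm hj')
        right
        have h2 := him i hi'
        have h3 := him j hj'
        rw [abs_of_nonpos (by linarith)] at h2 h3
        rw [Complex.neg_re, Complex.neg_re, hre, hre]
        constructor <;> linarith) h0 (neg_nonneg.2 ht)
    rw [hMa, zero_mul, neg_zero, Real.exp_zero, mul_one, ← hexp] at h1
    have h2 : ‖u‖ ≤ 2 * R * g⁻¹ ^ (N * N) * ‖w‖ := by
      have h3 : 1 ≤ R * g⁻¹ ^ (N * N) :=
        one_le_mul_of_one_le_of_one_le hR1 (one_le_pow₀ hg1')
      have h4 := hprojFull w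
      have h5 : ‖w‖ ≤ R * g⁻¹ ^ (N * N) * ‖w‖ := le_mul_of_one_le_left (norm_nonneg _) h3
      calc ‖u‖ ≤ ‖w‖ + ‖S.projFull τ ζ w‖ := norm_sub_le _ _
        _ ≤ _ := by linarith
    have hap : a ^ p ≤ (2 * b) ^ p * g⁻¹ ^ p := by
      rw [ha, mul_pow]
      gcongr
      linarith
    calc ‖S.expA t ζ u‖ ≤ P * a ^ p * ‖u‖ := h1
      _ ≤ P * ((2 * b) ^ p * g⁻¹ ^ p) * (2 * R * g⁻¹ ^ (N * N) * ‖w‖) := by gcongr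
      _ = _ := by rw [pow_add]; ring

end Bounds

/-! ### Powers of `|ζ|` -/

section SmallDivisors

variable {n N : ℕ} {S : Coeffs n N} {τ : Fin N → EuclideanSpace ℝ (Fin n) × ℝ → ℝ}

lemma ofReal_inv_norm_mul_le_infEDist {G : Set (Freq n)} (hG : ∀ γ ∈ G, ∀ s : ℝ, 0 < s → s • γ ∈ G)
    {ζ : Freq n} (hζ : ζ ≠ 0) {d : ℝ} (hd : ENNReal.ofReal d ≤ Metric.infEDist ζ G) :
    ENNReal.ofReal (‖ζ‖⁻¹ * d) ≤ Metric.infEDist (‖ζ‖⁻¹ • ζ) G := by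
  have hρ : 0 < ‖ζ‖ := norm_pos_iff.2 hζ
  refine Metric.le_infEDist.2 fun γ hγ => ?_
  have h1 := hd.trans (Metric.infEDist_le_edist_of_mem (hG γ hγ _ hρ))
  rw [edist_dist] at h1 ⊢
  refine ENNReal.ofReal_le_ofReal ?_
  rw [ENNReal.ofReal_le_ofReal_iff dist_nonneg] at h1
  have h2 : ‖ζ‖⁻¹ • ζ - γ = ‖ζ‖⁻¹ • (ζ - ‖ζ‖ • γ) := by
    rw [smul_sub, smul_smul, inv_mul_cancel₀ hρ.ne', one_smul]
  rw [dist_eq_norm, h2, norm_smul, norm_inv, norm_norm, ← dist_eq_norm]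
  gcongr

/-- A nonempty cone comes arbitrarily close to the origin, hence within distance one of any unit
vector. -/
lemma le_one_of_ofReal_le_infEDist {G : Set (Freq n)} (hG : ∀ γ ∈ G, ∀ s : ℝ, 0 < s → s • γ ∈ G)
    (hne : G.Nonempty) {ω : Freq n} (hω : ‖ω‖ = 1) {g : ℝ}
    (hg : ENNReal.ofReal g ≤ Metric.infEDist ω G) : g ≤ 1 := by
  obtain ⟨γ, hγ⟩ := hne
  refine le_of_forall_pos_le_add fun ε hε => ?_
  have hs : 0 < ε / (‖γ‖ + 1) := by positivity
  have h1 := hg.trans (Metric.infEDist_le_edist_of_mem (hG γ hγ _ hs))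
  rw [edist_dist, ENNReal.ofReal_le_ofReal_iff dist_nonneg, dist_eq_norm] at h1
  refine h1.trans ((norm_sub_le _ _).trans ?_)
  rw [hω, norm_smul, Real.norm_of_nonneg hs.le, div_mul_eq_mul_div]
  gcongr
  exact div_le_of_le_mul₀ (by positivity) hε.le (by nlinarith [norm_nonneg γ])

/-- The small divisor condition, read on the unit sphere. -/
lemma SmallDivisors.exists_normalized_bound (hτ : S.StrictlyHyperbolic τ) (hS : S.Regular) {m : ℕ}
    {z : Fin m → Freq n} (h : SmallDivisors τ z) :
    ∃ a c : ℝ, 0 < c ∧ ∀ ζ ∈ boundaryGroup z, ζ ≠ 0 → c * ‖ζ‖ ^ (-a) ≤ 1 ∧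
      ENNReal.ofReal (c * ‖ζ‖ ^ (-a)) ≤ Metric.infEDist (‖ζ‖⁻¹ • ζ) S.doubleSet := by
  have hG : glancingSet τ = S.doubleSet := Set.ext fun ζ => Coeffs.mem_glancingSet_iff hτ hS
  have hcone : ∀ γ ∈ S.doubleSet, ∀ s : ℝ, 0 < s → s • γ ∈ S.doubleSet := fun γ hγ s hs =>
    Coeffs.smul_mem_doubleSet hγ hs.ne'
  -- the distance to the empty set is infinite, and the first bound has to be arranged
  rcases S.doubleSet.eq_empty_or_nonempty with he | hne
  · refine ⟨0, 1, one_pos, fun ζ _ _ => ?_⟩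
    rw [he, Metric.infEDist_empty]
    simp
  obtain ⟨a, c, hc, hsd⟩ := h
  refine ⟨a + 1, c, hc, fun ζ hζ h0 => ?_⟩
  have hρ : 0 < ‖ζ‖ := norm_pos_iff.2 h0
  have h1 := ofReal_inv_norm_mul_le_infEDist hcone h0 (hG ▸ hsd ζ hζ h0)
  have h2 : ‖ζ‖⁻¹ * (c * ‖ζ‖ ^ (-a)) = c * ‖ζ‖ ^ (-(a + 1)) := by
    rw [neg_add, Real.rpow_add hρ, Real.rpow_neg_one]
    ring
  rw [h2] at h1
  refine ⟨le_one_of_ofReal_le_infEDist hcone hne ?_ h1, h1⟩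
  rw [norm_smul, norm_inv, norm_norm, inv_mul_cancel₀ hρ.ne']

/-- Two powers of `|ζ|` can be replaced by powers with opposite exponents if `|ζ|` is bounded
below. -/
lemma exists_common_exponent (Z : Set ℝ) (hZ : ∀ ρ ∈ Z, 0 < ρ) (s s' : ℝ) :
    ∃ D A b b' : ℝ, 0 < D ∧ 0 < A ∧ ((∃ r : ℝ, 0 < r ∧ ∀ ρ ∈ Z, r ≤ ρ) → b' = b) ∧
      ∀ ρ ∈ Z, D * ρ ^ (-b) ≤ ρ ^ (-s) ∧ ρ ^ s' ≤ A * ρ ^ b' := by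
  by_cases h : ∃ r : ℝ, 0 < r ∧ ∀ ρ ∈ Z, r ≤ ρ
  · obtain ⟨r, hr, hrZ⟩ := h
    set b := max s s'
    have hs : 0 ≤ b - s := sub_nonneg.2 (le_max_left _ _)
    have hs' : 0 ≤ b - s' := sub_nonneg.2 (le_max_right _ _)
    refine ⟨r ^ (b - s), (r ^ (b - s'))⁻¹, b, b, by positivity, by positivity, fun _ => rfl,
      fun ρ hρ => ⟨?_, ?_⟩⟩
    · have h1 := Real.rpow_le_rpow hr.le (hrZ ρ hρ) hs
      have hρ0 := hZ ρ hρ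
      calc r ^ (b - s) * ρ ^ (-b) ≤ ρ ^ (b - s) * ρ ^ (-b) := by gcongr
        _ = ρ ^ (-s) := by rw [← Real.rpow_add hρ0]; congr 1; ring
    · have h1 := Real.rpow_le_rpow hr.le (hrZ ρ hρ) hs'
      have hρ0 := hZ ρ hρ
      rw [inv_mul_eq_div, le_div_iff₀ (by positivity)]
      calc ρ ^ s' * r ^ (b - s') ≤ ρ ^ s' * ρ ^ (b - s') := by gcongr
        _ = ρ ^ b := by rw [← Real.rpow_add hρ0]; congr 1; ring
  · exact ⟨1, 1, s, s', one_pos, one_pos, fun h' => absurd h' h, fun ρ _ => by simp⟩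

end SmallDivisors

end HypBVP

end

/-! ### Estimates on the group of boundary frequencies -/

theorem mainTheorem8 {n N m : ℕ} (hn : 1 ≤ n) (hN : 1 ≤ N)
    (S : HypBVP.Coeffs n N) (hnor : IsUnit S.nor.det)
    (τ : Fin N → EuclideanSpace ℝ (Fin n) × ℝ → ℝ)
    (hτ : S.StrictlyHyperbolic τ) (hglanc : HypBVP.GlancingNondegenerate τ)
    (z : Fin m → HypBVP.Freq n) (hsd : HypBVP.SmallDivisors τ z) :
    ∃ C₁ c₁ b₁ b₁' : ℝ, 0 < C₁ ∧ 0 < c₁ ∧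
      ((∃ ρ : ℝ, 0 < ρ ∧ ∀ ζ ∈ HypBVP.boundaryGroup z, ζ ≠ 0 → ρ ≤ ‖ζ‖) → b₁' = b₁) ∧
      ∀ ζ ∈ HypBVP.boundaryGroup z, ζ ≠ 0 →
        S.Decomposes τ ζ ∧
        (∀ t : ℝ, 0 ≤ t →
          ‖(S.expA t ζ).comp (S.projMinus τ ζ)‖
              ≤ C₁ * Real.exp (-(c₁ * t * ‖ζ‖ ^ (-b₁))) ∧
            C₁ * Real.exp (-(c₁ * t * ‖ζ‖ ^ (-b₁))) ≤ C₁) ∧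
        (∀ t : ℝ, 0 ≤ t →
          ‖(S.expA t ζ).comp (S.projFull τ ζ)‖
            ≤ C₁ * ‖ζ‖ ^ b₁' * Real.exp (-(c₁ * t * ‖ζ‖ ^ (-b₁)))) ∧
        (∀ t : ℝ, t ≤ 0 →
          ‖(S.expA t ζ).comp (ContinuousLinearMap.id ℂ (HypBVP.Amp N) - S.projFull τ ζ)‖
            ≤ C₁ * ‖ζ‖ ^ b₁') := by
  have hS := hτ.regular hglanc
  obtain ⟨K, κ, q, hK, hκ, hbd⟩ := hS.exists_projection_bounds hτ hnor
  obtain ⟨a, c, hc, hg⟩ := hsd.exists_normalized_bound hτ hS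
  obtain ⟨D, A, b, b', hD, hA, hbb, hpow⟩ := HypBVP.exists_common_exponent
    {ρ | ∃ ζ ∈ HypBVP.boundaryGroup z, ζ ≠ 0 ∧ ‖ζ‖ = ρ}
    (by rintro _ ⟨ζ, -, h0, rfl⟩; exact norm_pos_iff.2 h0) (a - 1) (a * q)
  set C := K * (1 + c⁻¹ ^ q * A) with hC
  have hcA : 0 < c⁻¹ ^ q * A := by positivity
  have hKC : K ≤ C := le_mul_of_one_le_right hK.le (by linarith)
  have hKC' : K * (c⁻¹ ^ q * A) ≤ C := mul_le_mul_of_nonneg_left (by linarith) hK.le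
  have hC0 : 0 < C := hK.trans_le hKC
  refine ⟨C, κ * c * D, b, b', hC0, by positivity, ?_, fun ζ hζ h0 => ?_⟩
  · rintro ⟨ρ, hρ, h⟩
    refine hbb ⟨ρ, hρ, ?_⟩
    rintro _ ⟨ζ, hζ, h0, rfl⟩
    exact h ζ hζ h0
  have hρ : 0 < ‖ζ‖ := norm_pos_iff.2 h0
  obtain ⟨hp, hp'⟩ := hpow ‖ζ‖ ⟨ζ, hζ, h0, rfl⟩
  obtain ⟨hg1, hgd⟩ := hg ζ hζ h0
  obtain ⟨hdec, hminus, hfull, hrest⟩ := hbd ζ h0 (c * ‖ζ‖ ^ (-a)) (by positivity) hg1 hgd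
  -- the spectral gap at `ζ` is of the order of `c |ζ|^{-a}` times `|ζ|`
  have hrate : κ * c * D * ‖ζ‖ ^ (-b) ≤ κ * (c * ‖ζ‖ ^ (-a)) * ‖ζ‖ := by
    have h1 : ‖ζ‖ ^ (-(a - 1)) = ‖ζ‖ ^ (-a) * ‖ζ‖ := by
      rw [neg_sub, sub_eq_neg_add, Real.rpow_add hρ, Real.rpow_one]
    calc κ * c * D * ‖ζ‖ ^ (-b) = κ * c * (D * ‖ζ‖ ^ (-b)) := by ring
      _ ≤ κ * c * (‖ζ‖ ^ (-a) * ‖ζ‖) := by rw [← h1]; gcongr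
      _ = _ := by ring
  have hexp : ∀ t : ℝ, 0 ≤ t → Real.exp (-(κ * (c * ‖ζ‖ ^ (-a)) * ‖ζ‖ * t)) ≤
      Real.exp (-(κ * c * D * t * ‖ζ‖ ^ (-b))) := fun t ht => by
    refine Real.exp_le_exp.2 (neg_le_neg ?_)
    rw [mul_right_comm]
    exact mul_le_mul_of_nonneg_right hrate ht
  have hconst : K * (c * ‖ζ‖ ^ (-a))⁻¹ ^ q ≤ C * ‖ζ‖ ^ b' := by
    have h1 : (c * ‖ζ‖ ^ (-a))⁻¹ ^ q = c⁻¹ ^ q * ‖ζ‖ ^ (a * q) := by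
      rw [mul_inv, mul_pow, Real.rpow_neg hρ.le, inv_inv, Real.rpow_mul hρ.le, Real.rpow_natCast]
    calc K * (c * ‖ζ‖ ^ (-a))⁻¹ ^ q = K * (c⁻¹ ^ q * ‖ζ‖ ^ (a * q)) := by rw [h1]
      _ ≤ K * (c⁻¹ ^ q * (A * ‖ζ‖ ^ b')) := by gcongr
      _ = K * (c⁻¹ ^ q * A) * ‖ζ‖ ^ b' := by ring
      _ ≤ C * ‖ζ‖ ^ b' := by gcongr
  refine ⟨hdec, fun t ht => ⟨?_, ?_⟩, fun t ht => ?_, fun t ht => (hrest t ht).trans hconst⟩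
  · exact (hminus t ht).trans (mul_le_mul hKC (hexp t ht) (Real.exp_pos _).le hC0.le)
  · refine mul_le_of_le_one_right hC0.le (Real.exp_le_one_iff.2 (neg_nonpos.2 ?_))
    positivity
  · exact (hfull t ht).trans (mul_le_mul hconst (hexp t ht) (Real.exp_pos _).le (by positivity))
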